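/- Let $S^3$ be the unit sphere in $\mathbb{R}^4$, and let $A_1A_2A_3A_4$ be a (nondegenerate) regular tetrahedron in $S^3$: four linearly independent points of $S^3$ at equal pairwise spherical distances. Its edges are the shortest great-circle arcs between the vertices, its faces are the four regular spherical triangles spanned by three of the vertices, and its planar angle $\alpha\in(\pi/3,2\pi/3)$ is the angle of these triangles. A closed geodesic on the tetrahedron is a closed curve on its surface (the union of the four faces) that is locally shortest among curves on the surface; it is simple if it neither intersects itself nor runs along itself. A simple closed geodesic has type $(p,q)$ if it meets each edge of one pair of opposite edges in exactly $p$ points, each edge of another pair of opposite edges in exactly $q$ points, and each edge of the remaining pair of opposite edges in exactly $p+q$ points. Theorem. Let $p,q\ge 0$ be coprime integers with $3(p^2+pq+q^2)\ge\pi^2$ (equivalently, $(p,q)\notin\{(0,1),(1,0),(1,1)\}$), so that the right-hand side below is defined. If the planar angle satisfies $$\alpha>2\arcsin\sqrt{\frac{p^2+pq+q^2}{4(p^2+pq+q^2)-\pi^2}},$$ then there is no simple closed geodesic of type $(p,q)$ on the tetrahedron. -/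

import Mathlib

open Set

noncomputable section

namespace SphericalTetrahedron

/-- The ambient Euclidean four-space; the spherical space `S³` of curvature `1` is its unit sphere. -/
abbrev E4 : Type := EuclideanSpace ℝ (Fin 4)

/-- The angle at the vertex `x` of the spherical triangle with vertices `x`, `y`, `z` on the unit
sphere: the angle between the directions tangent to the sphere at `x` that point along the
great-circle arcs from `x` to `y` and from `x` to `z`. -/
def sphericalAngle (x y z : E4) : ℝ :=
  InnerProductGeometry.angle (y - inner ℝ x y • x) (z - inner ℝ x z • x)

/-- `A 0, A 1, A 2, A 3` are the vertices of a regular tetrahedron in `S³` with planar angle `α`.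
Linear independence says that the four points do not lie on a common great two-sphere. The length
of an edge is the angle between its two end points. -/
structure IsRegularTetrahedron (A : Fin 4 → E4) (α : ℝ) : Prop where
  norm_eq_one : ∀ i, ‖A i‖ = 1
  linearIndependent : LinearIndependent ℝ A
  edges_equal : ∀ i j k l, i ≠ j → k ≠ l →
    InnerProductGeometry.angle (A i) (A j) = InnerProductGeometry.angle (A k) (A l)
  planar_angle : ∀ i j k, i ≠ j → i ≠ k → j ≠ k → sphericalAngle (A i) (A j) (A k) = α

/-- The edge `A i A j`: the shortest great-circle arc between these two vertices. -/
def edge (A : Fin 4 → E4) (i j : Fin 4) : Set E4 :=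
  {x | ‖x‖ = 1 ∧ ∃ s t : ℝ, 0 ≤ s ∧ 0 ≤ t ∧ x = s • A i + t • A j}

/-- The face opposite to the vertex `A i`: the spherical triangle spanned by the other three
vertices (the nonnegative combinations of them that lie on the unit sphere). -/
def face (A : Fin 4 → E4) (i : Fin 4) : Set E4 :=
  {x | ‖x‖ = 1 ∧ ∃ t : Fin 4 → ℝ, (∀ j, 0 ≤ t j) ∧ t i = 0 ∧ x = ∑ j, t j • A j}

/-- The surface of the tetrahedron, the union of its four faces. -/
def surface (A : Fin 4 → E4) : Set E4 := ⋃ i, face A i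

/-- The curve `γ` is locally shortest among the curves on `S`: every sufficiently short arc of `γ`
is at most as long as any curve on `S` with the same end points. The length of a curve is its total
variation. -/
def IsLocallyShortestOn (S : Set E4) (γ : ℝ → E4) : Prop :=
  ∀ t : ℝ, ∃ ε > 0, ∀ a b : ℝ, t - ε ≤ a → a ≤ b → b ≤ t + ε →
    ∀ c : ℝ → E4, ContinuousOn c (Icc a b) → MapsTo c (Icc a b) S → c a = γ a → c b = γ b →
      eVariationOn γ (Icc a b) ≤ eVariationOn c (Icc a b)

/-- `γ` is a simple closed geodesic of length `L` on `S`, parametrized by arc length and extended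
periodically to the whole line. -/
structure IsSimpleClosedGeodesic (S : Set E4) (γ : ℝ → E4) (L : ℝ) : Prop where
  length_pos : 0 < L
  mem_surface : ∀ t, γ t ∈ S
  unit_speed : HasUnitSpeedOn γ univ
  closed : Function.Periodic γ L
  locally_shortest : IsLocallyShortestOn S γ
  simple : InjOn γ (Ico 0 L)

/-- The closed geodesic `γ` has type `(p, q)`: it has exactly `p` points on each of two opposite
edges, exactly `q` points on each of two other opposite edges, and exactly `p + q` points on each of
the remaining two opposite edges. The permutation `σ` chooses which pair of opposite edges is
which. -/
def HasType (A : Fin 4 → E4) (γ : ℝ → E4) (p q : ℕ) : Prop :=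
  ∃ σ : Equiv.Perm (Fin 4),
    (range γ ∩ edge A (σ 0) (σ 1)).encard = (p : ℕ∞) ∧
    (range γ ∩ edge A (σ 2) (σ 3)).encard = (p : ℕ∞) ∧
    (range γ ∩ edge A (σ 0) (σ 2)).encard = (q : ℕ∞) ∧
    (range γ ∩ edge A (σ 1) (σ 3)).encard = (q : ℕ∞) ∧
    (range γ ∩ edge A (σ 0) (σ 3)).encard = ((p + q : ℕ) : ℕ∞) ∧
    (range γ ∩ edge A (σ 1) (σ 2)).encard = ((p + q : ℕ) : ℕ∞)

end SphericalTetrahedron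

end

/-! ### Regular bases, unfolding of faces, crossing sequences. -/

namespace SphericalTetrahedron

open Module

/-! Let `c` be the cosine of the edge length and `N = p² + pq + q²`. The length `L` of a geodesic of
type `(p, q)` is bounded from both sides.

Lower bound: on the flat tetrahedron with the same vertices the edges have length `√(2(1 - c))`, and
a closed geodesic of this type has length `2√(2(1 - c)N)`. In each face it is calibrated by a
constant vector. The calibration still works on the sphere, because chords are shorter than arcs and
the sphere lies outside the flat faces (`CrossingSequence.calibration`).

Upper bound: `L ≤ 2π` (`CrossingSequence.length_le`). Start at the crossing nearest to a vertex on
an edge that is met `p + q` times. The two strands leaving it turn around this vertex and then run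
side by side through the same faces (`Parallel.step`), until they part around another vertex and
meet behind it. Developed into one sphere, the two strands lie on great circles bounding a lune with
sides of length `π` (`CrossingSequence.lune`). At each end the strand closes up around a vertex of
total angle `3α`, where `π < 3α < 2π`; this orders the times at which the strand, prolonged, meets
the corners of the lune (`CrossingSequence.exists_cap_times`). Adding both sides of the lune gives
`L ≤ 2π`.

Together, `2(1 - c)N ≤ π²`. As `cos α = c / (1 + c)`, that is `2(1 + c) sin²(α/2) = 1`, this
contradicts the lower bound assumed for `α`.

These arguments concern crossing sequences only. To obtain one from the metric definition
(`IsTetGeodesic.exists_crossingSequence`), the curve is compared with paths of three great-circle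
arcs. The first variation shows that it is straight inside faces and across edges, and that it
avoids vertices: since `3α < 2π`, on one side of a vertex there is a shortcut. -/

/-- A basis of `E4` consisting of unit vectors with equal pairwise inner products `c`. -/
structure IsRegularBasis (b : Basis (Fin 4) ℝ E4) (c : ℝ) : Prop where
  norm_eq_one : ∀ i, ‖b i‖ = 1
  inner_eq : ∀ i j, i ≠ j → inner ℝ (b i) (b j) = c

section Basics

variable {b : Basis (Fin 4) ℝ E4} {c : ℝ}

/-- The Gram matrix is `(1 - c) I + c J`, with `J` the all-ones matrix. -/
theorem IsRegularBasis.inner_eq_repr (hb : IsRegularBasis b c) (x y : E4) :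
    inner ℝ x y = (1 - c) * ∑ i, b.repr x i * b.repr y i
      + c * ((∑ i, b.repr x i) * ∑ i, b.repr y i) := by
  have hG : ∀ i j, inner ℝ (b i) (b j) = if i = j then (1 : ℝ) else c := by
    intro i j
    split_ifs with h
    · rw [h, real_inner_self_eq_norm_sq, hb.norm_eq_one]; norm_num
    · exact hb.inner_eq i j h
  conv_lhs => rw [← b.sum_repr x, ← b.sum_repr y]
  simp only [sum_inner, inner_sum, inner_smul_left, inner_smul_right, hG]
  simp [Fin.sum_univ_four]
  ring

theorem IsRegularBasis.inner_basis_right (hb : IsRegularBasis b c) (x : E4) (k : Fin 4) :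
    inner ℝ x (b k) = (1 - c) * b.repr x k + c * ∑ i, b.repr x i := by
  rw [hb.inner_eq_repr]
  simp [Finsupp.single_apply]

/-- `1 - c` and `1 + 3c` are the eigenvalues of the Gram matrix. Their positivity amounts to `-1/2 <
c / (1 + c) < 1/2`, that is, to `π/3 < α < 2π/3`. -/
theorem IsRegularBasis.lt_one (hb : IsRegularBasis b c) : c < 1 := by
  have h : b 0 - b 1 ≠ 0 := sub_ne_zero.2 (b.injective.ne (by decide))
  have := real_inner_self_pos.2 h
  rw [hb.inner_eq_repr] at this
  simp [Fin.sum_univ_four] at this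
  linarith

theorem IsRegularBasis.neg_third_lt (hb : IsRegularBasis b c) : -1 / 3 < c := by
  have h : b 0 + b 1 + b 2 + b 3 ≠ 0 := by
    intro h0
    have := congrArg (fun x => b.repr x 0) h0
    simp at this
  have := real_inner_self_pos.2 h
  rw [hb.inner_eq_repr] at this
  simp [Fin.sum_univ_four] at this
  linarith

/-- The linear involution of `E4` that unfolds the face opposite to `b g` and the face opposite to
`b g'` into each other's hyperplanes around their common edge. -/
noncomputable def unfold (b : Basis (Fin 4) ℝ E4) (κ : ℝ) (g g' : Fin 4) : E4 →ₗ[ℝ] E4 where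
  -- For `κ = 2c / (1 + c)` the vertex `b g` goes to the mirror image of `b g'` in the plane spanned
  -- by the common edge.
  toFun x := ∑ k, (if k = g then -b.repr x g' else if k = g' then -b.repr x g
    else b.repr x k + κ * (b.repr x g + b.repr x g')) • b k
  map_add' x y := by
    rw [← Finset.sum_add_distrib]
    refine Finset.sum_congr rfl fun k _ => ?_
    rw [← add_smul]
    congr 1
    split_ifs <;> simp <;> ring
  map_smul' r x := by
    rw [Finset.smul_sum]
    refine Finset.sum_congr rfl fun k _ => ?_
    rw [smul_smul]
    congr 1
    split_ifs
    · simp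
    · simp
    · simp
      ring

theorem repr_unfold (κ : ℝ) (g g' : Fin 4) (x : E4) (k : Fin 4) :
    b.repr (unfold b κ g g' x) k = if k = g then -b.repr x g' else if k = g' then -b.repr x g
    else b.repr x k + κ * (b.repr x g + b.repr x g') := by
  simp only [unfold, LinearMap.coe_mk, AddHom.coe_mk]
  rw [b.repr_sum_self]

theorem unfold_comm (κ : ℝ) (g g' : Fin 4) : unfold b κ g g' = unfold b κ g' g := by
  ext x : 1
  apply b.ext_elem
  intro k
  simp only [repr_unfold]
  rcases eq_or_ne k g with rfl | h <;> rcases eq_or_ne k g' with rfl | h'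
  · simp
  · simp [h']
  · simp [h]
  · simp [h, h', add_comm]

theorem unfold_unfold (κ : ℝ) {g g' : Fin 4} (hg : g ≠ g') (x : E4) :
    unfold b κ g g' (unfold b κ g g' x) = x := by
  apply b.ext_elem
  intro k
  simp only [repr_unfold]
  rcases eq_or_ne k g with rfl | h
  · simp [hg.symm]
  rcases eq_or_ne k g' with rfl | h'
  · simp [h]
  simp only [h, h', if_false, if_true, hg.symm]
  ring

theorem unfold_eq_self (κ : ℝ) {g g' : Fin 4} {x : E4} (h : b.repr x g = 0) (h' : b.repr x g' = 0) :
    unfold b κ g g' x = x := by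
  apply b.ext_elem
  intro k
  rw [repr_unfold]
  split_ifs with h1 h2 <;> simp_all

/-- The great circle through `P i` and `P (i + 1)`, passing them at the times `z i`, `z (i + 1)`. -/
noncomputable def strand (z : ℤ → ℝ) (P : ℤ → E4) (i : ℤ) (t : ℝ) : E4 :=
  (Real.sin (z (i + 1) - z i))⁻¹ •
    (Real.sin (z (i + 1) - t) • P i + Real.sin (t - z i) • P (i + 1))

/-- The combinatorial description of a simple closed geodesic on the tetrahedron: the times `z i` at
which it crosses edges, the crossing points `P i`, and the faces `F i` (labelled by the opposite
vertex) that contain the arcs from `P i` to `P (i + 1)`. -/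
structure CrossingSequence (b : Basis (Fin 4) ℝ E4) (m : ℕ) (L : ℝ) (z : ℤ → ℝ) (P : ℤ → E4)
    (F : ℤ → Fin 4) : Prop where
  period_pos : 0 < m
  z_lt : ∀ i, z i < z (i + 1)
  z_lt_pi : ∀ i, z (i + 1) < z i + Real.pi
  z_period : ∀ i, z (i + m) = z i + L
  P_period : ∀ i, P (i + m) = P i
  F_period : ∀ i, F (i + m) = F i
  norm_P : ∀ i, ‖P i‖ = 1
  coord_pos : ∀ i k, k ≠ F (i - 1) → k ≠ F i → 0 < b.repr (P i) k
  coord_prev : ∀ i, b.repr (P i) (F (i - 1)) = 0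
  coord_self : ∀ i, b.repr (P i) (F i) = 0
  F_ne : ∀ i, F i ≠ F (i - 1)
  -- An arc does not return to the edge from which it came.
  F_ne_two : ∀ i, F (i + 1) ≠ F (i - 1)
  inner_P : ∀ i, inner ℝ (P i) (P (i + 1)) = Real.cos (z (i + 1) - z i)
  -- Equal inner products with the ends of the edge express that the curve crosses it without a
  -- bend.
  straight : ∀ i k, k ≠ F (i - 1) → k ≠ F i → ∀ t,
    inner ℝ (strand z P (i - 1) t) (b k) = inner ℝ (strand z P i t) (b k)
  P_inj : ∀ i j, P i = P j → (m : ℤ) ∣ i - j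
  -- Positive combinations of `P i` and `P (i + 1)` are the positive multiples of interior points of
  -- the arc.
  noncross : ∀ i j (r s u v : ℝ), 0 < r → 0 < s → 0 < u → 0 < v →
    r • P i + s • P (i + 1) = u • P j + v • P (j + 1) → (m : ℤ) ∣ i - j

end Basics

/-! ### Consecutive strands are developments of each other. -/

section Strand

variable {b : Basis (Fin 4) ℝ E4} {c : ℝ} {m : ℕ} {L : ℝ} {z : ℤ → ℝ} {P : ℤ → E4} {F : ℤ → Fin 4}

theorem CrossingSequence.sin_pos (h : CrossingSequence b m L z P F) (i : ℤ) :
    0 < Real.sin (z (i + 1) - z i) :=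
  Real.sin_pos_of_pos_of_lt_pi (by linarith [h.z_lt i]) (by linarith [h.z_lt_pi i])

theorem CrossingSequence.strand_left (h : CrossingSequence b m L z P F) (i : ℤ) :
    strand z P i (z i) = P i := by
  simp [strand, smul_smul, (h.sin_pos i).ne']

theorem CrossingSequence.strand_right (h : CrossingSequence b m L z P F) (i : ℤ) :
    strand z P i (z (i + 1)) = P (i + 1) := by
  simp [strand, smul_smul, (h.sin_pos i).ne']

theorem sin_three_term (a b s t : ℝ) :
    Real.sin (b - a) * Real.sin (s - t) = Real.sin (b - t) * Real.sin (s - a)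
      - Real.sin (a - t) * Real.sin (s - b) := by
  simp only [Real.sin_sub]
  ring

/-- A strand is determined by its values at two times that do not differ by a multiple of `π`. -/
theorem strand_three (i : ℤ) (r s t : ℝ) :
    Real.sin (s - r) • strand z P i t =
      Real.sin (s - t) • strand z P i r + Real.sin (t - r) • strand z P i s := by
  have key : ∀ x : ℝ, Real.sin (s - r) * Real.sin (x - t) =
      Real.sin (s - t) * Real.sin (x - r) + Real.sin (t - r) * Real.sin (x - s) := by
    intro x
    have := sin_three_term r s x t
    rw [this, show r - t = -(t - r) by ring, Real.sin_neg]; ring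
  have key2 : ∀ x : ℝ, Real.sin (s - r) * Real.sin (t - x) =
      Real.sin (s - t) * Real.sin (r - x) + Real.sin (t - r) * Real.sin (s - x) := by
    intro x
    have := key x
    rw [← neg_sub x t, ← neg_sub x r, ← neg_sub x s]
    simp only [Real.sin_neg] at *
    linarith
  simp only [strand, smul_smul, smul_add]
  rw [add_add_add_comm, ← add_smul, ← add_smul]
  congr 2
  · linear_combination (Real.sin (z (i + 1) - z i))⁻¹ * key (z (i + 1))
  · linear_combination (Real.sin (z (i + 1) - z i))⁻¹ * key2 (z i)

theorem CrossingSequence.inner_strand_self (h : CrossingSequence b m L z P F) (i : ℤ) (t : ℝ) :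
    inner ℝ (strand z P i t) (strand z P i t) = 1 := by
  have hs := (h.sin_pos i).ne'
  have e1 : inner ℝ (P i) (P i) = (1 : ℝ) := by
    rw [real_inner_self_eq_norm_sq, h.norm_P]; norm_num
  have e2 : inner ℝ (P (i + 1)) (P (i + 1)) = (1 : ℝ) := by
    rw [real_inner_self_eq_norm_sq, h.norm_P]; norm_num
  simp only [strand, inner_smul_left, inner_smul_right, inner_add_left, inner_add_right, e1, e2,
    h.inner_P, real_inner_comm (P i) (P (i + 1))]
  simp only [map_inv₀, conj_trivial]
  field_simp
  set u := z (i + 1) - t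
  set v := t - z i
  have : z (i + 1) - z i = u + v := by simp only [u, v]; ring
  rw [this, Real.sin_add, Real.cos_add]
  have h1 := Real.sin_sq_add_cos_sq u
  have h2 := Real.sin_sq_add_cos_sq v
  linear_combination -(Real.sin v ^ 2) * h1 - (Real.sin u ^ 2) * h2

theorem CrossingSequence.coord_next (h : CrossingSequence b m L z P F) (i : ℤ) :
    b.repr (P (i + 1)) (F i) = 0 := by
  have := h.coord_prev (i + 1)
  rwa [add_sub_cancel_right] at this

theorem CrossingSequence.repr_strand_face (h : CrossingSequence b m L z P F) (i : ℤ) (t : ℝ) :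
    b.repr (strand z P i t) (F i) = 0 := by
  simp [strand, h.coord_self, h.coord_next]

theorem exists_other_indices (n o : Fin 4) (hno : n ≠ o) : ∃ k l : Fin 4,
    k ≠ n ∧ k ≠ o ∧ l ≠ n ∧ l ≠ o ∧ k ≠ l ∧
      ∀ f : Fin 4 → ℝ, ∑ i, f i = f n + f o + f k + f l := by
  have : ∃ k l : Fin 4, k ≠ n ∧ k ≠ o ∧ l ≠ n ∧ l ≠ o ∧ k ≠ l := by
    revert n o; decide
  obtain ⟨k, l, h1, h2, h3, h4, h5⟩ := this
  refine ⟨k, l, h1, h2, h3, h4, h5, fun f => ?_⟩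
  have hu : (Finset.univ : Finset (Fin 4)) = {n, o, k, l} := by
    revert n o k l; decide
  rw [hu, Finset.sum_insert (by simp [hno, h1.symm, h3.symm]),
    Finset.sum_insert (by simp [h2.symm, h4.symm]), Finset.sum_insert (by simp [h5]),
    Finset.sum_singleton]
  ring

theorem strand_eq_cos_sin (z : ℤ → ℝ) (P : ℤ → E4) (i j : ℤ) (t : ℝ) :
    strand z P i t = Real.cos (t - z j) • strand z P i (z j)
      + Real.sin (t - z j) • strand z P i (z j + Real.pi / 2) := by
  have := strand_three (z := z) (P := P) i (z j) (z j + Real.pi / 2) t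
  rw [add_sub_cancel_left, Real.sin_pi_div_two, one_smul] at this
  rw [this, show z j + Real.pi / 2 - t = Real.pi / 2 - (t - z j) by ring, Real.sin_pi_div_two_sub]

/-- Both great circles pass `P i` at the time `z i`, so only the velocities there have to be
compared. The field `straight` fixes the component along the edge, unit speed fixes the transverse
component up to sign, and the sign follows from the curve moving out of one face into the other. -/
theorem CrossingSequence.strand_unfold (hb : IsRegularBasis b c) (h : CrossingSequence b m L z P F)
    {κ : ℝ} (hκ : κ * (1 + c) = 2 * c) (i : ℤ) (t : ℝ) :
    strand z P i t = unfold b κ (F (i - 1)) (F i) (strand z P (i - 1) t) := by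
  have hc1 := hb.lt_one
  have hc2 := hb.neg_third_lt
  have hend : strand z P (i - 1) (z i) = P i := by
    simpa using h.strand_right (i - 1)
  have hne : F (i - 1) ≠ F i := (h.F_ne i).symm
  -- A quarter period after `z i`, a strand is at its velocity vector at `z i`.
  suffices hV : strand z P i (z i + Real.pi / 2) =
      unfold b κ (F (i - 1)) (F i) (strand z P (i - 1) (z i + Real.pi / 2)) by
    rw [strand_eq_cos_sin z P i i t, strand_eq_cos_sin z P (i - 1) i t, map_add, map_smul, map_smul,
      ← hV, h.strand_left, hend, unfold_eq_self κ (h.coord_prev i) (h.coord_self i)]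
  obtain ⟨k, l, hk, hk', hl, hl', hkl, hsum⟩ := exists_other_indices _ _ hne
  set V := strand z P i (z i + Real.pi / 2) with hVdef
  set W := strand z P (i - 1) (z i + Real.pi / 2) with hWdef
  have hV0 : b.repr V (F i) = 0 := h.repr_strand_face i _
  have hW0 : b.repr W (F (i - 1)) = 0 := h.repr_strand_face (i - 1) _
  have hx : 0 < b.repr V (F (i - 1)) := by
    have h1 := strand_eq_cos_sin z P i i (z (i + 1))
    rw [h.strand_left, h.strand_right] at h1
    have h2 := congrArg (fun x => b.repr x (F (i - 1))) h1
    simp only [map_add, map_smul, Finsupp.add_apply, Finsupp.smul_apply, smul_eq_mul,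
      h.coord_prev i] at h2
    have h3 : 0 < b.repr (P (i + 1)) (F (i - 1)) :=
      h.coord_pos (i + 1) _ (by simpa using hne) (h.F_ne_two i).symm
    rw [h2, mul_zero, zero_add] at h3
    exact pos_of_mul_pos_right h3 (h.sin_pos i).le
  have hy : b.repr W (F i) < 0 := by
    have h1 := strand_eq_cos_sin z P (i - 1) i (z (i - 1))
    rw [h.strand_left, hend] at h1
    have h2 := congrArg (fun x => b.repr x (F i)) h1
    simp only [map_add, map_smul, Finsupp.add_apply, Finsupp.smul_apply, smul_eq_mul,
      h.coord_self i] at h2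
    have h3 : 0 < b.repr (P (i - 1)) (F i) := by
      refine h.coord_pos (i - 1) _ ?_ hne.symm
      have := h.F_ne_two (i - 1)
      rwa [sub_add_cancel] at this
    rw [h2, mul_zero, zero_add, ← neg_sub, Real.sin_neg, neg_mul] at h3
    have h4 := h.sin_pos (i - 1)
    rw [sub_add_cancel] at h4
    by_contra hcon
    have := mul_nonneg h4.le (not_lt.1 hcon)
    linarith
  have ek := h.straight i k hk hk' (z i + Real.pi / 2)
  have el := h.straight i l hl hl' (z i + Real.pi / 2)
  have eV := h.inner_strand_self i (z i + Real.pi / 2)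
  have eW := h.inner_strand_self (i - 1) (z i + Real.pi / 2)
  rw [← hVdef] at eV ek el
  rw [← hWdef] at eW ek el
  rw [hb.inner_basis_right, hb.inner_basis_right, hsum, hsum, hV0, hW0] at ek el
  rw [hb.inner_eq_repr, hsum, hsum, hV0] at eV
  rw [hb.inner_eq_repr, hsum, hsum, hW0] at eW
  set x := b.repr V (F (i - 1))
  set y := b.repr W (F i)
  set d := b.repr V k - b.repr W k with hd
  have hdl : b.repr V l - b.repr W l = d := by
    have : (1 - c) * (b.repr V l - b.repr W l - d) = 0 := by rw [hd]; linarith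
    rcases mul_eq_zero.1 this with h0 | h0 <;> linarith
  have hVk : b.repr V k = b.repr W k + d := by rw [hd]; ring
  have hVl : b.repr V l = b.repr W l + d := by rw [← hdl]; ring
  rw [hVk, hVl] at ek eV
  have hdxy : (1 + c) * d = -c * (x - y) := by linarith
  -- Equal norms leave `x = -y` or `x - y = d`; the latter is excluded by `hpos`.
  have hprod : (1 - c) * ((x + y) * (x - y - d)) = 0 := by
    linear_combination eV - eW + (-2 * (b.repr W k + b.repr W l + y) - (2 * d + x - y)) * hdxy
  have hpos : 0 < x - y - d := by
    have : (1 + c) * (x - y - d) = (1 + 2 * c) * (x - y) := by linarith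
    have h2 : 0 < (1 + 2 * c) * (x - y) := mul_pos (by linarith) (by linarith)
    rw [← this] at h2
    exact pos_of_mul_pos_right h2 (by linarith)
  have hxy : x = -y := by
    rcases mul_eq_zero.1 hprod with h0 | h0
    · linarith
    rcases mul_eq_zero.1 h0 with h0 | h0 <;> linarith
  have hdy : d = κ * y := by
    have : (1 + c) * (d - κ * y) = 0 := by
      rw [hxy] at hdxy
      linear_combination hdxy - y * hκ
    rcases mul_eq_zero.1 this with h0 | h0 <;> linarith
  apply b.ext_elem
  intro j
  rw [repr_unfold]
  have hj : j = F (i - 1) ∨ j = F i ∨ j = k ∨ j = l := by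
    have : ∀ n o k l j : Fin 4, n ≠ o → k ≠ n → k ≠ o → l ≠ n → l ≠ o → k ≠ l →
      j = n ∨ j = o ∨ j = k ∨ j = l := by decide
    exact this _ _ _ _ _ hne hk hk' hl hl' hkl
  rcases hj with rfl | rfl | rfl | rfl
  · simpa using hxy
  · simp [hne.symm, hV0, hW0]
  · simp only [hk, hk', if_false, hW0, zero_add, hVk, hdy]; rfl
  · simp only [hl, hl', if_false, hW0, zero_add, hVl, hdy]; rfl

end Strand

end SphericalTetrahedron

/-! ### The cap that a geodesic forms around a vertex. -/

namespace SphericalTetrahedron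

open Module

theorem exists_polar {x y : ℝ} (hx : 0 < x) : ∃ ρ θ : ℝ, 0 < ρ ∧ -(Real.pi / 2) < θ ∧
    θ < Real.pi / 2 ∧ x = ρ * Real.cos θ ∧ y = ρ * Real.sin θ := by
  have hc := Real.cos_arctan_pos (y / x)
  refine ⟨x / Real.cos (Real.arctan (y / x)), Real.arctan (y / x), div_pos hx hc,
    Real.neg_pi_div_two_lt_arctan _, Real.arctan_lt_pi_div_two _, (div_mul_cancel₀ _ hc.ne').symm, ?_⟩
  have h2 : Real.tan (Real.arctan (y / x)) = y / x := Real.tan_arctan _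
  rw [Real.tan_eq_sin_div_cos, div_eq_iff hc.ne'] at h2
  rw [h2]
  field_simp

/-- Two sinusoids that are positive multiples of reflected translates of each other: their zeros are
ordered and lie within half a period of the points where the sinusoids are positive. -/
theorem exists_sinusoid_zeros {H₀ H₁ l a e z₀ zp zm : ℝ} (hH : 0 < H₀) (hl : 0 < l) (ha : 0 < a)
    (he : 0 < e) (hp : z₀ < zp) (hp' : zp < z₀ + Real.pi) (hm : zm < z₀) (hm' : z₀ < zm + Real.pi)
    {f g : ℝ → ℝ}
    (hf : ∀ t, f t = a * (H₀ * Real.cos (t - z₀) + H₁ * Real.sin (t - z₀))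
      + e * (l * (H₀ * Real.sin (t - z₀) - H₁ * Real.cos (t - z₀))))
    (hg : ∀ t, g t = a * (H₀ * Real.cos (t - z₀) + H₁ * Real.sin (t - z₀))
      - e * (l * (H₀ * Real.sin (t - z₀) - H₁ * Real.cos (t - z₀))))
    (hfp : 0 < f zp) (hgm : 0 < g zm) :
    ∃ τ τ' : ℝ, f τ = 0 ∧ g τ' = 0 ∧ zp - Real.pi < τ ∧ τ < zp ∧ zm < τ' ∧ τ' < zm + Real.pi ∧
      τ ≤ τ' := by
  obtain ⟨ρ, θ, hρ, hθ1, hθ2, rfl, rfl⟩ := exists_polar (y := H₁) hH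
  obtain ⟨r, s, hr, hs1, hs2, hrc, hrs⟩ := exists_polar (y := a) (mul_pos he hl)
  have hs0 : 0 < s := by
    by_contra hcon
    have := Real.sin_nonpos_of_nonpos_of_neg_pi_le (not_lt.1 hcon) (by linarith [Real.pi_pos])
    have := mul_nonpos_of_nonneg_of_nonpos hr.le this
    linarith
  -- The cosine-phase sinusoid has its maximum at `z₀ + θ`, and `0 < s < π/2`. The zeros are `z₀ + θ
  -- - s` and `z₀ + θ + s`, hence ordered.
  have hf' : ∀ t, f t = ρ * r * Real.sin (t - z₀ - θ + s) := by
    intro t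
    rw [hf]
    generalize t - z₀ = x
    rw [Real.sin_add, Real.sin_sub, Real.cos_sub]
    linear_combination (ρ * Real.cos θ * Real.cos x + ρ * Real.sin θ * Real.sin x) * hrs
      + ρ * (Real.cos θ * Real.sin x - Real.sin θ * Real.cos x) * hrc
  have hg' : ∀ t, g t = ρ * r * Real.sin (s - (t - z₀ - θ)) := by
    intro t
    rw [hg]
    generalize t - z₀ = x
    rw [Real.sin_sub s, Real.sin_sub _ θ, Real.cos_sub _ θ]
    linear_combination (ρ * Real.cos θ * Real.cos x + ρ * Real.sin θ * Real.sin x) * hrs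
      - ρ * (Real.cos θ * Real.sin x - Real.sin θ * Real.cos x) * hrc
  have hpos : 0 < ρ * r := mul_pos hρ hr
  have key : ∀ x, -Real.pi < x → x < 2 * Real.pi → 0 < Real.sin x → 0 < x ∧ x < Real.pi := by
    intro x h1 h2 h3
    constructor
    · by_contra hcon
      linarith [Real.sin_nonpos_of_nonpos_of_neg_pi_le (not_lt.1 hcon) h1.le]
    · by_contra hcon
      have := Real.sin_nonneg_of_nonneg_of_le_pi (x := x - Real.pi) (by linarith) (by linarith)
      rw [Real.sin_sub_pi] at this
      linarith
  rw [hf'] at hfp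
  rw [hg'] at hgm
  have h1 := key _ (by linarith) (by linarith) (pos_of_mul_pos_right hfp hpos.le)
  have h2 := key _ (by linarith) (by linarith) (pos_of_mul_pos_right hgm hpos.le)
  refine ⟨z₀ + θ - s, z₀ + θ + s, ?_, ?_, by linarith, by linarith, by linarith, by linarith,
    by linarith⟩
  · rw [hf', show z₀ + θ - s - z₀ - θ + s = 0 by ring, Real.sin_zero, mul_zero]
  · rw [hg', show s - (z₀ + θ + s - z₀ - θ) = 0 by ring, Real.sin_zero, mul_zero]

/-- Two sinusoids `H`, `I` on an ellipse with `I ^ 2 = M - (M + 1) * H ^ 2` are conjugate. -/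
theorem conjugate_of_sq_eq {H₀ H₁ I₀ I₁ M : ℝ} (hM : 0 < M) (hH : 0 < H₀)
    (hJ : 0 < H₀ * I₁ - I₀ * H₁) (h0 : I₀ ^ 2 = M - (M + 1) * H₀ ^ 2)
    (h1 : I₁ ^ 2 = M - (M + 1) * H₁ ^ 2)
    (h2 : (I₀ + I₁) ^ 2 = 2 * M - (M + 1) * (H₀ + H₁) ^ 2) :
    ∃ l, 0 < l ∧ I₀ = -(l * H₁) ∧ I₁ = l * H₀ := by
  have h3 : I₀ * I₁ = -((M + 1) * (H₀ * H₁)) := by linear_combination (h2 - h0 - h1) / 2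
  -- The product `I₀² I₁²`, computed from `h0` and `h1`, is compared with the square of `h3`.
  have h4 : M * (M - (M + 1) * (H₀ ^ 2 + H₁ ^ 2)) = 0 := by
    linear_combination (I₀ * I₁ - (M + 1) * (H₀ * H₁)) * h3 - I₁ ^ 2 * h0
      - (M - (M + 1) * H₀ ^ 2) * h1
  have h5 : M - (M + 1) * (H₀ ^ 2 + H₁ ^ 2) = 0 := (mul_eq_zero.1 h4).resolve_left hM.ne'
  have h6 : (H₀ * I₀ + H₁ * I₁) ^ 2 = 0 := by
    linear_combination H₀ ^ 2 * h0 + H₁ ^ 2 * h1 + 2 * H₀ * H₁ * h3 + (H₀ ^ 2 + H₁ ^ 2) * h5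
  have h7 : H₀ * I₀ + H₁ * I₁ = 0 := by simpa using h6
  have hl : I₁ / H₀ * H₀ = I₁ := div_mul_cancel₀ _ hH.ne'
  have hI0 : I₀ = -(I₁ / H₀ * H₁) := by
    field_simp
    linarith
  refine ⟨I₁ / H₀, ?_, hI0, hl.symm⟩
  rw [hI0, ← hl] at hJ
  have h8 : 0 < I₁ / H₀ * (H₀ ^ 2 + H₁ ^ 2) := by
    rw [mul_div_cancel_right₀ _ hH.ne'] at hJ
    nlinarith
  exact pos_of_mul_pos_left h8 (by positivity)

theorem exists_conjugate {H I : ℝ → ℝ} {z₀ M : ℝ}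
    (hH : ∀ t, H t = H z₀ * Real.cos (t - z₀) + H (z₀ + Real.pi / 2) * Real.sin (t - z₀))
    (hI : ∀ t, I t = I z₀ * Real.cos (t - z₀) + I (z₀ + Real.pi / 2) * Real.sin (t - z₀))
    (hM : 0 < M) (hH0 : 0 < H z₀)
    (hJ : 0 < H z₀ * I (z₀ + Real.pi / 2) - I z₀ * H (z₀ + Real.pi / 2))
    (hE : ∀ t, I t ^ 2 = M - (M + 1) * H t ^ 2) :
    ∃ l, 0 < l ∧ ∀ t, I t = l * (H z₀ * Real.sin (t - z₀)
      - H (z₀ + Real.pi / 2) * Real.cos (t - z₀)) := by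
  -- An eighth of a period supplies the mixed term that the values at `z₀` and `z₀ + π/2` do not
  -- give.
  have hquarter : (I z₀ + I (z₀ + Real.pi / 2)) ^ 2 =
      2 * M - (M + 1) * (H z₀ + H (z₀ + Real.pi / 2)) ^ 2 := by
    have w := hE (z₀ + Real.pi / 4)
    rw [hI (z₀ + Real.pi / 4), hH (z₀ + Real.pi / 4), add_sub_cancel_left, Real.sin_pi_div_four,
      Real.cos_pi_div_four] at w
    have h2 : Real.sqrt 2 ^ 2 = 2 := Real.sq_sqrt (by norm_num)
    linear_combination 2 * w - (I z₀ + I (z₀ + Real.pi / 2)) ^ 2 / 2 * h2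
      - (M + 1) * (H z₀ + H (z₀ + Real.pi / 2)) ^ 2 / 2 * h2
  obtain ⟨l, hl, h0, h1⟩ := conjugate_of_sq_eq hM hH0 hJ (hE _) (hE _) hquarter
  exact ⟨l, hl, fun t => by rw [hI, h0, h1]; ring⟩

theorem fin_four_sum {v f g h : Fin 4} (h1 : v ≠ f) (h2 : v ≠ g) (h3 : v ≠ h) (h4 : f ≠ g)
    (h5 : f ≠ h) (h6 : g ≠ h) (u : Fin 4 → ℝ) : ∑ i, u i = u v + u f + u g + u h := by
  have hu : (Finset.univ : Finset (Fin 4)) = {v, f, g, h} := by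
    revert v f g h; decide
  rw [hu, Finset.sum_insert (by simp [*]), Finset.sum_insert (by simp [*]),
    Finset.sum_insert (by simp [*]), Finset.sum_singleton]
  ring

theorem fin_four_cases {v f g h : Fin 4} (h1 : v ≠ f) (h2 : v ≠ g) (h3 : v ≠ h) (h4 : f ≠ g)
    (h5 : f ≠ h) (h6 : g ≠ h) (j : Fin 4) : j = v ∨ j = f ∨ j = g ∨ j = h := by
  revert v f g h j; decide

variable {b : Basis (Fin 4) ℝ E4} {c : ℝ} {m : ℕ} {L : ℝ} {z : ℤ → ℝ} {P : ℤ → E4} {F : ℤ → Fin 4}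

/-- Two vectors of the hyperplane `x f = 0` span the kernel of a functional in it. -/
theorem mem_span_of_functional {v f g h : Fin 4} (h1 : v ≠ f) (h2 : v ≠ g) (h3 : v ≠ h) (h4 : f ≠ g)
    (h5 : f ≠ h) (h6 : g ≠ h) {x p q : E4} (hx : b.repr x f = 0) (hp : b.repr p f = 0)
    (hq : b.repr q f = 0) (hpv : b.repr p v ≠ 0) (hph : b.repr p h = 0) (hqv : b.repr q v = 0)
    (hqh : b.repr q h ≠ 0) {ng nh : ℝ} (hng : ng ≠ 0)
    (hNx : b.repr x v + b.repr x g * ng + b.repr x h * nh = 0)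
    (hNp : b.repr p v + b.repr p g * ng + b.repr p h * nh = 0)
    (hNq : b.repr q v + b.repr q g * ng + b.repr q h * nh = 0) :
    ∃ r s : ℝ, x = r • p + s • q := by
  refine ⟨b.repr x v / b.repr p v, b.repr x h / b.repr q h, ?_⟩
  apply b.ext_elem
  intro j
  simp only [map_add, map_smul, Finsupp.add_apply, Finsupp.smul_apply, smul_eq_mul]
  rcases fin_four_cases h1 h2 h3 h4 h5 h6 j with rfl | rfl | rfl | rfl
  · rw [hqv]; field_simp; simp
  · rw [hx, hp, hq]; simp
  · apply mul_left_cancel₀ hng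
    have e1 : b.repr x v / b.repr p v * b.repr p v = b.repr x v := div_mul_cancel₀ _ hpv
    have e2 : b.repr x h / b.repr q h * b.repr q h = b.repr x h := div_mul_cancel₀ _ hqh
    rw [hph] at hNp
    rw [hqv] at hNq
    linear_combination hNx - b.repr x v / b.repr p v * hNp - b.repr x h / b.repr q h * hNq
      + e1 + nh * e2
  · rw [hph]; field_simp; simp

-- The crossings `k - 1`, `k`, `k + 1` lie on the three edges at the vertex `v`, and the two outer
-- arcs lie in the same face `f`. Developing the three faces around `v` sweeps out the angle `3α`
-- and preserves the height `H`, the inner product with `b v`. A functional vanishing on one outer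
-- great circle, evaluated along the other, is `(1 - cos 3α) H - (sin 3α) I` or `(1 - cos 3α) H +
-- (sin 3α) I`, where `I` is conjugate to `H`. The zeros are therefore symmetric about the summit of
-- `H`, and `sin 3α < 0` decides their order.
set_option maxHeartbeats 1000000 in
theorem CrossingSequence.exists_cap_times (hb : IsRegularBasis b c)
    (hS : CrossingSequence b m L z P F) (k : ℤ) (hF : F (k - 2) = F (k + 1))
    (hF' : F (k - 3) = F (k + 2)) :
    ∃ τ τ' : ℝ, (∃ r s : ℝ, strand z P (k + 1) τ = r • P (k - 1) + s • P (k - 2)) ∧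
      (∃ r s : ℝ, strand z P (k - 2) τ' = r • P (k + 1) + s • P (k + 2)) ∧
      z (k + 1) - Real.pi < τ ∧ τ < z (k + 1) ∧ z (k - 1) < τ' ∧ τ' < z (k - 1) + Real.pi ∧
      τ ≤ τ' := by
  have hc1 := hb.lt_one
  have hc2 := hb.neg_third_lt
  obtain ⟨v, hv⟩ : ∃ v, v = F (k + 2) := ⟨_, rfl⟩
  obtain ⟨f, hf⟩ : ∃ f, f = F (k + 1) := ⟨_, rfl⟩
  obtain ⟨g, hg⟩ : ∃ g, g = F k := ⟨_, rfl⟩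
  obtain ⟨h, hh⟩ : ∃ h, h = F (k - 1) := ⟨_, rfl⟩
  have a1 : k - 1 - 1 = k - 2 := by ring
  have a2 : k + 1 - 1 = k := by ring
  have a3 : k + 1 + 1 = k + 2 := by ring
  have a4 : k + 2 - 1 = k + 1 := by ring
  have a5 : k - 2 - 1 = k - 3 := by ring
  have a6 : k - 2 + 1 = k - 1 := by ring
  have a7 : k - 1 + 1 = k := by ring
  have n1 : v ≠ f := by have := hS.F_ne (k + 2); rwa [a4, ← hv, ← hf] at this
  have n2 : v ≠ g := by have := hS.F_ne_two (k + 1); rwa [a3, a2, ← hv, ← hg] at this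
  have n3 : v ≠ h := by
    have := hS.F_ne_two (k - 2); rw [a6, a5, hF', ← hv, ← hh] at this; exact this.symm
  have n4 : f ≠ g := by have := hS.F_ne (k + 1); rwa [a2, ← hf, ← hg] at this
  have n5 : f ≠ h := by
    have := hS.F_ne (k - 1); rw [a1, hF, ← hf, ← hh] at this; exact this.symm
  have n6 : g ≠ h := by have := hS.F_ne k; rwa [← hg, ← hh] at this
  have hsum := fin_four_sum n1 n2 n3 n4 n5 n6
  -- positions of the crossing points
  have p1v : 0 < b.repr (P (k + 1)) v :=
    hS.coord_pos _ _ (by rw [a2, ← hg]; exact n2) (by rw [← hf]; exact n1)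
  have p1h : 0 < b.repr (P (k + 1)) h :=
    hS.coord_pos _ _ (by rw [a2, ← hg]; exact n6.symm) (by rw [← hf]; exact n5.symm)
  have p1g : b.repr (P (k + 1)) g = 0 := by have := hS.coord_prev (k + 1); rwa [a2, ← hg] at this
  have p1f : b.repr (P (k + 1)) f = 0 := by have := hS.coord_self (k + 1); rwa [← hf] at this
  have p2h : 0 < b.repr (P (k + 2)) h :=
    hS.coord_pos _ _ (by rw [a4, ← hf]; exact n5.symm) (by rw [← hv]; exact n3.symm)
  have p2g : 0 < b.repr (P (k + 2)) g :=
    hS.coord_pos _ _ (by rw [a4, ← hf]; exact n4.symm) (by rw [← hv]; exact n2.symm)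
  have p2f : b.repr (P (k + 2)) f = 0 := by have := hS.coord_prev (k + 2); rwa [a4, ← hf] at this
  have p2v : b.repr (P (k + 2)) v = 0 := by have := hS.coord_self (k + 2); rwa [← hv] at this
  have p0v : 0 < b.repr (P k) v :=
    hS.coord_pos _ _ (by rw [← hh]; exact n3) (by rw [← hg]; exact n2)
  have p0f : 0 < b.repr (P k) f :=
    hS.coord_pos _ _ (by rw [← hh]; exact n5) (by rw [← hg]; exact n4)
  have p0h : b.repr (P k) h = 0 := by have := hS.coord_prev k; rwa [← hh] at this
  have p0g : b.repr (P k) g = 0 := by have := hS.coord_self k; rwa [← hg] at this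
  have q1v : 0 < b.repr (P (k - 1)) v :=
    hS.coord_pos _ _ (by rw [a1, hF, ← hf]; exact n1) (by rw [← hh]; exact n3)
  have q1g : 0 < b.repr (P (k - 1)) g :=
    hS.coord_pos _ _ (by rw [a1, hF, ← hf]; exact n4.symm) (by rw [← hh]; exact n6)
  have q1f : b.repr (P (k - 1)) f = 0 := by
    have := hS.coord_prev (k - 1); rwa [a1, hF, ← hf] at this
  have q1h : b.repr (P (k - 1)) h = 0 := by have := hS.coord_self (k - 1); rwa [← hh] at this
  have q2h : 0 < b.repr (P (k - 2)) h :=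
    hS.coord_pos _ _ (by rw [a5, hF', ← hv]; exact n3.symm) (by rw [hF, ← hf]; exact n5.symm)
  have q2g : 0 < b.repr (P (k - 2)) g :=
    hS.coord_pos _ _ (by rw [a5, hF', ← hv]; exact n2.symm) (by rw [hF, ← hf]; exact n4.symm)
  have q2v : b.repr (P (k - 2)) v = 0 := by
    have := hS.coord_prev (k - 2); rwa [a5, hF', ← hv] at this
  have q2f : b.repr (P (k - 2)) f = 0 := by
    have := hS.coord_self (k - 2); rwa [hF, ← hf] at this
  -- trigonometric constants
  have hc0 : 0 < 1 + c := by linarith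
  -- `C` and `S` are the cosine and sine of the planar angle.
  obtain ⟨C, hC⟩ : ∃ C, C = c / (1 + c) := ⟨_, rfl⟩
  have hCc : C * (1 + c) = c := by rw [hC]; exact div_mul_cancel₀ _ hc0.ne'
  have hC1 : C < 1 / 2 := by rw [hC, div_lt_iff₀ hc0]; linarith
  have hC2 : -(1 / 2) < C := by rw [hC, lt_div_iff₀ hc0]; linarith
  have hC3 : 0 < 1 - C ^ 2 := by
    rw [show 1 - C ^ 2 = (1 - C) * (1 + C) by ring]
    exact mul_pos (by linarith) (by linarith)
  obtain ⟨S, hSpos, hS2⟩ : ∃ S, 0 < S ∧ S ^ 2 = 1 - C ^ 2 :=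
    ⟨Real.sqrt (1 - C ^ 2), Real.sqrt_pos.2 hC3, Real.sq_sqrt hC3.le⟩
  have hκ : 2 * C * (1 + c) = 2 * c := by linarith
  -- the developed coordinates
  have crd0 : ∀ t, b.repr (strand z P (k - 1) t) h = 0 := by
    intro t; have := hS.repr_strand_face (k - 1) t; rwa [← hh] at this
  set X : ℝ → E4 := strand z P (k - 1) with hX
  have e0 : ∀ t, strand z P k t = unfold b (2 * C) h g (X t) := by
    intro t; rw [hS.strand_unfold hb hκ k t, ← hh, ← hg]
  have e1 : ∀ t, strand z P (k + 1) t = unfold b (2 * C) g f (unfold b (2 * C) h g (X t)) := by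
    intro t; rw [hS.strand_unfold hb hκ (k + 1) t, a2, ← hf, ← hg, e0]
  have e2 : ∀ t, strand z P (k - 2) t = unfold b (2 * C) f h (X t) := by
    intro t
    have := hS.strand_unfold hb hκ (k - 1) t
    rw [a1, hF, ← hf, ← hh] at this
    rw [hX, this, unfold_unfold _ n5]
  have s1g : ∀ t, b.repr (strand z P (k + 1) t) g
      = -(b.repr (X t) f + 2 * C * b.repr (X t) g) := by
    intro t; rw [e1]; simp [repr_unfold, n4, n5, crd0]
  have s1h : ∀ t, b.repr (strand z P (k + 1) t) h
      = -b.repr (X t) g + 2 * C * (b.repr (X t) f + 2 * C * b.repr (X t) g) := by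
    intro t; rw [e1]; simp [repr_unfold, n4, n5, n5.symm, n6, n6.symm, crd0]
  have s1f : ∀ t, b.repr (strand z P (k + 1) t) f = 0 := by
    intro t; rw [e1]; simp [repr_unfold, n4, n6, crd0]
  have s2g : ∀ t, b.repr (strand z P (k - 2) t) g = b.repr (X t) g + 2 * C * b.repr (X t) f := by
    intro t; rw [e2]; simp [repr_unfold, n4.symm, n6, crd0]
  have s2h : ∀ t, b.repr (strand z P (k - 2) t) h = -b.repr (X t) f := by
    intro t; rw [e2]; simp [repr_unfold, n5.symm]
  have s2f : ∀ t, b.repr (strand z P (k - 2) t) f = 0 := by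
    intro t; rw [e2]; simp [repr_unfold, crd0]
  have i1 : ∀ t, inner ℝ (strand z P (k + 1) t) (b v) = inner ℝ (X t) (b v) := by
    intro t
    have u1 := hS.straight (k + 1) v (by rw [a2, ← hg]; exact n2) (by rw [← hf]; exact n1) t
    have u2 := hS.straight k v (by rw [← hh]; exact n3) (by rw [← hg]; exact n2) t
    rw [a2] at u1
    rw [← u1, ← u2]
  have i2 : ∀ t, inner ℝ (strand z P (k - 2) t) (b v) = inner ℝ (X t) (b v) := by
    intro t
    have u1 := hS.straight (k - 1) v (by rw [a1, hF, ← hf]; exact n1) (by rw [← hh]; exact n3) t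
    rwa [a1] at u1
  have Xz0 : X (z k) = P k := by have := hS.strand_right (k - 1); rwa [a7] at this
  have Xzm : X (z (k - 1)) = P (k - 1) := hS.strand_left (k - 1)
  have zlt1 := hS.z_lt k
  have zlt2 := hS.z_lt (k - 1)
  have zlp1 := hS.z_lt_pi k
  have zlp2 := hS.z_lt_pi (k - 1)
  rw [a7] at zlt2 zlp2
  have hsin : 0 < Real.sin (z k - z (k - 1)) := by have := hS.sin_pos (k - 1); rwa [a7] at this
  -- the functional that expresses the height along the great circle
  obtain ⟨l, hl⟩ : ∃ l, l = inner ℝ (P (k - 1)) (b v) / b.repr (P (k - 1)) g := ⟨_, rfl⟩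
  obtain ⟨μ, hμ⟩ : ∃ μ, μ = inner ℝ (P k) (b v) / b.repr (P k) f := ⟨_, rfl⟩
  -- Place the edges towards `b g` and `b f` at the angles `0` and `α` in a Euclidean plane. The
  -- height is then the inner product with `(l, η)`, whose value on the second edge is `μ`.
  obtain ⟨η, hη⟩ : ∃ η, η = (μ - l * C) / S := ⟨_, rfl⟩
  have hμη : μ = l * C + η * S := by rw [hη]; field_simp; ring
  have hH : ∀ t, inner ℝ (X t) (b v) = l * b.repr (X t) g + μ * b.repr (X t) f := by
    intro t
    have u := strand_three (z := z) (P := P) (k - 1) (z (k - 1)) (z k) t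
    rw [← hX, Xz0, Xzm] at u
    have u1 := congrArg (fun x => inner ℝ x (b v)) u
    have u2 := congrArg (fun x => b.repr x g) u
    have u3 := congrArg (fun x => b.repr x f) u
    simp only [inner_add_left, inner_smul_left, conj_trivial, map_add, map_smul, Finsupp.add_apply,
      Finsupp.smul_apply, smul_eq_mul] at u1 u2 u3
    rw [p0g] at u2
    rw [q1f] at u3
    have w1 : inner ℝ (P (k - 1)) (b v) = l * b.repr (P (k - 1)) g := by
      rw [hl, div_mul_cancel₀ _ q1g.ne']
    have w2 : inner ℝ (P k) (b v) = μ * b.repr (P k) f := by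
      rw [hμ, div_mul_cancel₀ _ p0f.ne']
    apply mul_left_cancel₀ hsin.ne'
    rw [u1, w1, w2]
    linear_combination -l * u2 - μ * u3
  -- The inner product with `(-η, l)`, which is `(l, η)` turned by a right angle.
  obtain ⟨I, hI⟩ : ∃ I : ℝ → ℝ, I = fun t => -η * b.repr (X t) g + (l * S - η * C) * b.repr (X t) f :=
    ⟨_, rfl⟩
  -- the functionals vanishing on the two developed great circles
  have N2 : ∀ x : E4, inner ℝ x (b v) - (l * b.repr x g + (l * C - η * S) * b.repr x h) =
      b.repr x v + b.repr x g * (c - l) + b.repr x h * (c - (l * C - η * S)) + c * b.repr x f := by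
    intro x; rw [hb.inner_basis_right, hsum]; ring
  -- In the development, strand `k + 1` runs between the edges to `b h` and `b g` at the angles `2α`
  -- and `3α`, strand `k - 2` between those to `b h` and `b g` at `-α` and `0`. The coefficients are
  -- the values of `(l, η)` on these edges.
  have N1 : ∀ x : E4, inner ℝ x (b v) - ((l * (2 * C ^ 2 - 1) + η * (2 * S * C)) * b.repr x h
      + (l * (4 * C ^ 3 - 3 * C) + η * (S * (4 * C ^ 2 - 1))) * b.repr x g) =
      b.repr x v + b.repr x g * (c - (l * (4 * C ^ 3 - 3 * C) + η * (S * (4 * C ^ 2 - 1))))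
      + b.repr x h * (c - (l * (2 * C ^ 2 - 1) + η * (2 * S * C))) + c * b.repr x f := by
    intro x; rw [hb.inner_basis_right, hsum]; ring
  obtain ⟨ng, hng⟩ : ∃ x, x = c - l := ⟨_, rfl⟩
  obtain ⟨nh, hnh⟩ : ∃ x, x = c - (l * C - η * S) := ⟨_, rfl⟩
  obtain ⟨mg, hmg⟩ : ∃ x, x = c - (l * (4 * C ^ 3 - 3 * C) + η * (S * (4 * C ^ 2 - 1))) := ⟨_, rfl⟩
  obtain ⟨mh, hmh⟩ : ∃ x, x = c - (l * (2 * C ^ 2 - 1) + η * (2 * S * C)) := ⟨_, rfl⟩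
  rw [← hng, ← hnh] at N2
  rw [← hmg, ← hmh] at N1
  have N2b : ∀ t, b.repr (strand z P (k - 2) t) v + b.repr (strand z P (k - 2) t) g * ng
      + b.repr (strand z P (k - 2) t) h * nh = 0 := by
    intro t
    have := N2 (strand z P (k - 2) t)
    rw [s2f, i2, hH, s2g, s2h, hμη] at this
    rw [s2g, s2h]
    linear_combination -this
  have N1b : ∀ t, b.repr (strand z P (k + 1) t) v + b.repr (strand z P (k + 1) t) g * mg
      + b.repr (strand z P (k + 1) t) h * mh = 0 := by
    intro t
    have := N1 (strand z P (k + 1) t)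
    rw [s1f, i1, hH, s1g, s1h, hμη] at this
    rw [s1g, s1h]
    linear_combination -this
  have N2a : ∀ t, b.repr (strand z P (k + 1) t) v + b.repr (strand z P (k + 1) t) g * ng
      + b.repr (strand z P (k + 1) t) h * nh =
      (1 - (4 * C ^ 3 - 3 * C)) * inner ℝ (X t) (b v) + S * (1 - 4 * C ^ 2) * I t := by
    intro t
    have := N2 (strand z P (k + 1) t)
    rw [s1f, i1, hH, s1g, s1h, hμη] at this
    rw [s1g, s1h, hH, hμη, hI]
    linear_combination -this + b.repr (X t) f * l * (4 * C ^ 2 - 1) * hS2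
  have N1a : ∀ t, b.repr (strand z P (k - 2) t) v + b.repr (strand z P (k - 2) t) g * mg
      + b.repr (strand z P (k - 2) t) h * mh =
      (1 - (4 * C ^ 3 - 3 * C)) * inner ℝ (X t) (b v) - S * (1 - 4 * C ^ 2) * I t := by
    intro t
    have := N1 (strand z P (k - 2) t)
    rw [s2f, i2, hH, s2g, s2h, hμη] at this
    rw [s2g, s2h, hH, hμη, hI]
    linear_combination -this - b.repr (X t) f * l * (4 * C ^ 2 - 1) * hS2
  -- signs of the functionals at the vertices
  have u1 := N2b (z (k - 1))
  have u2 := N2b (z (k - 2))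
  have u3 := N1b (z (k + 1))
  have u4 := N1b (z (k + 2))
  have Xq1 : strand z P (k - 2) (z (k - 1)) = P (k - 1) := by
    have := hS.strand_right (k - 2); rwa [a6] at this
  have Xp2 : strand z P (k + 1) (z (k + 2)) = P (k + 2) := by
    have := hS.strand_right (k + 1); rwa [a3] at this
  rw [Xq1, q1h, zero_mul, add_zero] at u1
  rw [hS.strand_left, q2v, zero_add] at u2
  rw [hS.strand_left, p1g, zero_mul, add_zero] at u3
  rw [Xp2, p2v, zero_add] at u4
  have hng0 : ng < 0 := by
    by_contra hcon
    linarith [mul_nonneg q1g.le (not_lt.1 hcon)]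
  have hnh0 : 0 < nh := by
    by_contra hcon
    linarith [mul_nonneg q2h.le (neg_nonneg.2 (not_lt.1 hcon)), mul_pos q2g (neg_pos.2 hng0)]
  have hmh0 : mh < 0 := by
    by_contra hcon
    linarith [mul_nonneg p1h.le (not_lt.1 hcon)]
  have hmg0 : 0 < mg := by
    by_contra hcon
    linarith [mul_nonneg p2g.le (neg_nonneg.2 (not_lt.1 hcon)), mul_pos p2h (neg_pos.2 hmh0)]
  have hμ0 : 0 < μ := by
    have e : (nh - mh) + (mg - ng) = μ * (2 * ((1 - C) * (1 + 2 * C))) := by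
      rw [hnh, hmh, hmg, hng, hμη]; ring
    have e' : 0 < 2 * ((1 - C) * (1 + 2 * C)) := by
      have := mul_pos (show 0 < 1 - C by linarith) (show 0 < 1 + 2 * C by linarith)
      linarith
    have e'' : 0 < μ * (2 * ((1 - C) * (1 + 2 * C))) := by rw [← e]; linarith
    exact pos_of_mul_pos_left e'' e'.le
  -- the sinusoids
  have hcs : ∀ t, X t = Real.cos (t - z k) • X (z k) + Real.sin (t - z k) • X (z k + Real.pi / 2) :=
    fun t => strand_eq_cos_sin z P (k - 1) k t
  have hHt : ∀ t, inner ℝ (X t) (b v) = inner ℝ (X (z k)) (b v) * Real.cos (t - z k)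
      + inner ℝ (X (z k + Real.pi / 2)) (b v) * Real.sin (t - z k) := by
    intro t
    conv_lhs => rw [hcs t]
    simp only [inner_add_left, inner_smul_left, conj_trivial]
    ring
  have hIt : ∀ t, I t = I (z k) * Real.cos (t - z k) + I (z k + Real.pi / 2) * Real.sin (t - z k) := by
    intro t
    simp only [hI]
    conv_lhs => rw [hcs t]
    simp only [map_add, map_smul, Finsupp.add_apply, Finsupp.smul_apply, smul_eq_mul]
    ring
  have hH0 : 0 < inner ℝ (X (z k)) (b v) := by
    rw [hH, Xz0, p0g, mul_zero, zero_add]; exact mul_pos hμ0 p0f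
  have hlη : 0 < l ^ 2 + η ^ 2 := by
    rcases eq_or_ne l 0 with h0 | h0
    · rcases eq_or_ne η 0 with h0' | h0'
      · rw [hμη, h0, h0'] at hμ0; simp at hμ0
      · positivity
    · positivity
  have hJ : 0 < inner ℝ (X (z k)) (b v) * I (z k + Real.pi / 2)
      - I (z k) * inner ℝ (X (z k + Real.pi / 2)) (b v) := by
    have w1 := hHt (z (k - 1))
    have w2 := hIt (z (k - 1))
    have w3 : inner ℝ (X (z k)) (b v) * I (z (k - 1)) - I (z k) * inner ℝ (X (z (k - 1))) (b v)
        = -(b.repr (P (k - 1)) g * b.repr (P k) f * S * (l ^ 2 + η ^ 2)) := by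
      rw [hH, hH, hI]
      simp only [Xz0, Xzm, p0g, q1f, hμη]
      ring
    rw [w1, w2] at w3
    have w4 : Real.sin (z k - z (k - 1)) * (inner ℝ (X (z k)) (b v) * I (z k + Real.pi / 2)
      - I (z k) * inner ℝ (X (z k + Real.pi / 2)) (b v)) =
      b.repr (P (k - 1)) g * b.repr (P k) f * S * (l ^ 2 + η ^ 2) := by
      rw [← neg_sub (z (k - 1)), Real.sin_neg]
      linear_combination -w3
    have w5 : 0 < b.repr (P (k - 1)) g * b.repr (P k) f * S * (l ^ 2 + η ^ 2) := by positivity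
    rw [← w4] at w5
    exact pos_of_mul_pos_right w5 hsin.le
  have hcc : 0 < 1 - c ^ 2 := by
    rw [show 1 - c ^ 2 = (1 - c) * (1 + c) by ring]
    exact mul_pos (by linarith) hc0
  -- With `Q` the quadratic form of the developed plane, the strand satisfies `H² + (1 - c²) Q = 1`,
  -- while `H² + I² = (l² + η²) Q`. Eliminating `Q` gives the ellipse.
  have hM : ∀ t, I t ^ 2 = (l ^ 2 + η ^ 2) / (1 - c ^ 2)
      - ((l ^ 2 + η ^ 2) / (1 - c ^ 2) + 1) * inner ℝ (X t) (b v) ^ 2 := by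
    intro t
    have w1 := hS.inner_strand_self (k - 1) t
    rw [← hX, hb.inner_eq_repr, hsum, hsum, crd0] at w1
    have w2 := hH t
    have w3 : inner ℝ (X t) (b v) = b.repr (X t) v + c * (b.repr (X t) g + b.repr (X t) f) := by
      rw [hb.inner_basis_right, hsum, crd0]; ring
    have w4 : inner ℝ (X t) (b v) ^ 2 + (1 - c ^ 2) * (b.repr (X t) g ^ 2 + b.repr (X t) f ^ 2
        + 2 * C * b.repr (X t) g * b.repr (X t) f) = 1 := by
      rw [w3]
      linear_combination w1 + 2 * (1 - c) * b.repr (X t) g * b.repr (X t) f * hCc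
    have w5 : inner ℝ (X t) (b v) ^ 2 + I t ^ 2 = (l ^ 2 + η ^ 2) * (b.repr (X t) g ^ 2
        + b.repr (X t) f ^ 2 + 2 * C * b.repr (X t) g * b.repr (X t) f) := by
      rw [w2, hI, hμη]
      linear_combination (l ^ 2 + η ^ 2) * b.repr (X t) f ^ 2 * hS2
    have w6 : (l ^ 2 + η ^ 2) / (1 - c ^ 2) * (1 - c ^ 2) = l ^ 2 + η ^ 2 :=
      div_mul_cancel₀ _ hcc.ne'
    apply mul_left_cancel₀ hcc.ne'
    linear_combination (1 - c ^ 2) * w5 + (l ^ 2 + η ^ 2) * w4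
      - (1 - inner ℝ (X t) (b v) ^ 2) * w6
  obtain ⟨r, hr, hIr⟩ := exists_conjugate hHt hIt (div_pos hlη hcc) hH0 hJ hM
  have ha : 0 < 1 - (4 * C ^ 3 - 3 * C) := by
    have : 1 - (4 * C ^ 3 - 3 * C) = (1 - C) * (1 + 2 * C) ^ 2 := by ring
    rw [this]
    have h1 : 0 < 1 - C := by linarith
    have h2 : 0 < 1 + 2 * C := by linarith
    positivity
  have he : 0 < S * (1 - 4 * C ^ 2) := by
    rw [show 1 - 4 * C ^ 2 = (1 - 2 * C) * (1 + 2 * C) by ring]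
    exact mul_pos hSpos (mul_pos (by linarith) (by linarith))
  obtain ⟨τ, τ', h1, h2, h3, h4, h5, h6, h7⟩ := exists_sinusoid_zeros hH0 hr ha he zlt1 zlp1 zlt2 zlp2
    (f := fun t => b.repr (strand z P (k + 1) t) v + b.repr (strand z P (k + 1) t) g * ng
      + b.repr (strand z P (k + 1) t) h * nh)
    (g := fun t => b.repr (strand z P (k - 2) t) v + b.repr (strand z P (k - 2) t) g * mg
      + b.repr (strand z P (k - 2) t) h * mh)
    (fun t => by rw [N2a, hIr, hHt t]) (fun t => by rw [N1a, hIr, hHt t])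
    (by
      simp only [hS.strand_left, p1g, zero_mul, add_zero]
      exact add_pos p1v (mul_pos p1h hnh0))
    (by
      simp only [Xq1, q1h, zero_mul, add_zero]
      exact add_pos q1v (mul_pos q1g hmg0))
  refine ⟨τ, τ', ?_, ?_, h3, h4, h5, h6, h7⟩
  · refine mem_span_of_functional n1 n2 n3 n4 n5 n6 (s1f τ) q1f q2f q1v.ne' q1h q2v q2h.ne'
      hng0.ne h1 ?_ ?_
    · rw [q1h, zero_mul, add_zero, u1]
    · rw [q2v, zero_add, u2]
  · refine mem_span_of_functional n1 n3 n2 n5 n4 n6.symm (s2f τ') p1f p2f p1v.ne' p1g p2v p2g.ne'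
      (ng := mh) (nh := mg) hmh0.ne ?_ ?_ ?_
    · linear_combination h2
    · rw [p1g]; linear_combination u3
    · rw [p2v]; linear_combination u4

end SphericalTetrahedron

/-! ### Symmetries of crossing sequences, and the lune bounded by two parallel strands. -/

namespace SphericalTetrahedron

open Module

variable {b : Basis (Fin 4) ℝ E4} {c : ℝ} {m : ℕ} {L : ℝ} {z : ℤ → ℝ} {P : ℤ → E4} {F : ℤ → Fin 4}

theorem CrossingSequence.congr_of_dvd (h : CrossingSequence b m L z P F) {i j : ℤ}
    (hij : (m : ℤ) ∣ i - j) : P i = P j ∧ F i = F j := by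
  obtain ⟨n, hn⟩ := hij
  have hi : i = j + n * m := by linarith
  have hP : Function.Periodic P m := h.P_period
  have hF : Function.Periodic F m := h.F_period
  rw [hi]
  exact ⟨by simpa using hP.int_mul n j, by simpa using hF.int_mul n j⟩

theorem CrossingSequence.z_add_mul (h : CrossingSequence b m L z P F) (i n : ℤ) :
    z (i + n * m) = z i + n * L := by
  induction n using Int.induction_on with
  | zero => simp
  | succ n ih =>
    rw [show i + ((n : ℤ) + 1) * m = (i + n * m) + m by ring, h.z_period, ih]; push_cast; ring
  | pred n ih =>
    have := h.z_period (i + (-(n : ℤ) - 1) * m)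
    rw [show i + (-(n : ℤ) - 1) * m + m = i + -(n : ℤ) * m by ring, ih] at this
    push_cast at *; linarith

theorem CrossingSequence.strictMono (h : CrossingSequence b m L z P F) : StrictMono z :=
  strictMono_int_of_lt_succ h.z_lt

theorem CrossingSequence.length_pos (h : CrossingSequence b m L z P F) : 0 < L := by
  have h1 := h.strictMono (show (0 : ℤ) < 0 + m by simpa using h.period_pos)
  rw [h.z_period] at h1
  linarith

theorem CrossingSequence.shift (h : CrossingSequence b m L z P F) (n : ℤ) :
    CrossingSequence b m L (fun i => z (i + n)) (fun i => P (i + n)) (fun i => F (i + n)) := by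
  have e1 : ∀ i : ℤ, i + 1 + n = i + n + 1 := fun i => by ring
  have e2 : ∀ i : ℤ, i - 1 + n = i + n - 1 := fun i => by ring
  have e3 : ∀ i : ℤ, i + m + n = i + n + m := fun i => by ring
  have e4 : ∀ i t, strand (fun i => z (i + n)) (fun i => P (i + n)) i t = strand z P (i + n) t := by
    intro i t; simp only [strand, e1]
  constructor
  · exact h.period_pos
  · intro i; simpa only [e1] using h.z_lt (i + n)
  · intro i; simpa only [e1] using h.z_lt_pi (i + n)
  · intro i; simpa only [e3] using h.z_period (i + n)
  · intro i; simpa only [e3] using h.P_period (i + n)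
  · intro i; simpa only [e3] using h.F_period (i + n)
  · intro i; exact h.norm_P (i + n)
  · intro i k; simpa only [e2] using h.coord_pos (i + n) k
  · intro i; simpa only [e2] using h.coord_prev (i + n)
  · intro i; exact h.coord_self (i + n)
  · intro i; simpa only [e2] using h.F_ne (i + n)
  · intro i; simpa only [e1, e2] using h.F_ne_two (i + n)
  · intro i; simpa only [e1] using h.inner_P (i + n)
  · intro i k; simpa only [e4, e2] using h.straight (i + n) k
  · intro i j hij
    have := h.P_inj (i + n) (j + n) hij
    rwa [add_sub_add_right_eq_sub] at this
  · intro i j r s u v hr hs hu hv hij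
    simp only [e1] at hij
    have := h.noncross (i + n) (j + n) r s u v hr hs hu hv hij
    rwa [add_sub_add_right_eq_sub] at this

theorem strand_neg (z : ℤ → ℝ) (P : ℤ → E4) (i : ℤ) (t : ℝ) :
    strand (fun i => -z (-i)) (fun i => P (-i)) i t = strand z P (-i - 1) (-t) := by
  have e1 : -i - 1 + 1 = -i := by ring
  have e2 : -(i + 1) = -i - 1 := by ring
  simp only [strand, e1, e2]
  rw [show -z (-i - 1) - -z (-i) = z (-i) - z (-i - 1) by ring,
    show -z (-i - 1) - t = -t - z (-i - 1) by ring, show t - -z (-i) = z (-i) - -t by ring,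
    add_comm]

/-- The same geodesic traversed backwards. -/
theorem CrossingSequence.reverse (h : CrossingSequence b m L z P F) :
    CrossingSequence b m L (fun i => -z (-i)) (fun i => P (-i)) (fun i => F (-i - 1)) := by
  have e1 : ∀ i : ℤ, -i - 1 + 1 = -i := fun i => by ring
  have e2 : ∀ i : ℤ, -(i + 1) = -i - 1 := fun i => by ring
  have e3 : ∀ i : ℤ, -(i - 1) - 1 = -i := fun i => by ring
  have e4 : ∀ i : ℤ, -(i + m) + m = -i := fun i => by ring
  have e5 : ∀ i : ℤ, -(i + m) - 1 + m = -i - 1 := fun i => by ring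
  have e6 : ∀ i : ℤ, -(i - 1) - 1 = -i := fun i => by ring
  constructor
  · exact h.period_pos
  · intro i
    have := h.z_lt (-i - 1)
    rw [e1] at this
    simp only [e2]; linarith
  · intro i
    have := h.z_lt_pi (-i - 1)
    rw [e1] at this
    simp only [e2]; linarith
  · intro i
    have := h.z_period (-(i + m))
    rw [e4] at this
    linarith
  · intro i; have := h.P_period (-(i + m)); rw [e4] at this; exact this.symm
  · intro i; have := h.F_period (-(i + m) - 1); rw [e5] at this; exact this.symm
  · intro i; exact h.norm_P (-i)
  · intro i k h1 h2
    simp only [e6] at h1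
    exact h.coord_pos (-i) k h2 h1
  · intro i; simp only [e6]; exact h.coord_self (-i)
  · intro i; exact h.coord_prev (-i)
  · intro i; simp only [e6]; exact (h.F_ne (-i)).symm
  · intro i
    have := h.F_ne_two (-i - 1)
    rw [e1] at this
    simp only [e6, e2]; exact this.symm
  · intro i
    have := h.inner_P (-i - 1)
    rw [e1] at this
    simp only [e2]
    rw [real_inner_comm, this]; congr 1; ring
  · intro i k h1 h2 t
    simp only [e6] at h1
    rw [strand_neg, strand_neg, e6]
    exact (h.straight (-i) k h2 h1 (-t)).symm
  · intro i j hij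
    have := h.P_inj (-i) (-j) hij
    rwa [← dvd_neg, show -(i - j) = -i - -j by ring]
  · intro i j r s u v hr hs hu hv hij
    simp only [e2] at hij
    have := h.noncross (-i - 1) (-j - 1) s r v u hs hr hv hu (by
      rw [e1, e1, add_comm, hij, add_comm])
    rwa [← dvd_neg, show -(i - j) = -i - 1 - (-j - 1) by ring]

/-- No point of the arc from `P j` to `P (j + 1)` lies on the great circle of the arc from `P (-j)`
to `P (-j - 1)`. -/
def ArcMisses (P : ℤ → E4) (j : ℤ) : Prop :=
  ∀ r s u v : ℝ, 0 ≤ r → 0 ≤ s → 0 < r + s →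
    r • P j + s • P (j + 1) ≠ u • P (-j) + v • P (-j - 1)

theorem strand_add_pi (i : ℤ) (t : ℝ) : strand z P i (t + Real.pi) = -strand z P i t := by
  simp only [strand]
  rw [show z (i + 1) - (t + Real.pi) = z (i + 1) - t - Real.pi by ring, Real.sin_sub_pi,
    show t + Real.pi - z i = t - z i + Real.pi by ring, Real.sin_add_pi]
  module

/-- The great circles of two strands of the geodesic that run through the same faces in opposite
directions, without meeting, bound a lune of length `π`. -/
theorem CrossingSequence.lune (hb : IsRegularBasis b c) (h : CrossingSequence b m L z P F) {M : ℤ}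
    (hM : 3 ≤ M) (hF : ∀ j, 1 ≤ j → j ≤ M - 2 → F j = F (-j - 1))
    (hmiss : ∀ j, 1 ≤ j → j ≤ M - 2 → ArcMisses P j) {τ τ' : ℝ}
    (hτ : ∃ r s : ℝ, strand z P 1 τ = r • P (-1) + s • P (-2)) (hτ1 : z 1 - Real.pi < τ)
    (hτ2 : τ < z 1)
    (hτ' : ∃ r s : ℝ, strand z P (M - 2) τ' = r • P (-(M - 2)) + s • P (-(M - 2) - 1))
    (hτ1' : z (M - 1) < τ') (hτ2' : τ' < z (M - 1) + Real.pi) : τ' = τ + Real.pi := by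
  have hc0 : 0 < 1 + c := by linarith [hb.neg_third_lt]
  have hκ : 2 * c / (1 + c) * (1 + c) = 2 * c := div_mul_cancel₀ _ hc0.ne'
  -- Development carries the common point of the two great circles at the time `τ` from face to
  -- face. Its antipode, at the time `τ + π`, is also common to them, so an arc that misses the
  -- other great circle must end before that time.
  have key : ∀ n : ℕ, 1 + (n : ℤ) ≤ M - 2 →
      (∃ r s : ℝ, strand z P (1 + n) τ = r • P (-(1 + n)) + s • P (-(1 + n) - 1)) ∧
        z (1 + n + 1) < τ + Real.pi := by
    have step : ∀ j, 1 ≤ j → j ≤ M - 2 → z j < τ + Real.pi →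
        (∃ r s : ℝ, strand z P j τ = r • P (-j) + s • P (-j - 1)) →
        z (j + 1) < τ + Real.pi := by
      rintro j hj1 hj2 hlt ⟨r, s, hrs⟩
      by_contra hcon
      have h1 := strand_add_pi (z := z) (P := P) j τ
      rw [hrs] at h1
      set t := τ + Real.pi
      have hsin := h.sin_pos j
      have h2 : 0 < Real.sin (t - z j) :=
        Real.sin_pos_of_pos_of_lt_pi (by linarith) (by linarith [h.z_lt_pi j])
      have h3 : 0 ≤ Real.sin (z (j + 1) - t) :=
        Real.sin_nonneg_of_nonneg_of_le_pi (by linarith) (by linarith [h.z_lt_pi j])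
      refine hmiss j hj1 hj2 (Real.sin (z (j + 1) - t)) (Real.sin (t - z j))
        (-(Real.sin (z (j + 1) - z j) * r)) (-(Real.sin (z (j + 1) - z j) * s)) h3 h2.le
        (by linarith) ?_
      have h4 : Real.sin (z (j + 1) - z j) • strand z P j t =
          Real.sin (z (j + 1) - t) • P j + Real.sin (t - z j) • P (j + 1) := by
        simp only [strand]
        rw [smul_inv_smul₀ hsin.ne']
      rw [← h4, h1]
      module
    intro n
    induction n with
    | zero =>
      intro hn
      simp only [Nat.cast_zero, add_zero] at *
      exact ⟨hτ, step 1 le_rfl hn (by linarith) hτ⟩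
    | succ n ih =>
      intro hn
      push_cast at hn ⊢
      obtain ⟨⟨r, s, hrs⟩, hlt⟩ := ih (by linarith)
      set j : ℤ := 1 + n with hj
      have hj1 : 1 ≤ j := by omega
      rw [show 1 + ((n : ℤ) + 1) = j + 1 by omega]
      have hFj := hF j hj1 (by omega)
      have hFj1 := hF (j + 1) (by omega) (by omega)
      have e1 : -(j + 1) = -j - 1 := by ring
      have e2 : -(j + 1) - 1 = -j - 1 - 1 := by ring
      rw [e2] at hFj1
      have hU1 : unfold b (2 * c / (1 + c)) (F j) (F (j + 1)) (P (-j - 1)) = P (-j - 1) := by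
        apply unfold_eq_self
        · rw [hFj]; exact h.coord_self _
        · rw [hFj1]; exact h.coord_prev _
      have hU2 : unfold b (2 * c / (1 + c)) (F j) (F (j + 1)) (P (-j))
          = strand z P (-j - 1 - 1) (z (-j)) := by
        have h1 := h.strand_unfold hb hκ (-j - 1) (z (-j))
        have h2 := h.strand_right (-j - 1)
        rw [sub_add_cancel] at h2
        rw [h2, ← hFj, ← hFj1, unfold_comm] at h1
        rw [h1, unfold_unfold]
        have := h.F_ne (j + 1)
        rw [add_sub_cancel_right] at this
        exact this.symm
      have hZ : ∃ r s : ℝ, strand z P (j + 1) τ = r • P (-(j + 1)) + s • P (-(j + 1) - 1) := by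
        have h1 := h.strand_unfold hb hκ (j + 1) τ
        rw [add_sub_cancel_right, hrs, map_add, map_smul, map_smul, hU1, hU2] at h1
        rw [h1, e1]
        simp only [strand, sub_add_cancel]
        set a := (Real.sin (z (-j - 1) - z (-j - 1 - 1)))⁻¹
        exact ⟨r * a * Real.sin (z (-j) - z (-j - 1 - 1)) + s,
          r * a * Real.sin (z (-j - 1) - z (-j)), by module⟩
      exact ⟨hZ, step (j + 1) (by omega) (by omega) hlt hZ⟩
  obtain ⟨n, hn⟩ := Int.eq_ofNat_of_zero_le (show 0 ≤ M - 3 by omega)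
  obtain ⟨hZ, hlt⟩ := key n (by omega)
  rw [show 1 + (n : ℤ) = M - 2 by omega] at hZ hlt
  rw [show M - 2 + 1 = M - 1 by ring] at hlt
  have hz1 : z 1 ≤ z (M - 1) := h.strictMono.monotone (by omega)
  -- the zeros are spaced by `π`
  have hsin : Real.sin (τ' - τ) = 0 := by
    by_contra hne
    obtain ⟨r, s, hrs⟩ := hZ
    obtain ⟨r', s', hrs'⟩ := hτ'
    -- Two independent common points would make the great circles equal, and then `P (M - 2)` would
    -- lie on the one that its arc misses.
    have h3 := strand_three (z := z) (P := P) (M - 2) τ τ' (z (M - 2))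
    rw [h.strand_left, hrs, hrs'] at h3
    set x := Real.sin (τ' - z (M - 2))
    set y := Real.sin (z (M - 2) - τ)
    refine hmiss (M - 2) (by omega) le_rfl 1 0
      ((Real.sin (τ' - τ))⁻¹ * (x * r + y * r')) ((Real.sin (τ' - τ))⁻¹ * (x * s + y * s'))
      zero_le_one le_rfl (by norm_num) ?_
    rw [one_smul, zero_smul, add_zero, eq_comm, ← inv_smul_smul₀ hne (P (M - 2)), h3]
    module
  -- `τ' - τ` is a multiple of `π` strictly between `0` and `2π`.
  by_contra hne
  rcases lt_or_gt_of_ne hne with hlt' | hgt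
  · exact (Real.sin_pos_of_pos_of_lt_pi (by linarith) (by linarith)).ne' hsin
  · have h4 : Real.sin (τ' - τ - Real.pi) = 0 := by rw [Real.sin_sub_pi, hsin, neg_zero]
    exact (Real.sin_pos_of_pos_of_lt_pi (by linarith) (by linarith)).ne' h4

/-- A closed geodesic one of whose sides is a chain of faces closed up by two caps has length at
most `2π`. -/
theorem CrossingSequence.length_le_two_pi (hb : IsRegularBasis b c)
    (h : CrossingSequence b m L z P F) {M : ℤ} (hM : 4 ≤ M) (hPM : P M = P (-M))
    (hF : ∀ j, 1 ≤ j → j ≤ M - 2 → F j = F (-j - 1))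
    (hmiss : ∀ j, 1 ≤ j → j ≤ M - 2 → ArcMisses P j)
    (hmiss' : ∀ j, 1 ≤ j → j ≤ M - 2 → ArcMisses (fun i => P (-i)) j) : L ≤ 2 * Real.pi := by
  -- The stretch from crossing `-M` to crossing `M` covers `n` periods, so its length is `n * L`.
  obtain ⟨n, hn⟩ := h.P_inj _ _ hPM
  have hm : 0 < (m : ℤ) := by exact_mod_cast h.period_pos
  have hn0 : 0 < n := by
    by_contra hcon
    have := mul_nonpos_of_nonneg_of_nonpos hm.le (not_lt.1 hcon)
    omega
  have hn' : M + M = n * m := by linarith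
  have hshift : ∀ i, P (i + n * m) = P i ∧ F (i + n * m) = F i := by
    intro i; apply h.congr_of_dvd; exact ⟨n, by ring⟩
  have c1 : F (0 - 2) = F (0 + 1) := (hF 1 le_rfl (by omega)).symm
  have c2 : F (0 - 3) = F (0 + 2) := (hF 2 (by omega) (by omega)).symm
  have c3 : F (M - 2) = F (M + 1) := by
    rw [hF (M - 2) (by omega) le_rfl, ← (hshift (-(M - 2) - 1)).2]; congr 1; linarith
  have c4 : F (M - 3) = F (M + 2) := by
    rw [hF (M - 3) (by omega) (by omega), ← (hshift (-(M - 3) - 1)).2]; congr 1; linarith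
  obtain ⟨τ, τ', hτ, hτ', t1, t2, t3, t4, t5⟩ := h.exists_cap_times hb 0 c1 c2
  obtain ⟨σ, σ', hσ, hσ', s1, s2, s3, s4, s5⟩ := h.exists_cap_times hb M c3 c4
  simp only [zero_add, zero_sub] at hτ hτ' t1 t2 t3 t4
  have f1 : σ' = τ + Real.pi := by
    refine h.lune hb (by omega) hF hmiss hτ t1 t2 ?_ s3 s4
    obtain ⟨r, s, hrs⟩ := hσ'
    refine ⟨s, r, ?_⟩
    rw [hrs, add_comm, ← (hshift (-(M - 2))).1, ← (hshift (-(M - 2) - 1)).1]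
    congr 3 <;> linarith
  -- The other side of the lune is treated by reversing the sequence; the far cap is moved back by
  -- `n` periods.
  have f2 : -(σ - n * L) = -τ' + Real.pi := by
    refine h.reverse.lune (M := M) hb (by omega) ?_ hmiss' ?_ ?_ ?_ ?_ ?_ ?_
    · intro j h1 h2
      rw [← hF j h1 h2]; congr 1; ring
    · rw [strand_neg, neg_neg]
      simpa using hτ'
    · linarith
    · linarith
    · obtain ⟨r, s, hrs⟩ := hσ
      refine ⟨s, r, ?_⟩
      rw [strand_neg, neg_neg]
      have e0 : -(M - 2) - 1 + n * m = M + 1 := by linarith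
      have e1 : strand z P (-(M - 2) - 1) (σ - n * L) = strand z P (M + 1) σ := by
        rw [← e0]
        simp only [strand]
        have z1 := h.z_add_mul (-(M - 2) - 1) n
        have z2 := h.z_add_mul (-(M - 2) - 1 + 1) n
        have p1 := (hshift (-(M - 2) - 1)).1
        have p2 := (hshift (-(M - 2) - 1 + 1)).1
        rw [show -(M - 2) - 1 + n * m + 1 = -(M - 2) - 1 + 1 + n * m by ring, z1, z2, p1, p2]
        congr 3
        · ring_nf
        · ring_nf
        · ring_nf
      rw [e1, hrs, add_comm]
      congr 3
      · ring
      · ring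
    · have z1 := h.z_add_mul (-(M - 1)) n
      rw [show -(M - 1) + n * m = M + 1 by linarith] at z1
      linarith
    · have z1 := h.z_add_mul (-(M - 1)) n
      rw [show -(M - 1) + n * m = M + 1 by linarith] at z1
      linarith
  -- Here `σ' = τ + π`, `σ = nL + τ' - π`, and the caps give `τ ≤ τ'` and `σ ≤ σ'`.
  have hnL : n * L ≤ 2 * Real.pi := by linarith
  have hL := h.length_pos
  have : (1 : ℝ) ≤ n := by exact_mod_cast hn0
  nlinarith

end SphericalTetrahedron

/-! ### The arcs inside one face and their order. -/

namespace SphericalTetrahedron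

open Module

/-- Convention for what follows: the edges met `p + q` times, called heavy, are those joining `k` to
`Fin.rev k`. The faces `g` and `Fin.rev g` share such an edge; it is the only heavy one of the face
`g`, and `Fin.rev g` is the vertex opposite to it there. -/
theorem rev_ne_self (k : Fin 4) : Fin.rev k ≠ k := by revert k; decide

theorem rev_eq_or {g k j : Fin 4} (h : k ≠ g) (h' : k ≠ Fin.rev g) (hj : j ≠ g)
    (hj' : j ≠ Fin.rev g) : j = k ∨ j = Fin.rev k := by
  revert g k j; decide

variable {b : Basis (Fin 4) ℝ E4} {c : ℝ} {m : ℕ} {L : ℝ} {z : ℤ → ℝ} {P : ℤ → E4} {F : ℤ → Fin 4}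

/-- For two points of an edge with end points `b k`, `b l`, this is positive if and only if the
first of them is nearer to `b k`. -/
noncomputable def cross (b : Basis (Fin 4) ℝ E4) (k l : Fin 4) (x y : E4) : ℝ :=
  b.repr x k * b.repr y l - b.repr x l * b.repr y k

theorem cross_swap (k l : Fin 4) (x y : E4) : cross b l k x y = -cross b k l x y := by
  simp only [cross]; ring

theorem cross_anti (k l : Fin 4) (x y : E4) : cross b k l y x = -cross b k l x y := by
  simp only [cross]; ring

/-- `x` is a crossing point on the common edge of the faces `g` and `g'`. -/
def OnEdge (P : ℤ → E4) (F : ℤ → Fin 4) (g g' : Fin 4) (x : E4) : Prop :=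
  ∃ i, P i = x ∧ ((F (i - 1) = g ∧ F i = g') ∨ (F (i - 1) = g' ∧ F i = g))

theorem OnEdge.symm {g g' : Fin 4} {x : E4} (h : OnEdge P F g g' x) : OnEdge P F g' g x := by
  obtain ⟨i, h1, h2⟩ := h
  exact ⟨i, h1, h2.symm⟩

/-- The points `x` on the edge `{k, rev k}` and `y` on the edge `{k, rev g}` are the ends of an arc
in the face `g`. -/
def Corner (P : ℤ → E4) (F : ℤ → Fin 4) (g k : Fin 4) (x y : E4) : Prop :=
  k ≠ g ∧ k ≠ Fin.rev g ∧ ∃ i, F i = g ∧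
    ((P i = x ∧ P (i + 1) = y ∧ F (i - 1) = Fin.rev g ∧ F (i + 1) = Fin.rev k) ∨
      (P i = y ∧ P (i + 1) = x ∧ F (i - 1) = Fin.rev k ∧ F (i + 1) = Fin.rev g))

theorem Corner.onEdge_left {g k : Fin 4} {x y : E4} (h : Corner P F g k x y) :
    OnEdge P F g (Fin.rev g) x := by
  obtain ⟨-, -, i, hi, ⟨h1, h2, h3, h4⟩ | ⟨h1, h2, h3, h4⟩⟩ := h
  · exact ⟨i, h1, Or.inr ⟨h3, hi⟩⟩
  · exact ⟨i + 1, h2, Or.inl ⟨by simpa using hi, h4⟩⟩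

theorem Corner.onEdge_right {g k : Fin 4} {x y : E4} (h : Corner P F g k x y) :
    OnEdge P F g (Fin.rev k) y := by
  obtain ⟨-, -, i, hi, ⟨h1, h2, h3, h4⟩ | ⟨h1, h2, h3, h4⟩⟩ := h
  · exact ⟨i + 1, h2, Or.inl ⟨by simpa using hi, h4⟩⟩
  · exact ⟨i, h1, Or.inr ⟨h3, hi⟩⟩

theorem OnEdge.coords (h : CrossingSequence b m L z P F) {g g' : Fin 4} {x : E4}
    (hx : OnEdge P F g g' x) : b.repr x g = 0 ∧ b.repr x g' = 0 ∧
      ∀ k, k ≠ g → k ≠ g' → 0 < b.repr x k := by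
  obtain ⟨i, rfl, ⟨rfl, rfl⟩ | ⟨rfl, rfl⟩⟩ := hx
  · exact ⟨h.coord_prev i, h.coord_self i, h.coord_pos i⟩
  · exact ⟨h.coord_self i, h.coord_prev i, fun k h1 h2 => h.coord_pos i k h2 h1⟩

theorem OnEdge.norm_eq_one (h : CrossingSequence b m L z P F) {g g' : Fin 4} {x : E4}
    (hx : OnEdge P F g g' x) : ‖x‖ = 1 := by
  obtain ⟨i, rfl, -⟩ := hx
  exact h.norm_P i

theorem OnEdge.eq_of_cross_eq_zero (h : CrossingSequence b m L z P F) {g g' k l : Fin 4} {x y : E4}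
    (hx : OnEdge P F g g' x) (hy : OnEdge P F g g' y) (hkg : k ≠ g) (hkg' : k ≠ g') (hlg : l ≠ g)
    (hlg' : l ≠ g') (hkl : k ≠ l) (hgg : g ≠ g') (h0 : cross b k l x y = 0) : x = y := by
  obtain ⟨x1, x2, x3⟩ := hx.coords h
  obtain ⟨y1, y2, y3⟩ := hy.coords h
  have hxk := x3 k hkg hkg'
  have hyk := y3 k hkg hkg'
  have hxy : x = (b.repr x k / b.repr y k) • y := by
    apply b.ext_elem
    intro j
    simp only [map_smul, Finsupp.smul_apply, smul_eq_mul]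
    rcases fin_four_cases hkl hkg hkg' hlg hlg' hgg j with rfl | rfl | rfl | rfl
    · rw [div_mul_cancel₀ _ hyk.ne']
    · simp only [cross] at h0
      field_simp
      linarith
    · rw [x1, y1, mul_zero]
    · rw [x2, y2, mul_zero]
  have hn := hx.norm_eq_one h
  rw [hxy, norm_smul, hy.norm_eq_one h, mul_one, Real.norm_of_nonneg (by positivity)] at hn
  rw [hxy, hn, one_smul]

theorem Corner.coords (h : CrossingSequence b m L z P F) {g k : Fin 4} {x y : E4}
    (hc : Corner P F g k x y) : (0 < b.repr x k ∧ 0 < b.repr x (Fin.rev k) ∧ b.repr x g = 0 ∧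
      b.repr x (Fin.rev g) = 0) ∧ (0 < b.repr y k ∧ 0 < b.repr y (Fin.rev g) ∧ b.repr y g = 0 ∧
      b.repr y (Fin.rev k) = 0) := by
  obtain ⟨h1, h2, -⟩ := id hc
  obtain ⟨x1, x2, x3⟩ := hc.onEdge_left.coords h
  obtain ⟨y1, y2, y3⟩ := hc.onEdge_right.coords h
  have h3 : Fin.rev k ≠ g := fun h => h2 (by rw [← h, Fin.rev_rev])
  have h4 : Fin.rev k ≠ Fin.rev g := fun h => h1 (Fin.rev_injective h)
  exact ⟨⟨x3 k h1 h2, x3 _ h3 h4, x1, x2⟩, ⟨y3 k h1 (rev_ne_self k).symm, y3 _ (rev_ne_self g) h4.symm,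
    y1, y2⟩⟩

theorem Corner.ext_face {g k : Fin 4} (h1 : k ≠ g) (h2 : k ≠ Fin.rev g) {x y : E4}
    (hg : b.repr x g = b.repr y g) (hg' : b.repr x (Fin.rev g) = b.repr y (Fin.rev g))
    (hk : b.repr x k = b.repr y k) (hk' : b.repr x (Fin.rev k) = b.repr y (Fin.rev k)) : x = y := by
  have h3 : Fin.rev k ≠ g := fun h => h2 (by rw [← h, Fin.rev_rev])
  have h4 : Fin.rev k ≠ Fin.rev g := fun h => h1 (Fin.rev_injective h)
  apply b.ext_elem
  intro j
  rcases fin_four_cases h1 h2 (rev_ne_self k).symm (rev_ne_self g).symm h3.symm h4.symm j with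
    rfl | rfl | rfl | rfl <;> assumption

/-- Different arcs in a face do not cross. -/
theorem Corner.eq_of_crossing (h : CrossingSequence b m L z P F) {g k k' : Fin 4}
    {x y x' y' : E4} (hc : Corner P F g k x y) (hc' : Corner P F g k' x' y') {r s u v : ℝ}
    (hr : 0 < r) (hs : 0 < s) (hu : 0 < u) (hv : 0 < v)
    (he : r • x + s • y = u • x' + v • y') : x = x' ∧ y = y' := by
  obtain ⟨h1, h2, i, hi, hi'⟩ := hc
  obtain ⟨h1', h2', j, hj, hj'⟩ := hc'
  have hd : (m : ℤ) ∣ i - j := by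
    rcases hi' with ⟨rfl, rfl, -, -⟩ | ⟨rfl, rfl, -, -⟩ <;>
      rcases hj' with ⟨rfl, rfl, -, -⟩ | ⟨rfl, rfl, -, -⟩
    · exact h.noncross i j r s u v hr hs hu hv he
    · exact h.noncross i j r s v u hr hs hv hu (by rw [he, add_comm])
    · exact h.noncross i j s r u v hs hr hu hv (by rw [add_comm, he])
    · exact h.noncross i j s r v u hs hr hv hu (by rw [add_comm, he, add_comm])
  have e1 := h.congr_of_dvd hd
  have e2 := h.congr_of_dvd (i := i + 1) (j := j + 1) (by rwa [add_sub_add_right_eq_sub])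
  have e3 := h.congr_of_dvd (i := i - 1) (j := j - 1) (by rwa [sub_sub_sub_cancel_right])
  rcases hi' with ⟨rfl, rfl, a1, a2⟩ | ⟨rfl, rfl, a1, a2⟩ <;>
    rcases hj' with ⟨rfl, rfl, b1, b2⟩ | ⟨rfl, rfl, b1, b2⟩
  · exact ⟨e1.1, e2.1⟩
  · rw [e3.2, b1] at a1
    exact absurd (Fin.rev_injective a1) h1'
  · rw [e3.2, b1] at a1
    exact absurd (Fin.rev_injective a1).symm h1
  · exact ⟨e2.1, e1.1⟩

/-- The ends of an arc in a face are determined by each other. -/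
theorem Corner.right_unique (h : CrossingSequence b m L z P F) {g k k' : Fin 4}
    {x y y' : E4} (hc : Corner P F g k x y) (hc' : Corner P F g k' x y') : k = k' ∧ y = y' := by
  obtain ⟨h1, h2, i, hi, hi'⟩ := hc
  obtain ⟨h1', h2', j, hj, hj'⟩ := hc'
  rcases hi' with ⟨a1, a2, a3, a4⟩ | ⟨a1, a2, a3, a4⟩ <;>
    rcases hj' with ⟨b1, b2, b3, b4⟩ | ⟨b1, b2, b3, b4⟩
  · have hd := h.P_inj i j (a1.trans b1.symm)
    have e2 := h.congr_of_dvd (i := i + 1) (j := j + 1) (by rwa [add_sub_add_right_eq_sub])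
    exact ⟨Fin.rev_injective (by rw [← a4, ← b4, e2.2]), by rw [← a2, ← b2, e2.1]⟩
  · have hd := h.P_inj i (j + 1) (a1.trans b2.symm)
    have e2 := h.congr_of_dvd (i := i) (j := j + 1) hd
    rw [hi, b4] at e2
    exact absurd e2.2.symm (rev_ne_self g)
  · have hd := h.P_inj (i + 1) j (a2.trans b1.symm)
    have e2 := h.congr_of_dvd (i := i + 1) (j := j) hd
    rw [hj, a4] at e2
    exact absurd e2.2 (rev_ne_self g)
  · have hd := h.P_inj (i + 1) (j + 1) (a2.trans b2.symm)
    rw [add_sub_add_right_eq_sub] at hd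
    have e2 := h.congr_of_dvd (i := i) (j := j) hd
    have e3 := h.congr_of_dvd (i := i - 1) (j := j - 1) (by rwa [sub_sub_sub_cancel_right])
    exact ⟨Fin.rev_injective (by rw [← a3, ← b3, e3.2]), by rw [← a1, ← b1, e2.1]⟩

theorem Corner.left_unique (h : CrossingSequence b m L z P F) {g k : Fin 4}
    {x x' y : E4} (hc : Corner P F g k x y) (hc' : Corner P F g k x' y) : x = x' := by
  obtain ⟨h1, h2, i, hi, hi'⟩ := hc
  obtain ⟨h1', h2', j, hj, hj'⟩ := hc'
  have hk : Fin.rev k ≠ g := fun h => h2 (by rw [← h, Fin.rev_rev])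
  rcases hi' with ⟨a1, a2, a3, a4⟩ | ⟨a1, a2, a3, a4⟩ <;>
    rcases hj' with ⟨b1, b2, b3, b4⟩ | ⟨b1, b2, b3, b4⟩
  · have hd := h.P_inj (i + 1) (j + 1) (a2.trans b2.symm)
    rw [add_sub_add_right_eq_sub] at hd
    rw [← a1, ← b1, (h.congr_of_dvd hd).1]
  · have hd := h.P_inj (i + 1) j (a2.trans b1.symm)
    have e2 := h.congr_of_dvd hd
    rw [hj, a4] at e2
    exact absurd e2.2 hk
  · have hd := h.P_inj i (j + 1) (a1.trans b2.symm)
    have e2 := h.congr_of_dvd hd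
    rw [hi, b4] at e2
    exact absurd e2.2.symm hk
  · have hd := h.P_inj i j (a1.trans b1.symm)
    have e2 := h.congr_of_dvd (i := i + 1) (j := j + 1) (by rwa [add_sub_add_right_eq_sub])
    rw [← a2, ← b2, e2.1]

/-- Arcs that cut off the same corner of a face are ordered consistently. -/
theorem Corner.cross_nonneg (h : CrossingSequence b m L z P F) {g k : Fin 4} {x y x' y' : E4}
    (hc : Corner P F g k x y) (hc' : Corner P F g k x' y')
    (hx : 0 < cross b k (Fin.rev k) x x') (hy : cross b k (Fin.rev g) y y' < 0) : False := by
  obtain ⟨⟨x1, x2, x3, x4⟩, y1, y2, y3, y4⟩ := hc.coords h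
  obtain ⟨⟨x1', x2', x3', x4'⟩, y1', y2', y3', y4'⟩ := hc'.coords h
  have hy' : 0 < -cross b k (Fin.rev g) y y' := by linarith
  -- The weights of the crossing point of the two arcs: they equalise the coordinates at `Fin.rev k`
  -- and `Fin.rev g`, and the one at `k` then agrees as well.
  have := hc.eq_of_crossing h hc' (mul_pos x2' hy') (mul_pos y2' hx) (mul_pos x2 hy')
    (mul_pos y2 hx) (by
      refine Corner.ext_face (b := b) hc.1 hc.2.1 ?_ ?_ ?_ ?_ <;>
      simp only [map_add, map_smul, Finsupp.add_apply, Finsupp.smul_apply, smul_eq_mul, x3, x4, y3,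
        y4, x3', x4', y3', y4', cross] <;> ring)
  rw [this.1] at hx
  simp only [cross] at hx
  linarith

/-- Arcs cutting off the same corner transport the order from one edge to the other. Equality is
excluded because either end determines the arc. -/
theorem Corner.cross_pos_iff (h : CrossingSequence b m L z P F) {g k : Fin 4} {x y x' y' : E4}
    (hc : Corner P F g k x y) (hc' : Corner P F g k x' y') :
    0 < cross b k (Fin.rev k) x x' ↔ 0 < cross b k (Fin.rev g) y y' := by
  have h1 := hc.1
  have h2 := hc.2.1
  have h3 : Fin.rev k ≠ g := fun h => h2 (by rw [← h, Fin.rev_rev])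
  have h4 : Fin.rev k ≠ Fin.rev g := fun h => h1 (Fin.rev_injective h)
  constructor
  · intro hx
    rcases lt_trichotomy (cross b k (Fin.rev g) y y') 0 with hy | hy | hy
    · exact (hc.cross_nonneg h hc' hx hy).elim
    · have hyy := hc.onEdge_right.eq_of_cross_eq_zero h hc'.onEdge_right h1 (rev_ne_self k).symm
        (rev_ne_self g) h4.symm h2 h3.symm hy
      subst hyy
      rw [hc.left_unique h hc'] at hx
      simp only [cross] at hx
      linarith
    · exact hy
  · intro hy
    rcases lt_trichotomy (cross b k (Fin.rev k) x x') 0 with hx | hx | hx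
    · exact (hc'.cross_nonneg h hc (by rw [cross_anti]; linarith) (by rw [cross_anti]; linarith)).elim
    · have hxx := hc.onEdge_left.eq_of_cross_eq_zero h hc'.onEdge_left h1 h2 h3 h4
        (rev_ne_self k).symm (rev_ne_self g).symm hx
      subst hxx
      rw [(hc.right_unique h hc').2] at hy
      simp only [cross] at hy
      linarith
    · exact hx

/-- The arcs that cut off the corner `k` of a face meet the edge `{k, rev k}` nearer to `k` than those
that cut off the corner `rev k`. -/
theorem Corner.cross_pos (h : CrossingSequence b m L z P F) {g k : Fin 4} {x y x' y' : E4}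
    (hc : Corner P F g k x y) (hc' : Corner P F g (Fin.rev k) x' y') :
    0 < cross b k (Fin.rev k) x x' := by
  have h1 := hc.1
  have h2 := hc.2.1
  have h3 : Fin.rev k ≠ g := fun h => h2 (by rw [← h, Fin.rev_rev])
  have h4 : Fin.rev k ≠ Fin.rev g := fun h => h1 (Fin.rev_injective h)
  obtain ⟨⟨x1, x2, x3, x4⟩, y1, y2, y3, y4⟩ := hc.coords h
  obtain ⟨⟨x1', x2', x3', x4'⟩, y1', y2', y3', y4'⟩ := hc'.coords h
  rw [Fin.rev_rev] at x2' y4'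
  have hne : x ≠ x' := by
    rintro rfl
    exact rev_ne_self k (hc.right_unique h hc').1.symm
  by_contra hcon
  rcases lt_or_eq_of_le (not_lt.1 hcon) with hx | hx
  · have hx' : 0 < -cross b k (Fin.rev k) x x' := by linarith
    exact hne (hc.eq_of_crossing h hc'
      (r := b.repr y' (Fin.rev g) * b.repr y k * b.repr x' (Fin.rev k)
        + b.repr x' k * b.repr y (Fin.rev g) * b.repr y' (Fin.rev k))
      (s := b.repr y' (Fin.rev g) * -cross b k (Fin.rev k) x x')
      (u := b.repr x k * b.repr y (Fin.rev g) * b.repr y' (Fin.rev k)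
        + b.repr y' (Fin.rev g) * b.repr y k * b.repr x (Fin.rev k))
      (v := b.repr y (Fin.rev g) * -cross b k (Fin.rev k) x x')
      (by positivity) (by positivity) (by positivity) (by positivity) (by
        refine Corner.ext_face (b := b) hc.1 hc.2.1 ?_ ?_ ?_ ?_ <;>
        simp only [map_add, map_smul, Finsupp.add_apply, Finsupp.smul_apply, smul_eq_mul, x3, x4,
          y3, y4, x3', x4', y3', y4', cross] <;> ring)).1
  · exact hne (hc.onEdge_left.eq_of_cross_eq_zero h hc'.onEdge_left h1 h2 h3 h4
      (rev_ne_self k).symm (rev_ne_self g).symm hx)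

/-- Different arcs in a face: no point of the first lies on the great circle of the second. -/
theorem Corner.misses (h : CrossingSequence b m L z P F) {g k k' : Fin 4} {x y x' y' : E4}
    (hc : Corner P F g k x y) (hc' : Corner P F g k' x' y') (hne : x ≠ x') {r s u v : ℝ}
    (hr : 0 ≤ r) (hs : 0 ≤ s) (hrs : 0 < r + s) (he : r • x + s • y = u • x' + v • y') : False := by
  have h1 := hc.1
  have h2 := hc.2.1
  have h3 : Fin.rev k ≠ g := fun h => h2 (by rw [← h, Fin.rev_rev])
  have h4 : Fin.rev k ≠ Fin.rev g := fun h => h1 (Fin.rev_injective h)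
  obtain ⟨⟨x1, x2, x3, x4⟩, y1, y2, y3, y4⟩ := hc.coords h
  obtain ⟨⟨x1', x2', x3', x4'⟩, y1', y2', y3', y4'⟩ := hc'.coords h
  have ek := congrArg (fun w => b.repr w k) he
  have ek' := congrArg (fun w => b.repr w (Fin.rev k)) he
  have eg := congrArg (fun w => b.repr w (Fin.rev g)) he
  simp only [map_add, map_smul, Finsupp.add_apply, Finsupp.smul_apply, smul_eq_mul] at ek ek' eg
  rcases rev_eq_or h1 h2 hc'.1 hc'.2.1 with rfl | rfl
  · rw [y4, y4'] at ek'
    rw [x4, x4'] at eg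
    -- The determinant of the common point with respect to the second arc. Its two terms cannot have
    -- opposite signs, because the order of the ends is the same on both edges.
    have key : r * b.repr y' (Fin.rev g) * cross b k' (Fin.rev k') x x'
        + s * b.repr x' (Fin.rev k') * cross b k' (Fin.rev g) y y' = 0 := by
      simp only [cross]
      linear_combination b.repr x' (Fin.rev k') * b.repr y' (Fin.rev g) * ek
        - b.repr x' k' * b.repr y' (Fin.rev g) * ek' - b.repr y' k' * b.repr x' (Fin.rev k') * eg
    have hiff := hc.cross_pos_iff h hc'
    have hiff' := hc'.cross_pos_iff h hc
    rw [cross_anti, cross_anti (k := k') (l := Fin.rev g)] at hiff'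
    have hX : cross b k' (Fin.rev k') x x' ≠ 0 := fun h0 =>
      hne (hc.onEdge_left.eq_of_cross_eq_zero h hc'.onEdge_left h1 h2 h3 h4
        (rev_ne_self k').symm (rev_ne_self g).symm h0)
    rcases lt_or_gt_of_ne hX with hX | hX
    · have hY := hiff'.1 (by linarith)
      rcases hr.eq_or_lt with rfl | hr
      · have hs' : 0 < s := by linarith
        have := mul_pos (mul_pos hs' x2') hY
        linarith
      · have a1 := mul_pos (mul_pos hr y2') (neg_pos.2 hX)
        have a2 := mul_nonneg (mul_nonneg hs x2'.le) hY.le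
        linarith
    · have hY := hiff.1 hX
      rcases hr.eq_or_lt with rfl | hr
      · have hs' : 0 < s := by linarith
        have := mul_pos (mul_pos hs' x2') hY
        linarith
      · have a1 := mul_pos (mul_pos hr y2') hX
        have a2 := mul_nonneg (mul_nonneg hs x2'.le) hY.le
        linarith
  · rw [Fin.rev_rev] at y4' x2'
    have hX := hc.cross_pos h hc'
    rw [y4'] at ek
    rw [y4] at ek'
    rw [x4, x4'] at eg
    have key : r * b.repr y' (Fin.rev g) * cross b k (Fin.rev k) x x'
        + s * (b.repr y k * b.repr x' (Fin.rev k) * b.repr y' (Fin.rev g)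
          + b.repr x' k * b.repr y' (Fin.rev k) * b.repr y (Fin.rev g)) = 0 := by
      simp only [cross]
      linear_combination b.repr x' (Fin.rev k) * b.repr y' (Fin.rev g) * ek
        - b.repr x' k * b.repr y' (Fin.rev g) * ek' + b.repr x' k * b.repr y' (Fin.rev k) * eg
    rcases hr.eq_or_lt with rfl | hr
    · have hs' : 0 < s := by linarith
      have : 0 < s * (b.repr y k * b.repr x' (Fin.rev k) * b.repr y' (Fin.rev g)
          + b.repr x' k * b.repr y' (Fin.rev k) * b.repr y (Fin.rev g)) := by positivity
      linarith
    · have a1 := mul_pos (mul_pos hr y2') hX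
      have : 0 ≤ s * (b.repr y k * b.repr x' (Fin.rev k) * b.repr y' (Fin.rev g)
          + b.repr x' k * b.repr y' (Fin.rev k) * b.repr y (Fin.rev g)) := by positivity
      linarith

end SphericalTetrahedron

/-! ### Two strands that run side by side between two vertices. -/

namespace SphericalTetrahedron

open Module

variable {b : Basis (Fin 4) ℝ E4} {c : ℝ} {m : ℕ} {L : ℝ} {z : ℤ → ℝ} {P : ℤ → E4} {F : ℤ → Fin 4}

/-- Every other edge of the sequence is of the form `{k, rev k}`. -/
def Alternates (F : ℤ → Fin 4) : Prop :=
  ∀ i, F i = Fin.rev (F (i - 1)) ↔ F (i + 1) ≠ Fin.rev (F i)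

theorem CrossingSequence.corner_right (h : CrossingSequence b m L z P F) (ha : Alternates F) {i : ℤ}
    (hi : F i = Fin.rev (F (i - 1))) : Corner P F (F i) (Fin.rev (F (i + 1))) (P i) (P (i + 1)) := by
  refine ⟨fun h1 => (ha i).1 hi (by rw [← h1, Fin.rev_rev]), fun h1 => ?_, i, rfl,
    Or.inl ⟨rfl, rfl, by rw [hi, Fin.rev_rev], by rw [Fin.rev_rev]⟩⟩
  have := h.F_ne (i + 1)
  rw [add_sub_cancel_right] at this
  exact this (Fin.rev_injective h1)

theorem CrossingSequence.corner_left (h : CrossingSequence b m L z P F) (ha : Alternates F) {i : ℤ}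
    (hi : F i = Fin.rev (F (i - 1))) :
    Corner P F (F (i - 1)) (Fin.rev (F (i - 2))) (P i) (P (i - 1)) := by
  have e1 : i - 1 - 1 = i - 2 := by ring
  have e2 : i - 1 + 1 = i := by ring
  refine ⟨fun h1 => ?_, fun h1 => ?_, i - 1, rfl,
    Or.inr ⟨rfl, by rw [e2], by rw [e1, Fin.rev_rev], by rw [e2, hi]⟩⟩
  · have := (ha (i - 1)).1 (by rw [e1, h1])
    rw [e2] at this
    exact this hi
  · have := h.F_ne (i - 1)
    rw [e1] at this
    exact this (Fin.rev_injective h1).symm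

theorem CrossingSequence.corner_next (h : CrossingSequence b m L z P F) (ha : Alternates F) {i : ℤ}
    (hi : F i ≠ Fin.rev (F (i - 1))) :
    Corner P F (F i) (Fin.rev (F (i - 1))) (P (i + 1)) (P i) := by
  have h1 : F (i + 1) = Fin.rev (F i) := not_not.1 fun h1 => hi ((ha i).2 h1)
  have := h.corner_left ha (i := i + 1) (by rwa [add_sub_cancel_right])
  rwa [add_sub_cancel_right, show i + 1 - 2 = i - 1 by ring] at this

theorem CrossingSequence.corner_prev (h : CrossingSequence b m L z P F) (ha : Alternates F) {i : ℤ}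
    (hi : F i ≠ Fin.rev (F (i - 1))) :
    Corner P F (F (i - 1)) (Fin.rev (F i)) (P (i - 1)) (P i) := by
  have h1 : F (i - 1) = Fin.rev (F (i - 1 - 1)) := (ha (i - 1)).2 (by rwa [sub_add_cancel])
  have := h.corner_right ha (i := i - 1) h1
  rwa [sub_add_cancel] at this

theorem OnEdge.exists_corner (h : CrossingSequence b m L z P F) (ha : Alternates F) {g : Fin 4}
    {x : E4} (hx : OnEdge P F g (Fin.rev g) x) : ∃ k y, Corner P F g k x y := by
  obtain ⟨i, rfl, ⟨h1, h2⟩ | ⟨h1, h2⟩⟩ := hx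
  · have := h.corner_left ha (i := i) (by rw [h1, h2])
    rw [h1] at this
    exact ⟨_, _, this⟩
  · have := h.corner_right ha (i := i) (by rw [h1, h2, Fin.rev_rev])
    rw [h2] at this
    exact ⟨_, _, this⟩

theorem OnEdge.exists_corner' (h : CrossingSequence b m L z P F) (ha : Alternates F) {g k : Fin 4}
    {y : E4} (hk : k ≠ g) (hy : OnEdge P F g (Fin.rev k) y) : ∃ x, Corner P F g k x y := by
  obtain ⟨i, rfl, ⟨h1, h2⟩ | ⟨h1, h2⟩⟩ := hy
  · have := h.corner_prev ha (i := i) (by rw [h1, h2]; exact fun h => hk (Fin.rev_injective h))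
    rw [h1, h2, Fin.rev_rev] at this
    exact ⟨_, this⟩
  · have := h.corner_next ha (i := i) (by rw [h1, h2, Fin.rev_rev]; exact hk.symm)
    rw [h1, h2, Fin.rev_rev] at this
    exact ⟨_, this⟩

/-- `x` is the crossing point nearest to `b k` on the edge `{k, l}`, the common edge of the faces
`g` and `g'`. -/
def Nearest (b : Basis (Fin 4) ℝ E4) (P : ℤ → E4) (F : ℤ → Fin 4) (g g' k l : Fin 4) (x : E4) :
    Prop :=
  ∀ x', OnEdge P F g g' x' → 0 ≤ cross b k l x x'

/-- Arcs at the same corner keep their order, so the innermost arc is nearest to the vertex on both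
edges. In the converse direction below, arcs at the opposite corner also compete, and
`Corner.cross_pos` puts them farther away. -/
theorem Corner.nearest_right (h : CrossingSequence b m L z P F) (ha : Alternates F) {g k : Fin 4}
    {x y : E4} (hc : Corner P F g k x y) (hx : Nearest b P F g (Fin.rev g) k (Fin.rev k) x) :
    Nearest b P F g (Fin.rev k) k (Fin.rev g) y := by
  intro y' hy'
  obtain ⟨x', hc'⟩ := hy'.exists_corner' h ha hc.1
  by_contra hcon
  have h1 := (hc'.cross_pos_iff h hc).2 (by rw [cross_anti]; linarith)
  have h2 := hx x' hc'.onEdge_left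
  rw [cross_anti] at h1
  linarith

theorem Corner.nearest_left (h : CrossingSequence b m L z P F) (ha : Alternates F) {g k : Fin 4}
    {x y : E4} (hc : Corner P F g k x y) (hy : Nearest b P F g (Fin.rev k) k (Fin.rev g) y) :
    Nearest b P F g (Fin.rev g) k (Fin.rev k) x := by
  intro x' hx'
  obtain ⟨k', y', hc'⟩ := hx'.exists_corner h ha
  rcases rev_eq_or hc.1 hc.2.1 hc'.1 hc'.2.1 with rfl | rfl
  · by_contra hcon
    have h1 := (hc'.cross_pos_iff h hc).1 (by rw [cross_anti]; linarith)
    have h2 := hy y' hc'.onEdge_right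
    rw [cross_anti] at h1
    linarith
  · exact (hc.cross_pos h hc').le

/-- The last arc that cuts off a corner. -/
theorem Corner.nearest_of_adjacent (h : CrossingSequence b m L z P F) (ha : Alternates F)
    {g k : Fin 4} {x y x' y' : E4} (hc : Corner P F g k x y) (hc' : Corner P F g (Fin.rev k) x' y')
    (hadj : ∀ w, OnEdge P F g (Fin.rev g) w →
      ¬ 0 < cross b k (Fin.rev k) x w * cross b k (Fin.rev k) w x') :
    Nearest b P F g (Fin.rev k) (Fin.rev g) k y := by
  intro y'' hy''
  obtain ⟨x'', hc''⟩ := hy''.exists_corner' h ha hc.1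
  by_contra hcon
  have h1 := (hc.cross_pos_iff h hc'').2 (by rw [cross_swap]; linarith)
  have h2 := hc''.cross_pos h hc'
  exact hadj x'' hc''.onEdge_left (mul_pos h1 h2)

theorem arcMisses_of_corner (h : CrossingSequence b m L z P F) {g k k' : Fin 4} {j : ℤ}
    (hc : Corner P F g k (P j) (P (j + 1))) (hc' : Corner P F g k' (P (-j)) (P (-j - 1)))
    (hne : P j ≠ P (-j)) : ArcMisses P j ∧ ArcMisses (fun i => P (-i)) j := by
  refine ⟨fun r s u v hr hs hrs he => hc.misses h hc' hne hr hs hrs he,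
    fun r s u v hr hs hrs he => hc'.misses h hc hne.symm hr hs hrs (u := u) (v := v) ?_⟩
  simp only [neg_neg, neg_sub, sub_neg_eq_add, neg_add_rev] at he
  rwa [show -j - 1 = -1 + -j by ring, show j + 1 = 1 + j by ring]

theorem arcMisses_of_corner' (h : CrossingSequence b m L z P F) {g k k' : Fin 4} {j : ℤ}
    (hc : Corner P F g k (P (j + 1)) (P j)) (hc' : Corner P F g k' (P (-j - 1)) (P (-j)))
    (hne : P (j + 1) ≠ P (-j - 1)) : ArcMisses P j ∧ ArcMisses (fun i => P (-i)) j := by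
  refine ⟨fun r s u v hr hs hrs he => hc.misses h hc' hne hs hr (by linarith) (u := v) (v := u) ?_,
    fun r s u v hr hs hrs he => hc'.misses h hc hne.symm hs hr (by linarith) (u := v) (v := u) ?_⟩
  · rw [add_comm, he, add_comm]
  · simp only [neg_neg, neg_sub, sub_neg_eq_add, neg_add_rev] at he
    rw [add_comm, show -j - 1 = -1 + -j by ring, he, show 1 + j = j + 1 by ring, add_comm]

/-- The two strands of the sequence leaving the crossing `0` run through the same faces up to the
crossings `i` and `-i`, which are neighbours on a common edge. -/
structure Parallel (b : Basis (Fin 4) ℝ E4) (P : ℤ → E4) (F : ℤ → Fin 4) (i : ℤ) : Prop where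
  two_le : 2 ≤ i
  rev_eq : F i = Fin.rev (F (i - 1))
  eq_right : F i = F (-i - 1)
  eq_left : F (i - 1) = F (-i)
  ne : P i ≠ P (-i)
  adjacent : ∀ k w, OnEdge P F (F i) (Fin.rev (F i)) w →
    ¬ 0 < cross b k (Fin.rev k) (P i) w * cross b k (Fin.rev k) w (P (-i))
  chain : ∀ j, 1 ≤ j → j ≤ i - 1 →
    F j = F (-j - 1) ∧ ArcMisses P j ∧ ArcMisses (fun i => P (-i)) j

theorem cross_mul_rev (k : Fin 4) (x y w : E4) :
    cross b (Fin.rev k) (Fin.rev (Fin.rev k)) x w * cross b (Fin.rev k) (Fin.rev (Fin.rev k)) w y =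
      cross b k (Fin.rev k) x w * cross b k (Fin.rev k) w y := by
  rw [Fin.rev_rev, cross_swap k (Fin.rev k) x w, cross_swap k (Fin.rev k) w y, neg_mul_neg]

/-- If the crossings `w` and `w'` between two neighbours are excluded on one edge, they are so on the
next. -/
theorem Corner.adjacent_left (h : CrossingSequence b m L z P F) (ha : Alternates F) {g k : Fin 4}
    {x y x' y' : E4} (hc : Corner P F g k x y) (hc' : Corner P F g k x' y')
    (hadj : ∀ w, OnEdge P F g (Fin.rev k) w →
      ¬ 0 < cross b k (Fin.rev g) y w * cross b k (Fin.rev g) w y') :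
    ∀ w, OnEdge P F g (Fin.rev g) w →
      ¬ 0 < cross b k (Fin.rev k) x w * cross b k (Fin.rev k) w x' := by
  intro w hw hpos
  obtain ⟨k', u, hcw⟩ := hw.exists_corner h ha
  rcases rev_eq_or hc.1 hc.2.1 hcw.1 hcw.2.1 with rfl | rfl
  · refine hadj u hcw.onEdge_right ?_
    rcases pos_and_pos_or_neg_and_neg_of_mul_pos hpos with ⟨h1, h2⟩ | ⟨h1, h2⟩
    · exact mul_pos ((hc.cross_pos_iff h hcw).1 h1) ((hcw.cross_pos_iff h hc').1 h2)
    · rw [← neg_pos, ← cross_anti] at h1 h2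
      have h3 := (hcw.cross_pos_iff h hc).1 h1
      have h4 := (hc'.cross_pos_iff h hcw).1 h2
      rw [cross_anti] at h3 h4
      exact mul_pos_of_neg_of_neg (by linarith) (by linarith)
  · have h1 := hc.cross_pos h hcw
    have h2 := hc'.cross_pos h hcw
    rw [cross_anti] at h2
    have := mul_neg_of_pos_of_neg h1 (show cross b k (Fin.rev k) w x' < 0 by linarith)
    linarith

theorem Corner.adjacent_right (h : CrossingSequence b m L z P F) (ha : Alternates F) {g k : Fin 4}
    {x y x' y' : E4} (hc : Corner P F g k x y) (hc' : Corner P F g k x' y')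
    (hadj : ∀ w, OnEdge P F g (Fin.rev g) w →
      ¬ 0 < cross b k (Fin.rev k) x w * cross b k (Fin.rev k) w x') :
    ∀ w, OnEdge P F g (Fin.rev k) w →
      ¬ 0 < cross b k (Fin.rev g) y w * cross b k (Fin.rev g) w y' := by
  intro w hw hpos
  obtain ⟨u, hcw⟩ := hw.exists_corner' h ha hc.1
  refine hadj u hcw.onEdge_left ?_
  rcases pos_and_pos_or_neg_and_neg_of_mul_pos hpos with ⟨h1, h2⟩ | ⟨h1, h2⟩
  · exact mul_pos ((hc.cross_pos_iff h hcw).2 h1) ((hcw.cross_pos_iff h hc').2 h2)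
  · rw [← neg_pos, ← cross_anti] at h1 h2
    have h3 := (hcw.cross_pos_iff h hc).2 h1
    have h4 := (hc'.cross_pos_iff h hcw).2 h2
    rw [cross_anti] at h3 h4
    exact mul_pos_of_neg_of_neg (by linarith) (by linarith)

theorem Nearest.unique (h : CrossingSequence b m L z P F) {g k : Fin 4} (hk : k ≠ g)
    (hk' : k ≠ Fin.rev g) {x y : E4} (hx : OnEdge P F g (Fin.rev g) x)
    (hy : OnEdge P F g (Fin.rev g) y) (hnx : Nearest b P F g (Fin.rev g) k (Fin.rev k) x)
    (hny : Nearest b P F g (Fin.rev g) k (Fin.rev k) y) : x = y := by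
  refine hx.eq_of_cross_eq_zero h hy hk hk' (fun h => hk' (by rw [← h, Fin.rev_rev]))
    (fun h => hk (Fin.rev_injective h)) (rev_ne_self k).symm (rev_ne_self g).symm
    (le_antisymm ?_ (hnx y hy))
  have := hny x hx
  rw [cross_anti] at this
  linarith

/-- Two neighbours on the heavy edge of a face either cut off the same corner, and remain neighbours
through the next face, or cut off different corners. In the latter case no arc lies between them, so
each is the last at its corner. Both are then nearest to the vertex `Fin.rev (F i)` on the other two
edges of the face, hence also on the next heavy edge, where the nearest crossing is unique. -/
theorem Parallel.step (h : CrossingSequence b m L z P F) (ha : Alternates F) {i : ℤ}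
    (hp : Parallel b P F i) :
    (∀ j, 1 ≤ j → j ≤ i → F j = F (-j - 1) ∧ ArcMisses P j ∧ ArcMisses (fun i => P (-i)) j) ∧
      (P (i + 2) = P (-(i + 2)) ∨ Parallel b P F (i + 2)) := by
  have hc := h.corner_right ha hp.rev_eq
  have hri' : F (-i) = Fin.rev (F (-i - 1)) := by
    rw [← hp.eq_left, ← hp.eq_right, hp.rev_eq, Fin.rev_rev]
  have hc' := h.corner_left ha hri'
  rw [← hp.eq_right] at hc'
  have hmi := arcMisses_of_corner h hc hc' hp.ne
  have hchain : ∀ j, 1 ≤ j → j ≤ i →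
      F j = F (-j - 1) ∧ ArcMisses P j ∧ ArcMisses (fun i => P (-i)) j := by
    intro j hj hj'
    rcases hj'.lt_or_eq with hlt | rfl
    · exact hp.chain j hj (by omega)
    · exact ⟨hp.eq_right, hmi⟩
  refine ⟨hchain, ?_⟩
  have hn : F (i + 1) ≠ Fin.rev (F i) := (ha i).1 hp.rev_eq
  have hd := h.corner_next ha (i := i + 1) (by rwa [add_sub_cancel_right])
  rw [add_sub_cancel_right, show i + 1 + 1 = i + 2 by ring] at hd
  have hr1 : F (i + 2) = Fin.rev (F (i + 1)) := by
    have := ha (i + 1)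
    rw [add_sub_cancel_right, show i + 1 + 1 = i + 2 by ring] at this
    exact not_not.1 fun h => hn (this.2 h)
  have hn' : F (-i - 1) ≠ Fin.rev (F (-i - 1 - 1)) := fun h1 => by
    have := (ha (-i - 1)).1 h1
    rw [sub_add_cancel] at this
    exact this hri'
  have hd' := h.corner_prev ha hn'
  rw [show -i - 1 - 1 = -i - 2 by ring, ← hp.eq_right] at hd'
  have hr1' : F (-i - 2) = Fin.rev (F (-i - 3)) := by
    have := ha (-i - 2)
    rw [show -i - 2 - 1 = -i - 3 by ring, show -i - 2 + 1 = -i - 1 by ring] at this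
    rw [show -i - 1 - 1 = -i - 2 by ring] at hn'
    exact this.2 hn'
  have hneg : -(i + 2) = -i - 2 := by ring
  rcases rev_eq_or hc.1 hc.2.1 hc'.1 hc'.2.1 with heq | heq
  -- Same corner: the order and the neighbourhood relation pass through two faces.
  · right
    have hF : F (-i - 2) = F (i + 1) := Fin.rev_injective heq
    rw [hF] at hd' hr1'
    rw [heq] at hc'
    have hne2 : P (i + 2) ≠ P (-i - 2) := by
      intro h1
      rw [h1] at hd
      have h2 := (hd.right_unique h hd').2
      rw [h2] at hc
      exact hp.ne (hc.left_unique h hc')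
    have hadj1 := hc.adjacent_right h ha hc' fun w => hp.adjacent _ w
    have hadj2 := hd.adjacent_left h ha hd' fun w hw => by
      have := hadj1 w (by simpa using hw.symm)
      rwa [cross_swap _ _ _ w, cross_swap _ _ w, neg_mul_neg]
    have hm2 := arcMisses_of_corner' (j := i + 1) h (by rwa [show i + 1 + 1 = i + 2 by ring])
      (by rwa [show -(i + 1) - 1 = -i - 2 by ring, show -(i + 1) = -i - 1 by ring])
      (by rwa [show i + 1 + 1 = i + 2 by ring, show -(i + 1) - 1 = -i - 2 by ring])
    refine ⟨by linarith [hp.two_le], ?_, ?_, ?_, ?_, ?_, ?_⟩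
    · rw [hr1, show i + 2 - 1 = i + 1 by ring]
    · rw [hr1, show -(i + 2) - 1 = -i - 3 by ring, hr1', Fin.rev_rev]
    · rw [hneg, show i + 2 - 1 = i + 1 by ring, hF]
    · rwa [hneg]
    · intro k w hw
      rw [hr1, Fin.rev_rev] at hw
      have hw' := hw.symm
      rw [hneg]
      have key := hadj2 w hw'
      by_cases hk : k = F (i + 1) ∨ k = Fin.rev (F (i + 1))
      · have hw0 := hw.coords h
        have h1 : b.repr w k = 0 := by rcases hk with rfl | rfl; exacts [hw0.2.1, hw0.1]
        have h2 : b.repr w (Fin.rev k) = 0 := by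
          rcases hk with rfl | rfl
          · exact hw0.1
          · rw [Fin.rev_rev]; exact hw0.2.1
        simp [cross, h1, h2]
      · push Not at hk
        rcases rev_eq_or hd.1 hd.2.1 hk.1 hk.2 with rfl | rfl
        · exact key
        · rwa [cross_mul_rev]
    · intro j hj hj'
      rcases (show j ≤ i + 1 by omega).lt_or_eq with hlt | rfl
      · exact hchain j hj (by omega)
      · exact ⟨by rw [show -(i + 1) - 1 = -i - 2 by ring, hF], hm2⟩
  -- Different corners: the strands close up around the vertex `Fin.rev (F i)`.
  · left
    have hF : F (-i - 2) = Fin.rev (F (i + 1)) := by rw [← Fin.rev_rev (F (-i - 2)), heq, Fin.rev_rev]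
    rw [hF] at hd' hr1'
    rw [heq] at hc'
    have hN := hc.nearest_of_adjacent h ha hc' fun w => hp.adjacent _ w
    have hN' := Corner.nearest_of_adjacent h ha hc' (by rwa [Fin.rev_rev]) (fun w hw => by
      have := hp.adjacent (Fin.rev (F (i + 1))) w hw
      rw [cross_mul_rev]
      rwa [cross_anti _ _ w, cross_anti _ _ (P i) w, neg_mul_neg, mul_comm])
    rw [hneg]
    simp only [Fin.rev_rev] at hN hN'
    have hR : Nearest b P F (F (i + 1)) (Fin.rev (F (i + 1))) (Fin.rev (F i)) (Fin.rev (Fin.rev (F i)))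
        (P (i + 2)) := hd.nearest_left h ha fun y hy => hN y (by simpa using hy.symm)
    have hR' : Nearest b P F (Fin.rev (F (i + 1))) (Fin.rev (Fin.rev (F (i + 1)))) (Fin.rev (F i))
        (Fin.rev (Fin.rev (F i))) (P (-i - 2)) :=
      hd'.nearest_left h ha fun y hy => by
        rw [Fin.rev_rev]
        exact hN' y (by simpa using hy.symm)
    have hx := hd'.onEdge_left
    rw [Fin.rev_rev] at hR' hx
    exact Nearest.unique h hd.1 hd.2.1 hd.onEdge_left hx.symm hR fun y hy => hR' y hy.symm

/-- Both arcs at the crossing nearest to `v` cut off `v`: every edge is crossed, so some arc cuts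
off `v`, and it is nearer to `v` than any arc cutting off the other corner. The strands thus reach
the two edges of the face `Fin.rev v` at `v`, nearest to `v`, and continue to the heavy edge of that
face. They are neighbours there, since an arc between them would come from a crossing even nearer to
`v`. -/
theorem Parallel.start (h : CrossingSequence b m L z P F) (ha : Alternates F)
    (hex : ∀ g g', g ≠ g' → ∃ x, OnEdge P F g g' x) (h0 : F 0 = Fin.rev (F (-1))) {v : Fin 4}
    (hv : v ≠ F 0) (hv' : v ≠ Fin.rev (F 0))
    (hn : Nearest b P F (F 0) (Fin.rev (F 0)) v (Fin.rev v) (P 0)) : Parallel b P F 2 := by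
  -- The corner cut off by an arc at crossing `0` is `v`, in either of the two faces.
  have hnear : ∀ g k y, (g = F 0 ∨ g = Fin.rev (F 0)) → Corner P F g k (P 0) y → k = v := by
    intro g k y hg hc
    have hvg : v ≠ g := by rcases hg with rfl | rfl <;> assumption
    have hvg' : v ≠ Fin.rev g := by rcases hg with rfl | rfl; exacts [hv', by rwa [Fin.rev_rev]]
    rcases rev_eq_or hvg hvg' hc.1 hc.2.1 with rfl | rfl
    · rfl
    · obtain ⟨y', hy'⟩ := hex g (Fin.rev v) fun h1 => hvg' (by rw [h1, Fin.rev_rev])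
      obtain ⟨x', hc'⟩ := hy'.exists_corner' h ha hvg
      have h1 := hc'.cross_pos h hc
      have h2 := hn x' (by
        have := hc'.onEdge_left
        rcases hg with rfl | rfl
        · exact this
        · rw [Fin.rev_rev] at this
          exact this.symm)
      rw [cross_anti] at h1
      linarith
  have hc1 := h.corner_right ha (i := 0) (by simpa using h0)
  have hc2 := h.corner_left ha (i := 0) (by simpa using h0)
  norm_num at hc1 hc2
  have h0' : F (-1) = Fin.rev (F 0) := by rw [h0, Fin.rev_rev]
  rw [h0'] at hc2
  have k1 := hnear _ _ _ (Or.inl rfl) hc1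
  have k2 := hnear _ _ _ (Or.inr rfl) hc2
  have F1 : F 1 = Fin.rev v := by rw [← k1, Fin.rev_rev]
  have F2 : F (-2) = Fin.rev v := by rw [← k2, Fin.rev_rev]
  rw [k1] at hc1
  rw [k2] at hc2
  have hN1 := hc1.nearest_right h ha hn
  have hN2 := hc2.nearest_right h ha fun y hy => hn y (by rw [Fin.rev_rev] at hy; exact hy.symm)
  have hn1 : F 1 ≠ Fin.rev (F 0) := by rw [F1]; exact fun h1 => hv (Fin.rev_injective h1)
  have hd1 := h.corner_next ha (i := 1) (by simpa using hn1)
  have hn2 : F (-1) ≠ Fin.rev (F (-2)) := by rw [F2, h0', Fin.rev_rev]; exact hv'.symm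
  have hd2 := h.corner_prev ha (i := -1) (by norm_num; exact hn2)
  norm_num at hd1 hd2
  rw [F1] at hd1
  rw [F2, h0'] at hd2
  have hF2 : F 2 = v := by
    have := ha 1
    norm_num at this
    have h2 := not_not.1 fun h => hn1 (this.2 h)
    rw [h2, F1, Fin.rev_rev]
  have hF3 : F (-3) = v := by
    have := ha (-2)
    norm_num at this
    have h2 := this.2 hn2
    rw [F2] at h2
    exact (Fin.rev_injective h2).symm
  have hcross := hd1.cross_pos h hd2
  have hne : P 2 ≠ P (-2) := by
    intro h1
    rw [h1] at hcross
    simp only [cross] at hcross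
    linarith
  have hm := arcMisses_of_corner' (j := 1) h (by simpa using hd1) (by simpa using hd2)
    (by simpa using hne)
  refine ⟨le_rfl, ?_, ?_, ?_, hne, ?_, ?_⟩
  · norm_num; rw [hF2, F1, Fin.rev_rev]
  · norm_num; rw [hF2, hF3]
  · norm_num; rw [F1, F2]
  · have key : ∀ w, OnEdge P F (Fin.rev v) (Fin.rev (Fin.rev v)) w →
        ¬ 0 < cross b (Fin.rev (F 0)) (Fin.rev (Fin.rev (F 0))) (P 2) w
          * cross b (Fin.rev (F 0)) (Fin.rev (Fin.rev (F 0))) w (P (-2)) := by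
      have e1 : Nearest b P F (Fin.rev v) (Fin.rev (Fin.rev (F 0))) v (Fin.rev (F 0)) (P 1) :=
        fun y hy => hN1 y (by rw [Fin.rev_rev] at hy; exact hy.symm)
      have e2 : Nearest b P F (Fin.rev v) (Fin.rev (F 0)) v (F 0) (P (-1)) :=
        fun y hy => by simpa using hN2 y hy.symm
      intro w hw hpos
      obtain ⟨k', u, hcw⟩ := hw.exists_corner h ha
      rcases rev_eq_or hd1.1 hd1.2.1 hcw.1 hcw.2.1 with rfl | rfl
      · have h1 := hcw.cross_pos h hd2
        have h2 : 0 < cross b (Fin.rev (F 0)) (Fin.rev (Fin.rev (F 0))) (P 2) w :=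
          pos_of_mul_pos_left hpos h1.le
        have h3 := (hd1.cross_pos_iff h hcw).1 h2
        have h4 := e1 u hcw.onEdge_right
        rw [cross_swap] at h4
        simp only [Fin.rev_rev] at h3 h4
        linarith
      · have h1 := hd1.cross_pos h hcw
        have h2 : 0 < cross b (Fin.rev (F 0)) (Fin.rev (Fin.rev (F 0))) w (P (-2)) :=
          pos_of_mul_pos_right hpos h1.le
        have h3 := (hd2.cross_pos_iff h hcw).1 (by
          rw [cross_anti, cross_swap]
          simpa using h2)
        have h4 := e2 u (by simpa using hcw.onEdge_right)
        rw [cross_swap] at h4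
        simp only [Fin.rev_rev] at h3 h4
        linarith
    intro k w hw
    rw [hF2] at hw
    by_cases hk : k = v ∨ k = Fin.rev v
    · have hw0 := hw.coords h
      have h1 : b.repr w k = 0 := by rcases hk with rfl | rfl; exacts [hw0.1, hw0.2.1]
      have h2 : b.repr w (Fin.rev k) = 0 := by
        rcases hk with rfl | rfl
        · exact hw0.2.1
        · rw [Fin.rev_rev]; exact hw0.1
      simp [cross, h1, h2]
    · push Not at hk
      have key' := key w (by rw [Fin.rev_rev]; exact hw.symm)
      rcases rev_eq_or hd1.1 hd1.2.1 hk.2 (by rw [Fin.rev_rev]; exact hk.1) with rfl | rfl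
      · exact key'
      · rwa [cross_mul_rev]
  · intro j hj hj'
    obtain rfl : j = 1 := by omega
    norm_num
    exact ⟨by rw [F1, F2], hm⟩

/-- The strands cannot stay apart forever: periodicity identifies the crossings `2m` and `-2m`. So
they close up, and `CrossingSequence.length_le_two_pi` applies. -/
theorem Parallel.length_le (hb : IsRegularBasis b c) (h : CrossingSequence b m L z P F)
    (ha : Alternates F) (hp : Parallel b P F 2) : L ≤ 2 * Real.pi := by
  by_contra hcon
  have hall : ∀ n : ℕ, Parallel b P F (2 + 2 * n) := by
    intro n
    induction n with
    | zero => simpa using hp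
    | succ n ih =>
      obtain ⟨h1, h2⟩ := ih.step h ha
      rcases h2 with h2 | h2
      · refine absurd (h.length_le_two_pi hb (M := 2 + 2 * n + 2) (by omega) h2 ?_ ?_ ?_) hcon
        · exact fun j hj hj' => (h1 j hj (by omega)).1
        · exact fun j hj hj' => (h1 j hj (by omega)).2.1
        · exact fun j hj hj' => (h1 j hj (by omega)).2.2
      · convert h2 using 1
        push_cast
        ring
  have hm := h.period_pos
  have := (hall (m - 1)).ne
  have e : (2 + 2 * ((m - 1 : ℕ) : ℤ)) = 2 * m := by omega
  rw [e] at this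
  exact this (h.congr_of_dvd ⟨4, by ring⟩).1

/-- A simple closed geodesic on a regular tetrahedron is at most `2 * π` long. -/
theorem CrossingSequence.length_le (hb : IsRegularBasis b c) (h : CrossingSequence b m L z P F)
    (ha : Alternates F) (hex : ∀ g g', g ≠ g' → ∃ x, OnEdge P F g g' x) : L ≤ 2 * Real.pi := by
  have hfin : {x | OnEdge P F 0 (Fin.rev 0) x}.Finite := by
    refine ((Set.finite_Ico (0 : ℤ) m).image P).subset ?_
    rintro x ⟨i, rfl, -⟩
    have hm : (0 : ℤ) < m := by exact_mod_cast h.period_pos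
    refine ⟨i % m, ⟨Int.emod_nonneg _ hm.ne', Int.emod_lt_of_pos _ hm⟩, ?_⟩
    exact (h.congr_of_dvd ⟨-(i / m), by linarith [Int.emod_add_mul_ediv i m]⟩).1
  -- The smallest ratio of coordinates singles out the crossing nearest to `b 1`; the sequence is
  -- then renumbered so that it becomes crossing `0`.
  obtain ⟨x, hx, hmin⟩ := Set.exists_min_image _ (fun x => b.repr x 2 / b.repr x 1) hfin
    (hex 0 (Fin.rev 0) (by decide))
  have hn : Nearest b P F 0 (Fin.rev 0) 1 (Fin.rev 1) x := by
    intro y hy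
    have h1 := hmin y hy
    have x1 := (hx.coords h).2.2 1 (by decide) (by decide)
    have y1 := (hy.coords h).2.2 1 (by decide) (by decide)
    rw [div_le_div_iff₀ x1 y1] at h1
    show 0 ≤ cross b 1 2 x y
    simp only [cross]
    linarith
  have shifted : ∀ n, P n = x → F n = 0 ∨ F n = Fin.rev 0 → F n = Fin.rev (F (n - 1)) →
      L ≤ 2 * Real.pi := by
    intro n hPn hFn hrev
    have hedge : ∀ g g' y, OnEdge (fun i => P (i + n)) (fun i => F (i + n)) g g' y →
        OnEdge P F g g' y := by
      rintro g g' y ⟨i, hi, hi'⟩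
      refine ⟨i + n, hi, ?_⟩
      simpa [show i - 1 + n = i + n - 1 by ring] using hi'
    refine Parallel.length_le hb (h.shift n) (fun i => ?_) ?_
    · have := ha (i + n)
      simpa [show i - 1 + n = i + n - 1 by ring, show i + 1 + n = i + n + 1 by ring] using this
    · have hv : (1 : Fin 4) ≠ F n ∧ (1 : Fin 4) ≠ Fin.rev (F n) := by
        rcases hFn with h1 | h1 <;> rw [h1] <;> decide
      refine Parallel.start (h.shift n) (fun i => ?_) (fun g g' hg => ?_) ?_ (v := 1) ?_ ?_ ?_
      · have := ha (i + n)
        simpa [show i - 1 + n = i + n - 1 by ring, show i + 1 + n = i + n + 1 by ring] using this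
      · obtain ⟨y, i, hi, hi'⟩ := hex g g' hg
        exact ⟨y, i - n, by simpa using hi, by
          simpa [show i - n - 1 + n = i - 1 by ring] using hi'⟩
      · simpa [show (-1 : ℤ) + n = n - 1 by ring] using hrev
      · simpa using hv.1
      · simpa using hv.2
      · intro y hy
        have hy' := hedge _ _ _ hy
        simp only [zero_add] at hy' ⊢
        rw [hPn]
        refine hn y ?_
        rcases hFn with h1 | h1 <;> rw [h1] at hy'
        · exact hy'
        · rw [Fin.rev_rev] at hy'; exact hy'.symm
  obtain ⟨i, hi, ⟨h1, h2⟩ | ⟨h1, h2⟩⟩ := hx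
  · exact shifted i hi (Or.inr h2) (by rw [h1, h2])
  · exact shifted i hi (Or.inl h2) (by rw [h1, h2, Fin.rev_rev])

end SphericalTetrahedron

/-! ### Counting crossings, and the lower bound for the length by calibration. -/

namespace SphericalTetrahedron

open Module

variable {b : Basis (Fin 4) ℝ E4} {c : ℝ} {m : ℕ} {L : ℝ} {z : ℤ → ℝ} {P : ℤ → E4} {F : ℤ → Fin 4}

/-- The permutation `(0 1)(2 3)` of the vertices. -/
def swapPairs : Fin 4 → Fin 4 := ![1, 0, 3, 2]

/-- The number of points of a geodesic of type `(p, q)` on the common edge of two faces. -/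
def edgeCount (p q : ℕ) (g g' : Fin 4) : ℕ :=
  if g' = Fin.rev g then p + q else if g' = swapPairs g then p else q

/-- The crossing sequence is one of a geodesic of type `(p, q)`. -/
def CrossesWithType (P : ℤ → E4) (F : ℤ → Fin 4) (p q : ℕ) : Prop :=
  ∀ g g', g ≠ g' → {x | OnEdge P F g g' x}.encard = (edgeCount p q g g' : ℕ∞)

/-- The crossings in one period with the common edge of two faces. -/
def crossings (F : ℤ → Fin 4) (m : ℕ) (g g' : Fin 4) : Finset ℕ :=
  {i ∈ Finset.range m | (F ((i : ℤ) - 1) = g ∧ F i = g') ∨ (F ((i : ℤ) - 1) = g' ∧ F i = g)}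

theorem CrossingSequence.card_crossings (h : CrossingSequence b m L z P F) {p q : ℕ}
    (ht : CrossesWithType P F p q) {g g' : Fin 4} (hg : g ≠ g') :
    (crossings F m g g').card = edgeCount p q g g' := by
  have himg : {x | OnEdge P F g g' x} = (fun i : ℕ => P i) '' (crossings F m g g' : Set ℕ) := by
    ext x
    constructor
    · rintro ⟨i, rfl, hi⟩
      have hm : (0 : ℤ) < m := by exact_mod_cast h.period_pos
      have hnn := Int.emod_nonneg i hm.ne'
      have hlt := Int.emod_lt_of_pos i hm
      have hcast : ((i % m).toNat : ℤ) = i % m := Int.toNat_of_nonneg hnn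
      have hd : (m : ℤ) ∣ i % m - i := ⟨-(i / m), by linarith [Int.emod_add_mul_ediv i m]⟩
      have e1 := h.congr_of_dvd hd
      have e2 := h.congr_of_dvd (i := i % m - 1) (j := i - 1) (by rwa [sub_sub_sub_cancel_right])
      refine ⟨(i % m).toNat, ?_, ?_⟩
      · simp only [crossings, Finset.coe_filter, Finset.mem_range, Set.mem_setOf_eq, hcast, e1.2,
          e2.2]
        exact ⟨by omega, hi⟩
      · simp only [hcast, e1.1]
    · rintro ⟨i, hi, rfl⟩
      simp only [crossings, Finset.coe_filter, Set.mem_setOf_eq] at hi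
      exact ⟨i, rfl, hi.2⟩
  have hinj : Set.InjOn (fun i : ℕ => P i) (crossings F m g g' : Set ℕ) := by
    intro i hi j hj hij
    simp only [crossings, Finset.coe_filter, Finset.mem_range, Set.mem_setOf_eq] at hi hj
    have hd := h.P_inj i j hij
    have := Int.eq_zero_of_abs_lt_dvd hd (by rw [abs_lt]; constructor <;> omega)
    omega
  have := ht g g' hg
  rw [himg, hinj.encard_image, Set.encard_coe_eq_coe_finsetCard] at this
  exact_mod_cast this

/-- Summation over the crossings in one period, sorted by edges. -/
theorem CrossingSequence.sum_type (h : CrossingSequence b m L z P F) {p q : ℕ}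
    (ht : CrossesWithType P F p q) (φ : Fin 4 → Fin 4 → ℕ) (hφ : ∀ g g', φ g g' = φ g' g) :
    2 * ∑ i ∈ Finset.range m, φ (F ((i : ℤ) - 1)) (F i)
      = ∑ g, ∑ g', if g ≠ g' then edgeCount p q g g' * φ g g' else 0 := by
  have h1 : ∀ g g', (if g ≠ g' then edgeCount p q g g' * φ g g' else 0) =
      ∑ i ∈ Finset.range m, if g ≠ g' ∧ ((F ((i : ℤ) - 1) = g ∧ F i = g') ∨
        (F ((i : ℤ) - 1) = g' ∧ F i = g)) then φ g g' else 0 := by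
    intro g g'
    split_ifs with hg
    · rw [← h.card_crossings ht hg, crossings, Finset.card_filter, Finset.sum_mul]
      refine Finset.sum_congr rfl fun i _ => ?_
      simp [hg]
    · simp [not_not.1 hg]
  simp_rw [h1]
  have h2 : ∀ g, ∑ g', ∑ i ∈ Finset.range m, (if g ≠ g' ∧ ((F ((i : ℤ) - 1) = g ∧ F i = g') ∨
        (F ((i : ℤ) - 1) = g' ∧ F i = g)) then φ g g' else 0) =
      ∑ i ∈ Finset.range m, ∑ g', (if g ≠ g' ∧ ((F ((i : ℤ) - 1) = g ∧ F i = g') ∨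
        (F ((i : ℤ) - 1) = g' ∧ F i = g)) then φ g g' else 0) := fun g => Finset.sum_comm
  simp_rw [h2]
  rw [Finset.sum_comm, Finset.mul_sum]
  refine Finset.sum_congr rfl fun i _ => ?_
  have hne := h.F_ne i
  revert hne
  generalize F ((i : ℤ) - 1) = x
  generalize F (i : ℤ) = y
  intro hne
  have key : ∀ g g' : Fin 4, (g ≠ g' ∧ ((x = g ∧ y = g') ∨ (x = g' ∧ y = g))) ↔
      ((g = x ∧ g' = y) ∨ (g = y ∧ g' = x)) := by
    intro g g'
    constructor
    · rintro ⟨-, ⟨rfl, rfl⟩ | ⟨rfl, rfl⟩⟩ <;> simp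
    · rintro (⟨rfl, rfl⟩ | ⟨rfl, rfl⟩)
      · exact ⟨hne.symm, by simp⟩
      · exact ⟨hne, by simp⟩
  simp_rw [key]
  have : ∀ g g' : Fin 4, (if (g = x ∧ g' = y) ∨ (g = y ∧ g' = x) then φ g g' else 0) =
      (if g = x then (if g' = y then φ x y else 0) else 0)
        + (if g = y then (if g' = x then φ y x else 0) else 0) := by
    intro g g'
    rcases eq_or_ne g x with rfl | h1 <;> rcases eq_or_ne g y with rfl | h2
    · exact absurd rfl hne
    · rcases eq_or_ne g' y with rfl | h3 <;> simp [*]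
    · rcases eq_or_ne g' x with rfl | h3 <;> simp [*]
    · simp [*]
  simp_rw [this, Finset.sum_add_distrib]
  simp [hφ y x, two_mul]

theorem CrossingSequence.sum_range_succ_eq (h : CrossingSequence b m L z P F) {R : Type*}
    [AddCommGroup R] (f : ℤ → R) (hf : ∀ i, f (i + m) = f i) :
    ∑ i ∈ Finset.range m, f (i + 1) = ∑ i ∈ Finset.range m, f i := by
  have := Finset.sum_range_sub (fun i : ℕ => f i) m
  rw [Finset.sum_sub_distrib] at this
  have h0 : f m = f 0 := by simpa using hf 0
  push_cast at this
  rw [h0, sub_self] at this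
  exact sub_eq_zero.1 this

theorem edgeCount_comm (p q : ℕ) : ∀ g g', edgeCount p q g g' = edgeCount p q g' g := by
  intro g g'
  fin_cases g <;> fin_cases g' <;> simp [edgeCount, swapPairs]

/-- There are `4(p + q)` crossings in a period, half of them on heavy edges. Two consecutive
crossings are never both heavy, as a face has only one heavy edge and an arc does not return to its
edge. The count then forces strict alternation. -/
theorem CrossingSequence.alternates (h : CrossingSequence b m L z P F) {p q : ℕ}
    (ht : CrossesWithType P F p q) : Alternates F := by
  have hm : 2 * m = 8 * (p + q) := by
    have := h.sum_type ht (fun _ _ => 1) (fun _ _ => rfl)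
    simp [Fin.sum_univ_four, edgeCount, swapPairs] at this
    omega
  set r : ℤ → ℤ := fun i => if F i = Fin.rev (F (i - 1)) then 1 else 0 with hr
  have hsum : ∑ i ∈ Finset.range m, r i = 2 * (p + q) := by
    have := h.sum_type ht (fun g g' => if g' = Fin.rev g then 1 else 0) (by decide)
    simp [Fin.sum_univ_four, edgeCount] at this
    simp only [hr, Finset.sum_boole]
    push_cast
    omega
  have hper : ∀ i, r (i + m) = r i := by
    intro i
    simp only [hr, h.F_period, show i + m - 1 = i - 1 + m by ring]
  have hle : ∀ i, r i + r (i + 1) ≤ 1 := by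
    intro i
    simp only [hr, add_sub_cancel_right]
    split_ifs with h1 h2
    · exact absurd (by rw [h2, h1, Fin.rev_rev]) (h.F_ne_two i)
    all_goals norm_num
  have htot : ∑ i ∈ Finset.range m, (1 - (r i + r (i + 1))) = 0 := by
    rw [Finset.sum_sub_distrib, Finset.sum_add_distrib, h.sum_range_succ_eq r hper, hsum]
    simp
    omega
  have hzero := (Finset.sum_eq_zero_iff_of_nonneg (fun i _ => by linarith [hle i])).1 htot
  intro i
  have hmp : (0 : ℤ) < m := by exact_mod_cast h.period_pos
  have hnn := Int.emod_nonneg i hmp.ne'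
  have hlt := Int.emod_lt_of_pos i hmp
  have hcast : ((i % m).toNat : ℤ) = i % m := Int.toNat_of_nonneg hnn
  have hd : (m : ℤ) ∣ i % m - i := ⟨-(i / m), by linarith [Int.emod_add_mul_ediv i m]⟩
  have e1 := h.congr_of_dvd hd
  have e2 := h.congr_of_dvd (i := i % m - 1) (j := i - 1) (by rwa [sub_sub_sub_cancel_right])
  have e3 := h.congr_of_dvd (i := i % m + 1) (j := i + 1) (by rwa [add_sub_add_right_eq_sub])
  have := hzero (i % m).toNat (Finset.mem_range.2 (by omega))
  rw [hcast] at this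
  simp only [hr, add_sub_cancel_right, e1.2, e2.2, e3.2] at this
  split_ifs at this with h1 h2 h2
  · omega
  · exact ⟨fun _ => h2, fun _ => h1⟩
  · exact ⟨fun h => absurd h h1, fun h => absurd h2 h⟩
  · omega

/-- The coordinates of the calibrating vector of a face. -/
def calib (p q : ℕ) (f j : Fin 4) : ℝ :=
  if j = f then 0 else if j = Fin.rev f then -(p + q) else if j = swapPairs f then p else q

/-- The vector that calibrates the arcs of a geodesic of type `(p, q)` in a face. -/
noncomputable def calibVector (b : Basis (Fin 4) ℝ E4) (p q : ℕ) (f : Fin 4) : E4 :=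
  ∑ j, calib p q f j • b j

/-- The coordinates of the calibrating vector add up to zero, so the `c`-part of the inner product
disappears. -/
theorem IsRegularBasis.inner_calibVector (hb : IsRegularBasis b c) (p q : ℕ) (f : Fin 4) (x : E4) :
    inner ℝ x (calibVector b p q f) = (1 - c) * ∑ j, b.repr x j * calib p q f j := by
  have h0 : ∑ j, calib p q f j = 0 := by
    fin_cases f <;> simp [Fin.sum_univ_four, calib, swapPairs] <;> ring
  rw [hb.inner_eq_repr, calibVector, b.repr_sum_self, h0]
  ring

theorem IsRegularBasis.norm_calibVector (hb : IsRegularBasis b c) (p q : ℕ) (f : Fin 4) :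
    ‖calibVector b p q f‖ = Real.sqrt (2 * (1 - c) * ((p : ℝ) ^ 2 + p * q + q ^ 2)) := by
  rw [norm_eq_sqrt_real_inner, hb.inner_calibVector, calibVector, b.repr_sum_self]
  congr 1
  fin_cases f <;> simp [Fin.sum_univ_four, calib, swapPairs] <;> ring

/-- On the common edge the two calibrating functionals add up to a constant multiple of the
coordinate sum. This is the share of a crossing once the sum over arcs is regrouped by crossings;
its sign alternates along the geodesic. -/
theorem sum_calib (p q : ℕ) {g g' : Fin 4} (hg : g ≠ g') {x : Fin 4 → ℝ} (h : x g = 0)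
    (h' : x g' = 0) : ∑ j, x j * calib p q g j + ∑ j, x j * calib p q g' j =
      (if g' = Fin.rev g then 1 else -1) * (edgeCount p q g g' * ∑ j, x j) := by
  fin_cases g <;> fin_cases g' <;>
    first
    | exact absurd rfl hg
    | (simp [Fin.sum_univ_four, calib, edgeCount, swapPairs] at h h' ⊢
       rw [h, h']
       ring)

/-- Flat faces have coordinate sum one, and the sphere lies outside them. -/
theorem IsRegularBasis.one_le_sum (hb : IsRegularBasis b c) {x : E4} (hx : ‖x‖ = 1)
    (h0 : ∀ i, 0 ≤ b.repr x i) : 1 ≤ ∑ i, b.repr x i := by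
  have h1 : inner ℝ x x = (1 : ℝ) := by rw [real_inner_self_eq_norm_sq, hx]; norm_num
  rw [hb.inner_eq_repr] at h1
  have h2 : ∑ i, b.repr x i * b.repr x i ≤ (∑ i, b.repr x i) * ∑ i, b.repr x i := by
    rw [Finset.sum_mul]
    refine Finset.sum_le_sum fun i _ => mul_le_mul_of_nonneg_left ?_ (h0 i)
    exact Finset.single_le_sum (fun j _ => h0 j) (Finset.mem_univ i)
  have h3 : 0 ≤ ∑ i, b.repr x i := Finset.sum_nonneg fun i _ => h0 i
  have h4 := mul_le_mul_of_nonneg_left h2 (sub_nonneg.2 hb.lt_one.le)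
  nlinarith

theorem norm_sub_le_of_inner_eq_cos {x y : E4} (hx : ‖x‖ = 1) (hy : ‖y‖ = 1) {θ : ℝ} (hθ : 0 ≤ θ)
    (h : inner ℝ x y = Real.cos θ) : ‖x - y‖ ≤ θ := by
  refine le_of_sq_le_sq ?_ hθ
  rw [norm_sub_sq_real, hx, hy, h]
  have := Real.one_sub_sq_div_two_le_cos (x := θ)
  nlinarith

/-- Cauchy–Schwarz bounds the increment of the calibrating functional along an arc by the chord,
hence by the arc length, times the norm. Regrouped by crossings, the sum is at least `1 - c` times
the sum of the squared crossing numbers of the six edges, and `2(p² + q² + (p + q)²) = 4(p² + pq +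
q²)`. -/
theorem CrossingSequence.calibration (hb : IsRegularBasis b c) (h : CrossingSequence b m L z P F)
    {p q : ℕ} (ht : CrossesWithType P F p q) :
    4 * (1 - c) * ((p : ℝ) ^ 2 + p * q + q ^ 2) ≤
      L * Real.sqrt (2 * (1 - c) * ((p : ℝ) ^ 2 + p * q + q ^ 2)) := by
  set W := Real.sqrt (2 * (1 - c) * ((p : ℝ) ^ 2 + p * q + q ^ 2)) with hW
  have ha := h.alternates ht
  -- These signs alternate, so the terms belonging to one arc form a difference between its ends.
  set ε : ℤ → ℝ := fun i => if F i = Fin.rev (F (i - 1)) then 1 else -1 with hε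
  have hε1 : ∀ i, ε (i + 1) = -ε i := by
    intro i
    have := ha i
    simp only [hε, add_sub_cancel_right]
    split_ifs with h1 h2 h2
    · exact absurd h1 (this.1 h2)
    · norm_num
    · norm_num
    · exact absurd (this.2 h1) h2
  have hε2 : ∀ i, |ε i| = 1 := by
    intro i
    simp only [hε]
    split_ifs <;> norm_num
  have hL : L = ∑ i ∈ Finset.range m, (z (i + 1) - z i) := by
    have := Finset.sum_range_sub (fun i : ℕ => z i) m
    push_cast at this
    rw [this]
    have := h.z_period 0
    rw [zero_add] at this
    rw [this]
    ring
  have harc : ∀ i : ℤ, ε i * inner ℝ (P i) (calibVector b p q (F i))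
      + ε (i + 1) * inner ℝ (P (i + 1)) (calibVector b p q (F i)) ≤ (z (i + 1) - z i) * W := by
    intro i
    rw [hε1, neg_mul, ← sub_eq_add_neg, ← mul_sub, ← inner_sub_left]
    calc _ ≤ |ε i * inner ℝ (P i - P (i + 1)) (calibVector b p q (F i))| := le_abs_self _
      _ = |inner ℝ (P i - P (i + 1)) (calibVector b p q (F i))| := by rw [abs_mul, hε2, one_mul]
      _ ≤ ‖P i - P (i + 1)‖ * ‖calibVector b p q (F i)‖ := abs_real_inner_le_norm _ _
      _ ≤ _ := by
        rw [hb.norm_calibVector]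
        exact mul_le_mul_of_nonneg_right (norm_sub_le_of_inner_eq_cos (h.norm_P _) (h.norm_P _)
          (by linarith [h.z_lt i]) (h.inner_P i)) (Real.sqrt_nonneg _)
  have hpt : ∀ i : ℤ, (1 - c) * (edgeCount p q (F (i - 1)) (F i) : ℝ) ≤
      ε i * inner ℝ (P i) (calibVector b p q (F (i - 1)))
        + ε i * inner ℝ (P i) (calibVector b p q (F i)) := by
    intro i
    have hnn : ∀ k, 0 ≤ b.repr (P i) k := by
      intro k
      by_cases h1 : k = F (i - 1)
      · rw [h1, h.coord_prev]
      by_cases h2 : k = F i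
      · rw [h2, h.coord_self]
      exact (h.coord_pos i k h1 h2).le
    have h1 := hb.one_le_sum (h.norm_P i) hnn
    have h2 := sum_calib p q (h.F_ne i).symm (h.coord_prev i) (h.coord_self i)
    rw [hb.inner_calibVector, hb.inner_calibVector, ← mul_add, ← mul_add, h2]
    have h3 : ε i * ((1 - c) * ((if F i = Fin.rev (F (i - 1)) then 1 else -1) *
        (edgeCount p q (F (i - 1)) (F i) * ∑ j, b.repr (P i) j))) =
        (1 - c) * (edgeCount p q (F (i - 1)) (F i)) * ∑ j, b.repr (P i) j := by
      simp only [hε]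
      split_ifs <;> ring
    rw [h3]
    exact le_mul_of_one_le_right (mul_nonneg (by linarith [hb.lt_one]) (Nat.cast_nonneg _)) h1
  have hshift := h.sum_range_succ_eq (fun i => ε i * inner ℝ (P i) (calibVector b p q (F (i - 1))))
    (fun i => by
      simp only [hε, h.F_period, h.P_period, show i + m - 1 = i - 1 + m by ring])
  simp only [add_sub_cancel_right] at hshift
  have h1 := Finset.sum_le_sum fun (i : ℕ) (_ : i ∈ Finset.range m) => harc i
  rw [Finset.sum_add_distrib, hshift, ← Finset.sum_mul, ← hL] at h1
  have h2 := Finset.sum_le_sum fun (i : ℕ) (_ : i ∈ Finset.range m) => hpt i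
  rw [Finset.sum_add_distrib, ← Finset.mul_sum] at h2
  have h3 : (∑ i ∈ Finset.range m, (edgeCount p q (F ((i : ℤ) - 1)) (F i) : ℝ))
      = 4 * ((p : ℝ) ^ 2 + p * q + q ^ 2) := by
    have := h.sum_type ht (edgeCount p q) (edgeCount_comm p q)
    have h4 : (2 : ℝ) * ∑ i ∈ Finset.range m, (edgeCount p q (F ((i : ℤ) - 1)) (F i) : ℝ) =
      ((2 * ∑ i ∈ Finset.range m, edgeCount p q (F ((i : ℤ) - 1)) (F i) : ℕ) : ℝ) := by push_cast; rfl
    rw [this] at h4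
    simp [Fin.sum_univ_four, edgeCount, swapPairs] at h4
    simp [edgeCount, swapPairs]
    linarith
  rw [h3] at h2
  linarith

/-- The edges of a regular tetrahedron with a simple closed geodesic of type `(p, q)` are short. -/
theorem CrossingSequence.edge_bound (hb : IsRegularBasis b c) (h : CrossingSequence b m L z P F)
    {p q : ℕ} (hp : 0 < p) (hq : 0 < q) (ht : CrossesWithType P F p q) :
    2 * (1 - c) * ((p : ℝ) ^ 2 + p * q + q ^ 2) ≤ Real.pi ^ 2 := by
  have hL := h.length_le hb (h.alternates ht) fun g g' hg => by
    have h1 : 0 < edgeCount p q g g' := by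
      unfold edgeCount
      split_ifs <;> omega
    have h2 := ht g g' hg
    have h3 : {x | OnEdge P F g g' x}.encard ≠ 0 := by
      rw [h2]
      exact_mod_cast h1.ne'
    exact Set.encard_ne_zero.1 h3
  have hc := h.calibration hb ht
  have hN : 0 < (p : ℝ) ^ 2 + p * q + q ^ 2 := by positivity
  set N := (p : ℝ) ^ 2 + p * q + q ^ 2
  have hpos : 0 < 2 * (1 - c) * N := by
    have := hb.lt_one
    have : 0 < 1 - c := by linarith
    positivity
  have hs := Real.sq_sqrt hpos.le
  have hs0 := Real.sqrt_pos.2 hpos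
  set s := Real.sqrt (2 * (1 - c) * N)
  have h1 : 2 * s ≤ 2 * Real.pi := by
    refine le_trans (le_of_mul_le_mul_right ?_ hs0) hL
    nlinarith
  rw [← hs]
  exact pow_le_pow_left₀ hs0.le (by linarith) 2

end SphericalTetrahedron

/-! ### Great-circle arcs on the surface, and what is needed of the metric definition. -/

namespace SphericalTetrahedron

open Module InnerProductGeometry

variable {b : Basis (Fin 4) ℝ E4} {c : ℝ}

/-- `x` lies in the cone over the face opposite to the vertex `b f`. -/
def InCone (b : Basis (Fin 4) ℝ E4) (f : Fin 4) (x : E4) : Prop :=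
  b.repr x f = 0 ∧ ∀ j, 0 ≤ b.repr x j

theorem mem_face_iff {f : Fin 4} {x : E4} : x ∈ face b f ↔ ‖x‖ = 1 ∧ InCone b f x := by
  constructor
  · rintro ⟨h1, t, h2, h3, rfl⟩
    refine ⟨h1, ?_, fun j => ?_⟩
    · rw [b.repr_sum_self, h3]
    · rw [b.repr_sum_self]; exact h2 j
  · rintro ⟨h1, h2, h3⟩
    exact ⟨h1, fun j => b.repr x j, h3, h2, (b.sum_repr x).symm⟩

theorem mem_surface_iff {x : E4} : x ∈ surface b ↔ ‖x‖ = 1 ∧ ∃ f, InCone b f x := by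
  simp only [surface, mem_iUnion, mem_face_iff]
  exact ⟨fun ⟨f, h1, h2⟩ => ⟨h1, f, h2⟩, fun ⟨h1, f, h2⟩ => ⟨f, h1, h2⟩⟩

theorem InCone.smul {f : Fin 4} {x : E4} (h : InCone b f x) {r : ℝ} (hr : 0 ≤ r) :
    InCone b f (r • x) :=
  ⟨by simp [h.1], fun j => by simpa using mul_nonneg hr (h.2 j)⟩

theorem InCone.add {f : Fin 4} {x y : E4} (h : InCone b f x) (h' : InCone b f y) :
    InCone b f (x + y) :=
  ⟨by simp [h.1, h'.1], fun j => by simpa using add_nonneg (h.2 j) (h'.2 j)⟩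

theorem angle_lt_pi_of_nonneg {x y : E4} (hx : ∀ j, 0 ≤ b.repr x j) (hy : ∀ j, 0 ≤ b.repr y j)
    (hy0 : y ≠ 0) : angle x y < Real.pi := by
  refine lt_of_le_of_ne (angle_le_pi x y) fun h => ?_
  obtain ⟨-, r, hr, rfl⟩ := angle_eq_pi_iff.1 h
  refine hy0 (b.ext_elem fun j => ?_)
  have h1 := hy j
  simp only [map_smul, Finsupp.smul_apply, smul_eq_mul, map_zero, Finsupp.coe_zero,
    Pi.zero_apply] at h1 ⊢
  nlinarith [hx j]

/-- The great circle through `x` with the initial velocity `v`. -/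
noncomputable def great (x v : E4) (t : ℝ) : E4 := Real.cos t • x + Real.sin t • v

theorem great_zero (x v : E4) : great x v 0 = x := by simp [great]

theorem inner_great (x v w : E4) (t : ℝ) :
    inner ℝ (great x v t) w = Real.cos t * inner ℝ x w + Real.sin t * inner ℝ v w := by
  simp [great, inner_add_left, inner_smul_left]

theorem repr_great (x v : E4) (t : ℝ) (j : Fin 4) :
    b.repr (great x v t) j = Real.cos t * b.repr x j + Real.sin t * b.repr v j := by
  simp [great]

theorem continuous_great (x v : E4) : Continuous (great x v) := by
  unfold great; fun_prop

theorem norm_great_sub_sq {x v : E4} (hx : ‖x‖ = 1) (hxv : inner ℝ x v = 0) (s t : ℝ) :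
    ‖great x v s - great x v t‖ ^ 2 =
      (Real.cos s - Real.cos t) ^ 2 + (Real.sin s - Real.sin t) ^ 2 * ‖v‖ ^ 2 := by
  have h1 : great x v s - great x v t =
      (Real.cos s - Real.cos t) • x + (Real.sin s - Real.sin t) • v := by
    simp only [great]; module
  rw [h1, norm_add_sq_real, norm_smul, norm_smul, inner_smul_left, inner_smul_right, hxv, hx]
  simp [mul_pow]

theorem norm_great {x v : E4} (hx : ‖x‖ = 1) (hv : ‖v‖ = 1) (hxv : inner ℝ x v = 0) (t : ℝ) :
    ‖great x v t‖ = 1 := by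
  have : ‖great x v t‖ ^ 2 = 1 := by
    rw [great, norm_add_sq_real, norm_smul, norm_smul, inner_smul_left, inner_smul_right, hxv, hx, hv]
    simp
  nlinarith [norm_nonneg (great x v t)]

theorem lipschitzWith_great {x v : E4} (hx : ‖x‖ = 1) (hv : ‖v‖ ≤ 1) (hxv : inner ℝ x v = 0) :
    LipschitzWith 1 (great x v) := by
  refine LipschitzWith.of_dist_le_mul fun s t => ?_
  rw [dist_eq_norm, NNReal.coe_one, one_mul, Real.dist_eq]
  refine abs_le_of_sq_le_sq' ?_ (abs_nonneg _) |>.2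
  rw [norm_great_sub_sq hx hxv, sq_abs]
  have h1 : ‖v‖ ^ 2 ≤ 1 := pow_le_one₀ (norm_nonneg _) hv
  have h2 := Real.one_sub_sq_div_two_le_cos (x := s - t)
  rw [Real.cos_sub] at h2
  have h3 := mul_le_mul_of_nonneg_left h1 (sq_nonneg (Real.sin s - Real.sin t))
  nlinarith [Real.sin_sq_add_cos_sq s, Real.sin_sq_add_cos_sq t]

theorem sin_smul_great (x v : E4) (r s t : ℝ) : Real.sin (s - r) • great x v t =
    Real.sin (s - t) • great x v r + Real.sin (t - r) • great x v s := by
  simp only [great, Real.sin_sub, smul_add, smul_smul]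
  rw [add_add_add_comm, ← add_smul, ← add_smul]
  congr 2
  · ring
  · ring

theorem exists_great {x y : E4} (hx : ‖x‖ = 1) (hy : ‖y‖ = 1) (h : angle x y < Real.pi) :
    ∃ v, ‖v‖ ≤ 1 ∧ inner ℝ x v = 0 ∧ great x v (angle x y) = y := by
  have hcos : inner ℝ x y = Real.cos (angle x y) := by rw [cos_angle, hx, hy]; simp
  have hxx : inner ℝ x x = (1 : ℝ) := by rw [real_inner_self_eq_norm_sq, hx]; norm_num
  rcases (angle_nonneg x y).eq_or_lt with h0 | h0
  · refine ⟨0, by simp, by simp, ?_⟩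
    rw [← h0, great_zero]
    rw [← h0, Real.cos_zero] at hcos
    exact (inner_eq_one_iff_of_norm_eq_one hx hy).1 hcos
  · have hs := Real.sin_pos_of_pos_of_lt_pi h0 h
    set θ := angle x y
    have hv : ‖(Real.sin θ)⁻¹ • (y - Real.cos θ • x)‖ = 1 := by
      have h1 : ‖y - Real.cos θ • x‖ ^ 2 = Real.sin θ ^ 2 := by
        rw [norm_sub_sq_real, norm_smul, inner_smul_right, real_inner_comm, hcos, hx, hy]
        simp only [Real.norm_eq_abs, mul_one, sq_abs]
        nlinarith [Real.sin_sq_add_cos_sq θ]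
      rw [norm_smul, norm_inv, Real.norm_of_nonneg hs.le,
        (pow_left_inj₀ (norm_nonneg _) hs.le two_ne_zero).1 h1, inv_mul_cancel₀ hs.ne']
    refine ⟨_, hv.le, ?_, ?_⟩
    · rw [inner_smul_right, inner_sub_right, inner_smul_right, hcos, hxx]; ring
    · rw [great, smul_smul, mul_inv_cancel₀ hs.ne']; module

/-- The points `x` and `y` can be joined by a curve in `S` of length at most `ℓ`. -/
def Joinable (S : Set E4) (x y : E4) (ℓ : ℝ) : Prop :=
  ∀ u v : ℝ, u < v → ∃ γ : ℝ → E4, ContinuousOn γ (Icc u v) ∧ MapsTo γ (Icc u v) S ∧ γ u = x ∧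
    γ v = y ∧ eVariationOn γ (Icc u v) ≤ ENNReal.ofReal ℓ

theorem Joinable.trans {S : Set E4} {x y w : E4} {ℓ ℓ' : ℝ} (hℓ : 0 ≤ ℓ) (hℓ' : 0 ≤ ℓ')
    (h : Joinable S x y ℓ) (h' : Joinable S y w ℓ') : Joinable S x w (ℓ + ℓ') := by
  intro u v huv
  obtain ⟨γ, c1, m1, a1, b1, l1⟩ := h u ((u + v) / 2) (by linarith)
  obtain ⟨δ, c2, m2, a2, b2, l2⟩ := h' ((u + v) / 2) v (by linarith)
  set τ := (u + v) / 2 with hτ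
  have huτ : u ≤ τ := by linarith
  have hτv : τ ≤ v := by linarith
  let η : ℝ → E4 := fun t => if t ≤ τ then γ t else δ t
  have e1 : EqOn η γ (Icc u τ) := fun t ht => if_pos ht.2
  have e2 : EqOn η δ (Icc τ v) := by
    intro t ht
    rcases ht.1.eq_or_lt with rfl | h
    · simp only [η, le_refl, if_true]; rw [b1, a2]
    · exact if_neg (not_le.2 h)
  refine ⟨η, ?_, ?_, ?_, ?_, ?_⟩
  · rw [← Icc_union_Icc_eq_Icc huτ hτv]
    exact (c1.congr e1).union_of_isClosed (c2.congr e2) isClosed_Icc isClosed_Icc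
  · rw [← Icc_union_Icc_eq_Icc huτ hτv]
    rintro t (ht | ht)
    · rw [e1 ht]; exact m1 ht
    · rw [e2 ht]; exact m2 ht
  · rw [e1 ⟨le_rfl, huτ⟩, a1]
  · rw [e2 ⟨hτv, le_rfl⟩, b2]
  · have := eVariationOn.Icc_add_Icc η (s := univ) huτ hτv (mem_univ _)
    simp only [univ_inter] at this
    rw [← this, ENNReal.ofReal_add hℓ hℓ', eVariationOn.congr e1, eVariationOn.congr e2]
    exact add_le_add l1 l2

/-- Points of the great-circle arc are combinations of its ends with nonnegative sine weights, so
the arc stays in the cone. -/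
theorem joinable_of_inCone {f : Fin 4} {x y : E4} (hx : ‖x‖ = 1) (hy : ‖y‖ = 1) (hxf : InCone b f x)
    (hyf : InCone b f y) : Joinable (surface b) x y (angle x y) := by
  have hπ : angle x y < Real.pi := angle_lt_pi_of_nonneg hxf.2 hyf.2 (by rintro rfl; simp at hy)
  obtain ⟨v, hv, hxv, hend⟩ := exists_great hx hy hπ
  set θ := angle x y with hθ
  have hθ0 : 0 ≤ θ := angle_nonneg x y
  have hmem : ∀ t ∈ Icc 0 θ, great x v t ∈ surface b := by
    intro t ht
    rcases hθ0.eq_or_lt with h0 | h0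
    · have : t = 0 := le_antisymm (by rw [h0]; exact ht.2) ht.1
      rw [this, great_zero]
      exact mem_surface_iff.2 ⟨hx, f, hxf⟩
    · have hs := Real.sin_pos_of_pos_of_lt_pi h0 hπ
      have h1 := sin_smul_great x v 0 θ t
      rw [great_zero, hend, sub_zero, sub_zero] at h1
      have h2 : great x v t = (Real.sin θ)⁻¹ • (Real.sin (θ - t) • x + Real.sin t • y) := by
        rw [← h1, smul_smul, inv_mul_cancel₀ hs.ne', one_smul]
      have hv1 : ‖v‖ = 1 := by
        have h3 : Real.sin θ • v = y - Real.cos θ • x := by rw [← hend, great]; module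
        have h4 : ‖Real.sin θ • v‖ ^ 2 = Real.sin θ ^ 2 := by
          have hcos : inner ℝ x y = Real.cos θ := by rw [hθ, cos_angle, hx, hy]; simp
          rw [h3, norm_sub_sq_real, norm_smul, inner_smul_right, real_inner_comm, hcos, hx, hy]
          simp only [Real.norm_eq_abs, mul_one, sq_abs]
          nlinarith [Real.sin_sq_add_cos_sq θ]
        rw [norm_smul, Real.norm_of_nonneg hs.le] at h4
        have h5 := (pow_left_inj₀ (by positivity) hs.le two_ne_zero).1 h4
        exact mul_left_cancel₀ hs.ne' (by rw [h5, mul_one])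
      refine mem_surface_iff.2 ⟨norm_great hx hv1 hxv t, f, ?_⟩
      rw [h2]
      exact ((hxf.smul (Real.sin_nonneg_of_nonneg_of_le_pi (by linarith [ht.2]) (by linarith [ht.1]))).add
        (hyf.smul (Real.sin_nonneg_of_nonneg_of_le_pi ht.1 (by linarith [ht.2])))).smul
          (inv_nonneg.2 hs.le)
  intro r s hrs
  have hrs' : 0 < s - r := sub_pos.2 hrs
  set φ : ℝ → ℝ := fun t => (t - r) / (s - r) * θ with hφ
  have hφm : Monotone φ := by
    intro t t' htt
    simp only [hφ]
    gcongr
  have hφr : φ r = 0 := by simp [hφ]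
  have hφs : φ s = θ := by simp [hφ, hrs'.ne']
  refine ⟨fun t => great x v (φ t), ?_, ?_, ?_, ?_, ?_⟩
  · exact ((continuous_great x v).comp (by simp only [hφ]; fun_prop)).continuousOn
  · intro t ht
    exact hmem _ ⟨by rw [← hφr]; exact hφm ht.1, by rw [← hφs]; exact hφm ht.2⟩
  · simp only [hφr, great_zero]
  · simp only [hφs, hend]
  · have h1 := ((lipschitzWith_great hx hv hxv).lipschitzOnWith (s := univ)).comp_eVariationOn_le
      (g := φ) (s := Icc r s) (mapsTo_univ _ _)
    refine h1.trans ?_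
    have h2 := (hφm.monotoneOn (Icc r s)).eVariationOn_le (left_mem_Icc.2 hrs.le)
      (right_mem_Icc.2 hrs.le)
    rw [inter_self, hφr, hφs, sub_zero] at h2
    simpa using h2

/-- `γ` is a geodesic of unit speed on the surface of the tetrahedron, which does not run along
an edge. -/
structure IsTetGeodesic (b : Basis (Fin 4) ℝ E4) (γ : ℝ → E4) : Prop where
  norm_eq_one : ∀ t, ‖γ t‖ = 1
  nonneg : ∀ t j, 0 ≤ b.repr (γ t) j
  exists_zero : ∀ t, ∃ f, b.repr (γ t) f = 0
  continuous : Continuous γ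
  angle_le : ∀ s t, s ≤ t → angle (γ s) (γ t) ≤ t - s
  -- The competitors consist of three great-circle arcs, in the faces `f`, `g`, `k`, with breaks at
  -- `x` on `f ∩ g` and `y` on `g ∩ k`. The points `x` and `y` need not be normalised.
  shortest : ∀ t, ∃ ε > 0, ∀ u v, t - ε ≤ u → u ≤ v → v ≤ t + ε → ∀ (x y : E4) (f g k : Fin 4),
    x ≠ 0 → y ≠ 0 → InCone b f (γ u) → InCone b f x → InCone b g x → InCone b g y → InCone b k y →
    InCone b k (γ v) → v - u ≤ angle (γ u) x + angle x y + angle y (γ v)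
  leaves_edge : ∀ s t, s < t → ∀ g g', g ≠ g' →
    ∃ u ∈ Ioo s t, b.repr (γ u) g ≠ 0 ∨ b.repr (γ u) g' ≠ 0

theorem IsTetGeodesic.reverse {γ : ℝ → E4} (h : IsTetGeodesic b γ) :
    IsTetGeodesic b (fun t => γ (-t)) where
  norm_eq_one t := h.norm_eq_one _
  nonneg t := h.nonneg _
  exists_zero t := h.exists_zero _
  continuous := h.continuous.comp continuous_neg
  angle_le s t hst := by
    rw [angle_comm]
    linarith [h.angle_le (-t) (-s) (by linarith)]
  shortest t := by
    obtain ⟨ε, hε, H⟩ := h.shortest (-t)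
    refine ⟨ε, hε, fun u v h1 h2 h3 x y f g k hx hy a1 a2 a3 a4 a5 a6 => ?_⟩
    have := H (-v) (-u) (by linarith) (by linarith) (by linarith) y x k g f hy hx a6 a5 a4 a3 a2 a1
    rw [angle_comm (γ (-v)) y, angle_comm y x, angle_comm x (γ (-u))] at this
    linarith
  leaves_edge s t hst g g' hg := by
    obtain ⟨u, hu, hu'⟩ := h.leaves_edge (-t) (-s) (by linarith) g g' hg
    exact ⟨-u, ⟨by linarith [hu.2], by linarith [hu.1]⟩, by rwa [neg_neg]⟩

/-- Angles of less than a right angle are at most as large as their tangents. -/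
theorem angle_le_tan {x y : E4} (h : 0 < inner ℝ x y) : angle x y ≤
    Real.sqrt (inner ℝ x x * inner ℝ y y - inner ℝ x y * inner ℝ x y) / inner ℝ x y := by
  have hx : x ≠ 0 := by rintro rfl; simp at h
  have hy : y ≠ 0 := by rintro rfl; simp at h
  have hn : 0 < ‖x‖ * ‖y‖ := mul_pos (norm_pos_iff.2 hx) (norm_pos_iff.2 hy)
  have hc := cos_angle_mul_norm_mul_norm x y
  have hs := sin_angle_mul_norm_mul_norm x y
  have hcos : 0 < Real.cos (angle x y) := pos_of_mul_pos_left (by rw [hc]; exact h) hn.le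
  have hlt : angle x y < Real.pi / 2 := by
    by_contra hcon
    have := Real.cos_nonpos_of_pi_div_two_le_of_le (not_lt.1 hcon)
      (by linarith [angle_le_pi x y, Real.pi_pos])
    linarith
  rw [← hs, ← hc, mul_div_mul_right _ _ hn.ne', ← Real.tan_eq_sin_div_cos]
  exact Real.le_tan (angle_nonneg x y) hlt

/-- A step of length `δ` turns by at most `δ / (1 - δ² / 2)`. Subdividing finely and summing up the
angles removes the error. -/
theorem angle_le_of_lipschitz {γ : ℝ → E4} (hn : ∀ t, ‖γ t‖ = 1)
    (hl : ∀ s t, s ≤ t → ‖γ s - γ t‖ ≤ t - s) {s t : ℝ} (hst : s ≤ t) :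
    angle (γ s) (γ t) ≤ t - s := by
  have hstep : ∀ s δ, 0 ≤ δ → δ < 1 → angle (γ s) (γ (s + δ)) ≤ δ / (1 - δ ^ 2 / 2) := by
    intro s δ h0 h1
    have h2 := hl s (s + δ) (by linarith)
    rw [add_sub_cancel_left] at h2
    have h3 : ‖γ s - γ (s + δ)‖ ^ 2 = 2 - 2 * inner ℝ (γ s) (γ (s + δ)) := by
      rw [norm_sub_sq_real, hn, hn]; ring
    set d := ‖γ s - γ (s + δ)‖ with hd
    have hd0 : 0 ≤ d := norm_nonneg _
    have h4 : inner ℝ (γ s) (γ (s + δ)) = 1 - d ^ 2 / 2 := by linarith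
    have h5 : d ^ 2 ≤ δ ^ 2 := pow_le_pow_left₀ hd0 h2 2
    have h6 : δ ^ 2 < 1 := by nlinarith
    have h7 : 0 < 1 - δ ^ 2 / 2 := by linarith
    refine (angle_le_tan (by rw [h4]; linarith)).trans ?_
    rw [h4, real_inner_self_eq_norm_sq, real_inner_self_eq_norm_sq, hn, hn]
    refine div_le_div₀ h0 ?_ h7 (by linarith)
    refine Real.sqrt_le_iff.2 ⟨h0, ?_⟩
    nlinarith [sq_nonneg (d ^ 2)]
  have hsum : ∀ (δ : ℝ), 0 ≤ δ → δ < 1 → ∀ n : ℕ,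
      angle (γ s) (γ (s + n * δ)) ≤ n * (δ / (1 - δ ^ 2 / 2)) := by
    intro δ h0 h1 n
    induction n with
    | zero =>
      have : γ s ≠ 0 := by intro h; have := hn s; rw [h] at this; simp at this
      simp [angle_self this]
    | succ n ih =>
      have h2 := hstep (s + n * δ) δ h0 h1
      rw [show s + n * δ + δ = s + ((n + 1 : ℕ) : ℝ) * δ by push_cast; ring] at h2
      refine (angle_le_angle_add_angle _ (γ (s + n * δ)) _).trans ?_
      push_cast at h2 ⊢
      linarith
  set h := t - s with hh
  have hh0 : 0 ≤ h := by linarith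
  have hlim : Filter.Tendsto (fun n : ℕ => h / (1 - (h / n) ^ 2 / 2)) Filter.atTop (nhds h) := by
    have h1 : Filter.Tendsto (fun n : ℕ => h / (n : ℝ)) Filter.atTop (nhds 0) :=
      tendsto_const_div_atTop_nhds_zero_nat h
    have h2 : Filter.Tendsto (fun n : ℕ => h / (1 - (h / n) ^ 2 / 2)) Filter.atTop
        (nhds (h / (1 - 0 ^ 2 / 2))) :=
      tendsto_const_nhds.div (tendsto_const_nhds.sub ((h1.pow 2).div_const 2)) (by norm_num)
    simpa using h2
  refine ge_of_tendsto hlim ?_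
  obtain ⟨N, hN⟩ := exists_nat_gt h
  filter_upwards [Filter.eventually_ge_atTop (max N 1)] with n hn'
  have hn1 : (N : ℝ) ≤ n := by exact_mod_cast (le_max_left _ _).trans hn'
  have hn2 : (0 : ℝ) < n := by
    have : 1 ≤ n := (le_max_right _ _).trans hn'
    exact_mod_cast this
  have := hsum (h / n) (by positivity) ((div_lt_one hn2).2 (by linarith)) n
  rw [show s + n * (h / n) = t by field_simp; rw [hh]; ring] at this
  refine this.trans (le_of_eq ?_)
  rw [← mul_div_assoc, mul_div_cancel₀ _ hn2.ne']

theorem IsSimpleClosedGeodesic.exists_period {S : Set E4} {γ : ℝ → E4} {L : ℝ}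
    (h : IsSimpleClosedGeodesic S γ L) {u v : ℝ} (huv : γ u = γ v) : ∃ n : ℤ, v = u + n * L := by
  have hL := h.length_pos
  have key : ∀ u, γ (toIcoMod hL 0 u) = γ u := fun u => by
    rw [toIcoMod, h.closed.sub_zsmul_eq]
  have hmem : ∀ u, toIcoMod hL 0 u ∈ Ico 0 L := fun u => by
    simpa using toIcoMod_mem_Ico hL 0 u
  have := h.simple (hmem u) (hmem v) (by rw [key, key, huv])
  simp only [toIcoMod, zsmul_eq_mul] at this
  refine ⟨toIcoDiv hL 0 v - toIcoDiv hL 0 u, ?_⟩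
  push_cast
  linarith

/-- The curve cannot run along an edge: being injective on a period, it would have infinitely many
points there. -/
theorem IsSimpleClosedGeodesic.isTetGeodesic {γ : ℝ → E4} {L : ℝ}
    (h : IsSimpleClosedGeodesic (surface b) γ L)
    (hfin : ∀ g g', g ≠ g' → {x ∈ range γ | b.repr x g = 0 ∧ b.repr x g' = 0}.Finite) :
    IsTetGeodesic b γ := by
  have hvar : ∀ s t, eVariationOn γ (Icc s t) = ENNReal.ofReal (t - s) := fun s t => by
    simpa using h.unit_speed (mem_univ s) (mem_univ t)
  have hl : ∀ s t, s ≤ t → ‖γ s - γ t‖ ≤ t - s := by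
    intro s t hst
    have := eVariationOn.edist_le γ (left_mem_Icc.2 hst) (right_mem_Icc.2 hst)
    rw [hvar, edist_dist, dist_eq_norm] at this
    exact (ENNReal.ofReal_le_ofReal_iff (by linarith)).1 this
  have hmem := fun t => mem_surface_iff.1 (h.mem_surface t)
  refine ⟨fun t => (hmem t).1, fun t => (hmem t).2.choose_spec.2,
    fun t => ⟨_, (hmem t).2.choose_spec.1⟩, ?_, fun s t hst =>
      angle_le_of_lipschitz (fun t => (hmem t).1) hl hst, ?_, ?_⟩
  · refine LipschitzWith.continuous (K := 1) (LipschitzWith.of_dist_le_mul fun s t => ?_)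
    rw [NNReal.coe_one, one_mul]
    rcases le_total s t with hst | hst
    · rw [dist_eq_norm, dist_comm, Real.dist_eq, abs_of_nonneg (by linarith)]
      exact hl s t hst
    · rw [dist_comm, dist_eq_norm, Real.dist_eq, abs_of_nonneg (by linarith)]
      exact hl t s hst
  · intro t
    obtain ⟨ε, hε, H⟩ := h.locally_shortest t
    refine ⟨ε, hε, fun u v h1 h2 h3 x y f g k hx hy a1 a2 a3 a4 a5 a6 => ?_⟩
    have hx' := norm_pos_iff.2 hx
    have hy' := norm_pos_iff.2 hy
    rcases h2.eq_or_lt with rfl | h2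
    · have := angle_nonneg (γ u) x
      have := angle_nonneg x y
      have := angle_nonneg y (γ u)
      linarith
    have nx : ‖‖x‖⁻¹ • x‖ = 1 := by rw [norm_smul, norm_inv, norm_norm, inv_mul_cancel₀ hx'.ne']
    have ny : ‖‖y‖⁻¹ • y‖ = 1 := by rw [norm_smul, norm_inv, norm_norm, inv_mul_cancel₀ hy'.ne']
    have ix := inv_pos.2 hx'
    have iy := inv_pos.2 hy'
    have j1 := joinable_of_inCone (hmem u).1 nx a1 (a2.smul ix.le)
    have j2 := joinable_of_inCone nx ny (a3.smul ix.le) (a4.smul iy.le)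
    have j3 := joinable_of_inCone ny (hmem v).1 (a5.smul iy.le) a6
    rw [angle_smul_right_of_pos _ _ ix] at j1
    rw [angle_smul_right_of_pos _ _ iy, angle_smul_left_of_pos _ _ ix] at j2
    rw [angle_smul_left_of_pos _ _ iy] at j3
    obtain ⟨δ, d1, d2, d3, d4, d5⟩ := ((j1.trans (angle_nonneg _ _) (angle_nonneg _ _) j2).trans
      (add_nonneg (angle_nonneg _ _) (angle_nonneg _ _)) (angle_nonneg _ _) j3) u v h2
    have := (H u v h1 h2.le h3 δ d1 d2 d3 d4).trans d5
    rw [hvar] at this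
    exact (ENNReal.ofReal_le_ofReal_iff (add_nonneg (add_nonneg (angle_nonneg _ _)
      (angle_nonneg _ _)) (angle_nonneg _ _))).1 this
  · intro s t hst g g' hg
    by_contra! hcon
    have hL := h.length_pos
    have hinj : InjOn γ (Ioo s (min t (s + L))) := by
      intro u hu v hv huv
      obtain ⟨n, hn⟩ := h.exists_period huv
      have hu2 := hu.2.trans_le (min_le_right _ _)
      have hv2 := hv.2.trans_le (min_le_right _ _)
      have hn1 : (n : ℝ) * L < 1 * L := by linarith [hu.1]
      have hn2 : (-1 : ℝ) * L < n * L := by linarith [hv.1]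
      have h1 : (n : ℝ) < 1 := lt_of_mul_lt_mul_right hn1 hL.le
      have h2 : (-1 : ℝ) < n := lt_of_mul_lt_mul_right hn2 hL.le
      have h3 : n < 1 := by exact_mod_cast h1
      have h4 : -1 < n := by exact_mod_cast h2
      have : n = 0 := by omega
      rw [hn, this]; simp
    have hlt : s < min t (s + L) := lt_min hst (by linarith)
    refine (Ioo_infinite hlt).image hinj ((hfin g g' hg).subset ?_)
    rintro _ ⟨u, hu, rfl⟩
    exact ⟨mem_range_self u, hcon u ⟨hu.1, hu.2.trans_le (min_le_left _ _)⟩⟩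

end SphericalTetrahedron

/-! ### Local shape: straight in faces and across edges, never through a vertex. -/

namespace SphericalTetrahedron

open Module InnerProductGeometry Filter Topology

variable {b : Basis (Fin 4) ℝ E4} {c : ℝ} {γ : ℝ → E4}

/-- Equality in the triangle inequality for angles puts `w` on the arc; the squared norm of the
difference of both sides turns out to be zero. -/
theorem interpolation {x w y : E4} (hx : ‖x‖ = 1) (hw : ‖w‖ = 1) (hy : ‖y‖ = 1)
    (h : angle x y = angle x w + angle w y) :
    Real.sin (angle x y) • w = Real.sin (angle w y) • x + Real.sin (angle x w) • y := by
  have e1 : inner ℝ x w = Real.cos (angle x w) := by rw [cos_angle, hx, hw]; simp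
  have e2 : inner ℝ w y = Real.cos (angle w y) := by rw [cos_angle, hw, hy]; simp
  have e3 : inner ℝ x y = Real.cos (angle x w + angle w y) := by rw [← h, cos_angle, hx, hy]; simp
  have f1 : inner ℝ x x = (1 : ℝ) := by rw [real_inner_self_eq_norm_sq, hx]; norm_num
  have f2 : inner ℝ w w = (1 : ℝ) := by rw [real_inner_self_eq_norm_sq, hw]; norm_num
  have f3 : inner ℝ y y = (1 : ℝ) := by rw [real_inner_self_eq_norm_sq, hy]; norm_num
  rw [h]
  set α := angle x w
  set β := angle w y
  rw [← sub_eq_zero, ← inner_self_eq_zero (𝕜 := ℝ)]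
  simp only [inner_sub_left, inner_sub_right, inner_add_left, inner_add_right, inner_smul_left,
    inner_smul_right, conj_trivial, real_inner_comm x w, real_inner_comm w y, real_inner_comm x y,
    e1, e2, e3, f1, f2, f3]
  rw [Real.sin_add, Real.cos_add]
  linear_combination -(Real.sin α ^ 2) * Real.sin_sq_add_cos_sq β
    - (Real.sin β ^ 2) * Real.sin_sq_add_cos_sq α

theorem IsTetGeodesic.ne_zero (h : IsTetGeodesic b γ) (t : ℝ) : γ t ≠ 0 := by
  intro h0
  have := h.norm_eq_one t
  rw [h0] at this
  simp at this

/-- Between two sufficiently close points in one face, a geodesic is an arc of a great circle. -/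
theorem IsTetGeodesic.exists_arc (h : IsTetGeodesic b γ) (t : ℝ) : ∃ ε > 0, ∀ u v, t - ε ≤ u →
    u < v → v ≤ t + ε → ∀ f, b.repr (γ u) f = 0 → b.repr (γ v) f = 0 →
    ∃ V, ‖V‖ = 1 ∧ inner ℝ (γ u) V = 0 ∧ b.repr V f = 0 ∧
      ∀ s ∈ Icc u v, γ s = great (γ u) V (s - u) := by
  obtain ⟨ε, hε, H⟩ := h.shortest t
  refine ⟨ε, hε, fun u v h1 h2 h3 f hu hv => ?_⟩
  have cu : InCone b f (γ u) := ⟨hu, h.nonneg u⟩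
  have cv : InCone b f (γ v) := ⟨hv, h.nonneg v⟩
  have hang : angle (γ u) (γ v) = v - u := by
    refine le_antisymm (h.angle_le u v h2.le) ?_
    -- The competitor is the direct arc; both breaks are placed at its end.
    have := H u v h1 h2.le h3 (γ v) (γ v) f f f (h.ne_zero v) (h.ne_zero v) cu cv cv cv cv cv
    rw [angle_self (h.ne_zero v)] at this
    linarith
  have hπ := angle_lt_pi_of_nonneg (x := γ u) (h.nonneg u) (h.nonneg v) (h.ne_zero v)
  obtain ⟨V, hV, hUV, hend⟩ := exists_great (h.norm_eq_one u) (h.norm_eq_one v) hπ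
  rw [hang] at hπ hend
  have hs := Real.sin_pos_of_pos_of_lt_pi (sub_pos.2 h2) hπ
  refine ⟨V, ?_, hUV, ?_, fun s hs' => ?_⟩
  · have h4 := h.norm_eq_one v
    have h5 : ‖great (γ u) V (v - u)‖ ^ 2 = 1 := by rw [hend, h4]; norm_num
    rw [great, norm_add_sq_real, norm_smul, norm_smul, inner_smul_left, inner_smul_right, hUV,
      h.norm_eq_one] at h5
    simp only [Real.norm_eq_abs, mul_one, sq_abs, mul_zero, add_zero, mul_pow] at h5
    have h6 : Real.sin (v - u) ^ 2 * (‖V‖ ^ 2 - 1) = 0 := by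
      linear_combination h5 - Real.sin_sq_add_cos_sq (v - u)
    rcases mul_eq_zero.1 h6 with h7 | h7
    · exact absurd h7 (pow_ne_zero 2 hs.ne')
    · nlinarith [norm_nonneg V]
  · have := congrArg (fun x => b.repr x f) hend
    simp only [repr_great, hu, hv, mul_zero, zero_add] at this
    exact (mul_eq_zero.1 this).resolve_left hs.ne'
  · have a1 := h.angle_le u s hs'.1
    have a2 := h.angle_le s v hs'.2
    have a3 := angle_le_angle_add_angle (γ u) (γ s) (γ v)
    have e1 : angle (γ u) (γ s) = s - u := by linarith
    have e2 : angle (γ s) (γ v) = v - s := by linarith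
    have hi := interpolation (h.norm_eq_one u) (h.norm_eq_one s) (h.norm_eq_one v)
      (by rw [hang, e1, e2]; ring)
    rw [hang, e1, e2] at hi
    have hg := sin_smul_great (γ u) V 0 (v - u) (s - u)
    rw [great_zero, hend, sub_zero, sub_zero, show v - u - (s - u) = v - s by ring, ← hi] at hg
    exact (smul_right_injective E4 hs.ne' hg).symm

/-- On one side of the time `t`, given by the sign `σ`, the curve is an arc of a great circle in the
face `f`. -/
structure Germ (b : Basis (Fin 4) ℝ E4) (γ : ℝ → E4) (t σ : ℝ) (f : Fin 4) (V : E4) (δ : ℝ) :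
    Prop where
  pos : 0 < δ
  norm_eq_one : ‖V‖ = 1
  inner_eq_zero : inner ℝ (γ t) V = 0
  repr_eq_zero : b.repr (γ t) f = 0
  repr_dir : b.repr V f = 0
  eq_great : ∀ s, 0 ≤ s → s ≤ δ → γ (t + σ * s) = great (γ t) V s

theorem Germ.mono {t σ δ δ' : ℝ} {f : Fin 4} {V : E4} (h : Germ b γ t σ f V δ) (hδ : 0 < δ')
    (hle : δ' ≤ δ) : Germ b γ t σ f V δ' :=
  ⟨hδ, h.norm_eq_one, h.inner_eq_zero, h.repr_eq_zero, h.repr_dir,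
    fun s h0 h1 => h.eq_great s h0 (h1.trans hle)⟩

/-- Some face contains the curve at times accumulating at `t` from the right. Being closed, it also
contains `γ t`, so `exists_arc` applies between `t` and one of these times. -/
theorem IsTetGeodesic.exists_germ_right (h : IsTetGeodesic b γ) (t : ℝ) :
    ∃ f V δ, Germ b γ t 1 f V δ := by
  obtain ⟨ε, hε, H⟩ := h.exists_arc t
  have hcont : ∀ f, Continuous fun s => b.repr (γ s) f := fun f =>
    (LinearMap.continuous_of_finiteDimensional (b.coord f)).comp h.continuous
  have hf : ∃ f, ∃ᶠ s in 𝓝[>] t, b.repr (γ s) f = 0 := by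
    by_contra! hcon
    have h1 : ∀ᶠ s in 𝓝[>] t, ∀ f, b.repr (γ s) f ≠ 0 := by
      rw [eventually_all]
      exact fun f => by simpa using hcon f
    obtain ⟨s, hs⟩ := h1.exists
    obtain ⟨f, hf⟩ := h.exists_zero s
    exact hs f hf
  obtain ⟨f, hf⟩ := hf
  have h0 : b.repr (γ t) f = 0 := by
    have hcl : IsClosed {s | b.repr (γ s) f = 0} := isClosed_eq (hcont f) continuous_const
    exact hcl.mem_of_frequently_of_tendsto hf (tendsto_id.mono_left nhdsWithin_le_nhds)
  have hev : ∀ᶠ s in 𝓝[>] t, s ∈ Ioc t (t + ε) := Ioc_mem_nhdsGT (by linarith)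
  obtain ⟨v, hv, hv'⟩ := (hf.and_eventually hev).exists
  obtain ⟨V, h1, h2, h3, h4⟩ := H t v (by linarith) hv'.1 hv'.2 f h0 hv
  refine ⟨f, V, v - t, sub_pos.2 hv'.1, h1, h2, h0, h3, fun s hs hs' => ?_⟩
  rw [one_mul, h4 (t + s) ⟨by linarith, by linarith⟩, add_sub_cancel_left]

theorem IsTetGeodesic.exists_germ_left (h : IsTetGeodesic b γ) (t : ℝ) :
    ∃ f V δ, Germ b γ t (-1) f V δ := by
  obtain ⟨f, V, δ, h1, h2, h3, h4, h5, h6⟩ := h.reverse.exists_germ_right (-t)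
  simp only [neg_neg] at h3 h4 h6
  refine ⟨f, V, δ, h1, h2, h3, h4, h5, fun s hs hs' => ?_⟩
  rw [← h6 s hs hs']
  congr 1
  ring

theorem Germ.repr_nonneg (h : IsTetGeodesic b γ) {t σ δ : ℝ} {f k : Fin 4} {V : E4}
    (hg : Germ b γ t σ f V δ) (hk : b.repr (γ t) k = 0) : 0 ≤ b.repr V k := by
  set s := min δ 1
  have hs0 : 0 < s := lt_min hg.pos one_pos
  have h1 := h.nonneg (t + σ * s) k
  rw [hg.eq_great s hs0.le (min_le_left _ _), repr_great, hk, mul_zero, zero_add] at h1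
  exact nonneg_of_mul_nonneg_right h1 (Real.sin_pos_of_pos_of_lt_pi hs0
    (by linarith [min_le_right δ 1, Real.pi_gt_three]))

/-- Otherwise the arc would run along the common edge of `f` and `k`. -/
theorem Germ.repr_pos (h : IsTetGeodesic b γ) {t σ δ : ℝ} (hσ : σ = 1 ∨ σ = -1) {f k : Fin 4}
    {V : E4} (hg : Germ b γ t σ f V δ) (hkf : k ≠ f) (hk : b.repr (γ t) k = 0) :
    0 < b.repr V k := by
  refine (hg.repr_nonneg h hk).lt_of_ne' fun h0 => ?_
  have hz : ∀ s, 0 ≤ s → s ≤ δ → b.repr (γ (t + σ * s)) f = 0 ∧ b.repr (γ (t + σ * s)) k = 0 := by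
    intro s h1 h2
    rw [hg.eq_great s h1 h2]
    simp [repr_great, hg.repr_eq_zero, hg.repr_dir, hk, h0]
  have hδ := hg.pos
  rcases hσ with rfl | rfl
  · obtain ⟨u, hu, hu'⟩ := h.leaves_edge t (t + δ) (by linarith) f k hkf.symm
    have := hz (u - t) (by linarith [hu.1]) (by linarith [hu.2])
    rw [show t + 1 * (u - t) = u by ring] at this
    rcases hu' with h' | h'
    exacts [h' this.1, h' this.2]
  · obtain ⟨u, hu, hu'⟩ := h.leaves_edge (t - δ) t (by linarith) f k hkf.symm
    have := hz (t - u) (by linarith [hu.2]) (by linarith [hu.1])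
    rw [show t + -1 * (t - u) = u by ring] at this
    rcases hu' with h' | h'
    exacts [h' this.1, h' this.2]

/-- A geodesic that stays in one face near the time `t` is straight at this time. -/
theorem IsTetGeodesic.neg_of_germs (h : IsTetGeodesic b γ) {t δ : ℝ} {f : Fin 4} {U V : E4}
    (hl : Germ b γ t (-1) f U δ) (hr : Germ b γ t 1 f V δ) : U = -V := by
  obtain ⟨ε, hε, H⟩ := h.exists_arc t
  set s := min (min δ ε) 1 with hs
  have hs0 : 0 < s := lt_min (lt_min hr.pos hε) one_pos
  have hsδ : s ≤ δ := (min_le_left _ _).trans (min_le_left _ _)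
  have hsε : s ≤ ε := (min_le_left _ _).trans (min_le_right _ _)
  have hsin : 0 < Real.sin s := Real.sin_pos_of_pos_of_lt_pi hs0
    (by linarith [min_le_right (min δ ε) 1, Real.pi_gt_three])
  have e1 := hl.eq_great s hs0.le hsδ
  have e2 := hr.eq_great s hs0.le hsδ
  rw [show t + -1 * s = t - s by ring] at e1
  rw [one_mul] at e2
  obtain ⟨W, -, -, -, hW⟩ := H (t - s) (t + s) (by linarith) (by linarith) (by linarith) f
    (by rw [e1, repr_great, hl.repr_eq_zero, hl.repr_dir]; ring)
    (by rw [e2, repr_great, hr.repr_eq_zero, hr.repr_dir]; ring)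
  have f1 := hW t ⟨by linarith, by linarith⟩
  have f2 := hW (t + s) ⟨by linarith, by linarith⟩
  rw [show t - (t - s) = s by ring] at f1
  rw [show t + s - (t - s) = 2 * s by ring] at f2
  have key := sin_smul_great (γ (t - s)) W 0 (2 * s) s
  rw [great_zero, ← f1, ← f2, sub_zero, show 2 * s - s = s by ring, sub_zero, Real.sin_two_mul,
    e1, e2] at key
  simp only [great] at key
  have h2 : (Real.sin s * Real.sin s) • (U + V) = 0 := by
    have : (Real.sin s * Real.sin s) • (U + V) =
      (Real.sin s • (Real.cos s • γ t + Real.sin s • U) + Real.sin s • (Real.cos s • γ t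
        + Real.sin s • V)) - (2 * Real.sin s * Real.cos s) • γ t := by module
    rw [this, key, sub_self]
  exact eq_neg_of_add_eq_zero_left ((smul_eq_zero.1 h2).resolve_left (mul_pos hsin hsin).ne')

/-- On the boundary of the face, both directions would have to point inwards although they are
opposite. -/
theorem IsTetGeodesic.pos_of_germs (h : IsTetGeodesic b γ) {t δ : ℝ} {f : Fin 4} {U V : E4}
    (hl : Germ b γ t (-1) f U δ) (hr : Germ b γ t 1 f V δ) {k : Fin 4} (hk : k ≠ f) :
    0 < b.repr (γ t) k := by
  refine (h.nonneg t k).lt_of_ne' fun h0 => ?_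
  have h1 := hl.repr_pos h (Or.inr rfl) hk h0
  have h2 := hr.repr_pos h (Or.inl rfl) hk h0
  rw [h.neg_of_germs hl hr] at h1
  simp at h1
  linarith

/-- The first variation of the spherical distance. Angles ignore scaling, so the point may move
along a straight line off the sphere. -/
theorem hasDerivAt_angle {x u : E4} (hx : ‖x‖ = 1) (hu : ‖u‖ = 1) (hxu : inner ℝ x u = 0) {s : ℝ}
    (hs : 0 < s) (hs' : s < Real.pi) (w : E4) :
    HasDerivAt (fun r : ℝ => angle (great x u s) (x + r • w)) (-inner ℝ u w) 0 := by
  have hsin := Real.sin_pos_of_pos_of_lt_pi hs hs'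
  have hxx : inner ℝ x x = (1 : ℝ) := by rw [real_inner_self_eq_norm_sq, hx]; norm_num
  have hN : HasDerivAt (fun r : ℝ => ‖x + r • w‖) (inner ℝ x w) 0 := by
    have h1 : HasDerivAt (fun r : ℝ => 1 + 2 * inner ℝ x w * r + ‖w‖ ^ 2 * r ^ 2)
        (2 * inner ℝ x w) 0 := by
      have a1 := ((hasDerivAt_id (0 : ℝ)).const_mul (2 * inner ℝ x w)).const_add 1
      have a2 := ((hasDerivAt_id (0 : ℝ)).pow 2).const_mul (‖w‖ ^ 2)
      exact (a1.add a2).congr_deriv (by simp)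
    have h2 := h1.sqrt (by simp)
    have h3 : (fun r : ℝ => ‖x + r • w‖) =
        fun r => Real.sqrt (1 + 2 * inner ℝ x w * r + ‖w‖ ^ 2 * r ^ 2) := by
      funext r
      rw [← Real.sqrt_sq (norm_nonneg (x + r • w)), norm_add_sq_real, norm_smul, inner_smul_right, hx,
        mul_pow, Real.norm_eq_abs, sq_abs]
      congr 1
      ring
    rw [h3]
    convert h2 using 1
    simp
  have hI : HasDerivAt (fun r : ℝ => inner ℝ (great x u s) (x + r • w))
      (Real.cos s * inner ℝ x w + Real.sin s * inner ℝ u w) 0 := by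
    have h1 : (fun r : ℝ => inner ℝ (great x u s) (x + r • w)) = fun r =>
        inner ℝ (great x u s) x + (Real.cos s * inner ℝ x w + Real.sin s * inner ℝ u w) * r := by
      funext r
      rw [inner_add_right, inner_smul_right, inner_great x u w]
      ring
    rw [h1]
    simpa using ((hasDerivAt_id (0 : ℝ)).const_mul
      (Real.cos s * inner ℝ x w + Real.sin s * inner ℝ u w)).const_add (inner ℝ (great x u s) x)
  have h0 : inner ℝ (great x u s) x = Real.cos s := by
    rw [inner_great, hxx, real_inner_comm, hxu]; ring
  have hQ : HasDerivAt (fun r : ℝ => inner ℝ (great x u s) (x + r • w) /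
      (‖great x u s‖ * ‖x + r • w‖)) (Real.sin s * inner ℝ u w) 0 := by
    have := hI.div (hN.const_mul ‖great x u s‖) (by rw [norm_great hx hu hxu]; simp [hx])
    rw [norm_great hx hu hxu] at this ⊢
    refine this.congr_deriv ?_
    simp only [zero_smul, add_zero, hx, h0]
    ring
  have hval : Real.cos s = inner ℝ (great x u s) (x + (0 : ℝ) • w) /
      (‖great x u s‖ * ‖x + (0 : ℝ) • w‖) := by
    simp only [zero_smul, add_zero, hx, h0, norm_great hx hu hxu, mul_one, div_one]
  have hlt : Real.cos s ^ 2 < 1 := by nlinarith [Real.sin_sq_add_cos_sq s, sq_pos_of_pos hsin]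
  have hA := (Real.hasDerivAt_arccos (x := Real.cos s) (by intro h; rw [h] at hlt; norm_num at hlt)
    (by intro h; rw [h] at hlt; norm_num at hlt)).comp_of_eq 0 hQ hval
  refine hA.congr_deriv ?_
  rw [← Real.sin_sq, Real.sqrt_sq hsin.le]
  field_simp

/-- The direction `w` points from the point `x` into the face `f`. -/
def PointsInto (b : Basis (Fin 4) ℝ E4) (f : Fin 4) (x w : E4) : Prop :=
  b.repr x f = 0 ∧ b.repr w f = 0 ∧ ∀ k, b.repr x k = 0 → 0 ≤ b.repr w k

theorem PointsInto.eventually_inCone {f : Fin 4} {x w : E4} (h : PointsInto b f x w)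
    (hx : ∀ k, 0 ≤ b.repr x k) : ∀ᶠ r : ℝ in 𝓝[>] 0, InCone b f (x + r • w) := by
  have h1 : ∀ᶠ r : ℝ in 𝓝[>] 0, ∀ k, 0 ≤ b.repr (x + r • w) k := by
    rw [eventually_all]
    intro k
    rcases (hx k).eq_or_lt with h0 | h0
    · filter_upwards [self_mem_nhdsWithin] with r hr
      have := mul_nonneg (le_of_lt hr) (h.2.2 k h0.symm)
      simpa [← h0] using this
    · have hc : ContinuousAt (fun r : ℝ => b.repr x k + r * b.repr w k) 0 := by fun_prop
      have : ∀ᶠ r : ℝ in 𝓝 0, 0 < b.repr x k + r * b.repr w k :=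
        hc.eventually (lt_mem_nhds (by simpa using h0))
      filter_upwards [this.filter_mono nhdsWithin_le_nhds] with r hr
      simpa using hr.le
  filter_upwards [h1] with r hr
  exact ⟨by simp [h.1, h.2.1], hr⟩

/-- The first variation of the length of a geodesic, under a variation of its point at the time `t`
into an arc in the face `k`. -/
theorem IsTetGeodesic.first_variation (h : IsTetGeodesic b γ) {t δ : ℝ} {i j k : Fin 4} {U V : E4}
    (hl : Germ b γ t (-1) i U δ) (hr : Germ b γ t 1 j V δ) {w w' : E4}
    (h1 : PointsInto b i (γ t) w) (h2 : PointsInto b k (γ t) w) (h3 : PointsInto b k (γ t) w')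
    (h4 : PointsInto b j (γ t) w') : inner ℝ U w + inner ℝ V w' ≤
      Real.sqrt (inner ℝ (w' - w) (w' - w) - inner ℝ (γ t) (w' - w) * inner ℝ (γ t) (w' - w)) := by
  obtain ⟨ε, hε, H⟩ := h.shortest t
  set s := min (min δ ε) 1 with hs
  have hs0 : 0 < s := lt_min (lt_min hr.pos hε) one_pos
  have hsδ : s ≤ δ := (min_le_left _ _).trans (min_le_left _ _)
  have hsε : s ≤ ε := (min_le_left _ _).trans (min_le_right _ _)
  have hsπ : s < Real.pi := by linarith [min_le_right (min δ ε) 1, Real.pi_gt_three]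
  have hX := h.norm_eq_one t
  have e1 := hl.eq_great s hs0.le hsδ
  have e2 := hr.eq_great s hs0.le hsδ
  rw [show t + -1 * s = t - s by ring] at e1
  rw [one_mul] at e2
  set X := γ t with hXdef
  set D := w' - w with hD
  have hXX : inner ℝ X X = (1 : ℝ) := by rw [real_inner_self_eq_norm_sq, hX]; norm_num
  have d1 := hasDerivAt_angle hX hl.norm_eq_one hl.inner_eq_zero hs0 hsπ w
  have d2 := hasDerivAt_angle hX hr.norm_eq_one hr.inner_eq_zero hs0 hsπ w'
  have a0 : ∀ W : E4, ‖W‖ = 1 → inner ℝ X W = 0 → angle (great X W s) (X + (0 : ℝ) • w) = s ∧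
      angle (great X W s) (X + (0 : ℝ) • w') = s := by
    intro W hW hXW
    have : angle (great X W s) X = s := by
      rw [angle, norm_great hX hW hXW, hX, inner_great, hXX, real_inner_comm, hXW]
      simp [Real.arccos_cos hs0.le hsπ.le]
    simpa using this
  have t1 := (hasDerivAt_iff_tendsto_slope.1 d1).mono_left (nhdsWithin_mono 0 (s := Ioi 0)
    (t := {0}ᶜ) fun r hr => (ne_of_gt hr : r ≠ 0))
  have t2 := (hasDerivAt_iff_tendsto_slope.1 d2).mono_left (nhdsWithin_mono 0 (s := Ioi 0)
    (t := {0}ᶜ) fun r hr => (ne_of_gt hr : r ≠ 0))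
  -- By `angle_le_tan`, `r * G r` bounds the middle arc: the Gram determinant of its ends is `r²`
  -- times that of `X + r • w` and `D`.
  set G : ℝ → ℝ := fun r => Real.sqrt (inner ℝ (X + r • w) (X + r • w) * inner ℝ D D -
    inner ℝ (X + r • w) D * inner ℝ (X + r • w) D) / inner ℝ (X + r • w) (X + r • w') with hG
  have hGc : ContinuousAt G 0 := by
    refine ContinuousAt.div (by fun_prop) (by fun_prop) ?_
    simp [hX]
  have t3 : Tendsto G (𝓝[>] 0) (𝓝 (Real.sqrt (inner ℝ D D - inner ℝ X D * inner ℝ X D))) := by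
    have : G 0 = Real.sqrt (inner ℝ D D - inner ℝ X D * inner ℝ X D) := by
      simp only [hG, zero_smul, add_zero, hXX, one_mul, div_one]
    rw [← this]
    exact hGc.tendsto.mono_left nhdsWithin_le_nhds
  have tsum := (t1.add t2).add t3
  have hge : ∀ᶠ r in 𝓝[>] (0 : ℝ), 0 ≤ slope (fun r : ℝ => angle (great X U s) (X + r • w)) 0 r
      + slope (fun r : ℝ => angle (great X V s) (X + r • w')) 0 r + G r := by
    have hpos : ∀ᶠ r in 𝓝[>] (0 : ℝ), 0 < inner ℝ (X + r • w) (X + r • w') := by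
      have hc : ContinuousAt (fun r : ℝ => inner ℝ (X + r • w) (X + r • w')) 0 := by fun_prop
      have : ∀ᶠ r in 𝓝 (0 : ℝ), 0 < inner ℝ (X + r • w) (X + r • w') :=
        hc.eventually (lt_mem_nhds (by simp [hX]))
      exact this.filter_mono nhdsWithin_le_nhds
    have hnn := h.nonneg t
    filter_upwards [hpos, h1.eventually_inCone hnn, h2.eventually_inCone hnn,
      h3.eventually_inCone hnn, h4.eventually_inCone hnn, self_mem_nhdsWithin] with r r0 r1 r2 r3 r4 r5
    have r5 : 0 < r := r5
    have n1 : X + r • w ≠ 0 := by intro h0; rw [h0] at r0; simp at r0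
    have n2 : X + r • w' ≠ 0 := by intro h0; rw [h0] at r0; simp at r0
    have hmain := H (t - s) (t + s) (by linarith) (by linarith) (by linarith) _ _ i k j n1 n2
      ⟨by rw [e1, repr_great, hl.repr_eq_zero, hl.repr_dir]; ring, h.nonneg _⟩ r1 r2 r3 r4
      ⟨by rw [e2, repr_great, hr.repr_eq_zero, hr.repr_dir]; ring, h.nonneg _⟩
    rw [e1, e2, angle_comm _ (great X V s)] at hmain
    have htan := angle_le_tan r0
    have hgram : inner ℝ (X + r • w) (X + r • w) * inner ℝ (X + r • w') (X + r • w')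
        - inner ℝ (X + r • w) (X + r • w') * inner ℝ (X + r • w) (X + r • w') =
        r ^ 2 * (inner ℝ (X + r • w) (X + r • w) * inner ℝ D D -
          inner ℝ (X + r • w) D * inner ℝ (X + r • w) D) := by
      have : X + r • w' = (X + r • w) + r • D := by rw [hD]; module
      rw [this]
      generalize X + r • w = Y
      simp only [inner_add_left, inner_add_right, inner_smul_left, inner_smul_right, conj_trivial,
        real_inner_comm Y D]
      ring
    rw [hgram, Real.sqrt_mul (sq_nonneg r), Real.sqrt_sq r5.le, mul_div_assoc] at htan
    simp only [slope_def_field, sub_zero]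
    rw [(a0 U hl.norm_eq_one hl.inner_eq_zero).1, (a0 V hr.norm_eq_one hr.inner_eq_zero).2, ← add_div,
      div_add' _ _ _ r5.ne']
    refine div_nonneg ?_ r5.le
    simp only [hG]
    linarith
  have := ge_of_tendsto tsum hge
  linarith

theorem pointsInto_basis {f k : Fin 4} {x : E4} (hx : b.repr x f = 0) (hk : k ≠ f) {r : ℝ}
    (hr : 0 ≤ r) : PointsInto b f x (r • b k) := by
  refine ⟨hx, by simp [Finsupp.single_apply, hk], fun j _ => ?_⟩
  rw [map_smul, b.repr_self, Finsupp.smul_apply, Finsupp.single_apply, smul_eq_mul]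
  split_ifs <;> simp [hr]

theorem pointsInto_neg_basis {f k : Fin 4} {x : E4} (hx : b.repr x f = 0) (hk : k ≠ f)
    (hk' : b.repr x k ≠ 0) : PointsInto b f x (-b k) := by
  refine ⟨hx, by simp [Finsupp.single_apply, hk], fun j hj => ?_⟩
  have : k ≠ j := by rintro rfl; exact hk' hj
  simp [Finsupp.single_apply, this]

/-- Both breaks move together along the edge towards `b k`, so the middle arc has length zero. -/
theorem IsTetGeodesic.inner_add_nonpos (h : IsTetGeodesic b γ) {t δ : ℝ} {i j k : Fin 4} {U V : E4}
    (hl : Germ b γ t (-1) i U δ) (hr : Germ b γ t 1 j V δ) (hi : k ≠ i) (hj : k ≠ j) :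
    inner ℝ U (b k) + inner ℝ V (b k) ≤ 0 := by
  have h1 := pointsInto_basis hl.repr_eq_zero hi zero_le_one
  have h2 := pointsInto_basis hr.repr_eq_zero hj zero_le_one
  rw [one_smul] at h1 h2
  simpa using h.first_variation hl hr h1 h1 h1 h2

/-- The law of reflection at an edge. -/
theorem IsTetGeodesic.inner_add_eq_zero (h : IsTetGeodesic b γ) {t δ : ℝ} {i j k : Fin 4} {U V : E4}
    (hl : Germ b γ t (-1) i U δ) (hr : Germ b γ t 1 j V δ) (hi : k ≠ i) (hj : k ≠ j)
    (hk : b.repr (γ t) k ≠ 0) : inner ℝ U (b k) + inner ℝ V (b k) = 0 := by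
  have h1 := pointsInto_neg_basis hl.repr_eq_zero hi hk
  have h2 := pointsInto_neg_basis hr.repr_eq_zero hj hk
  have h3 := h.first_variation hl hr h1 h1 h1 h2
  simp only [sub_self, inner_zero_right, inner_neg_right, mul_zero, Real.sqrt_zero] at h3
  linarith [h.inner_add_nonpos hl hr hi hj]

/-- The quantitative form of `3α < 2π` at a vertex, with `e = -c`. The last hypothesis says that
there is no shortcut over the edge `k`; the conclusions then produce one on the other side of the
vertex. -/
theorem vertex_estimate {e x y P R K : ℝ} (he : 0 < e) (he' : e < 1 / 3) (hx : 0 < x) (hy : 0 < y)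
    (hK : K * (1 + e) = 1 - e) (hP : P ^ 2 + (1 - 2 * e) * x ^ 2 = K)
    (hR : R ^ 2 + (1 - 2 * e) * y ^ 2 = K) (h : (1 - 2 * e) * (x + y) ≤ e * (P + R)) :
    0 < y * P + x * R ∧ e < (1 + e) * (P * R - (1 - 2 * e) * (x * y)) := by
  have hw : 0 < 1 - 2 * e := by linarith
  set w := 1 - 2 * e with hwdef
  have hK0 : 0 < K := by
    by_contra hcon
    have := mul_nonneg_of_nonpos_of_nonpos (not_lt.1 hcon) (show -(1 + e) ≤ 0 by linarith)
    linarith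
  have hxy : 0 < w * (x + y) := by positivity
  have hPR : 0 < P + R := by
    by_contra hcon
    have := mul_nonneg he.le (sub_nonneg.2 (not_lt.1 hcon))
    linarith
  -- With `P = √K cos φ`, `√w x = √K sin φ`, and likewise `R`, `y` with `ψ`, these are the
  -- identities for sums of sines and cosines. The hypothesis `h` bounds the tangent of `(φ + ψ) /
  -- 2`.
  have i1 : K * (P + R) ^ 2 = (K + P * R - w * (x * y)) * (K + P * R + w * (x * y)) := by
    linear_combination (K - R ^ 2) * hP + w * x ^ 2 * hR
  have i2 : K * w * (x + y) ^ 2 = (K - P * R + w * (x * y)) * (K + P * R + w * (x * y)) := by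
    linear_combination R ^ 2 * hP + (K - w * x ^ 2) * hR
  have i3 : (y * P + x * R) * (K + P * R + w * (x * y)) = K * ((P + R) * (x + y)) := by
    linear_combination y * R * hP + x * P * hR
  have hs : 0 < K + P * R + w * (x * y) := by
    have hxy' : 0 < w * (x * y) := by positivity
    have : 0 < (K - P * R + w * (x * y)) * (K + P * R + w * (x * y)) := by rw [← i2]; positivity
    rcases pos_and_pos_or_neg_and_neg_of_mul_pos this with h1 | h1 <;> linarith [h1.1, h1.2]
  refine ⟨?_, ?_⟩
  · have : 0 < (y * P + x * R) * (K + P * R + w * (x * y)) := by rw [i3]; positivity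
    exact pos_of_mul_pos_left this hs.le
  · have h1 : (w * (x + y)) ^ 2 ≤ (e * (P + R)) ^ 2 := pow_le_pow_left₀ hxy.le h 2
    have h2 : w * (K - P * R + w * (x * y)) ≤ e ^ 2 * (K + P * R - w * (x * y)) := by
      refine le_of_mul_le_mul_right ?_ hs
      have := mul_le_mul_of_nonneg_left h1 hK0.le
      nlinarith
    have h3 : K * (w - e ^ 2) ≤ (P * R - w * (x * y)) * (1 - e) ^ 2 := by
      have : (1 - e) ^ 2 = w + e ^ 2 := by rw [hwdef]; ring
      rw [this]; linarith
    have h4 : (1 - e) * (w - e ^ 2) ≤ (1 + e) * (P * R - w * (x * y)) * (1 - e) ^ 2 := by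
      have := mul_le_mul_of_nonneg_left h3 (show 0 ≤ 1 + e by linarith)
      calc (1 - e) * (w - e ^ 2) = (1 + e) * (K * (w - e ^ 2)) := by rw [← hK]; ring
        _ ≤ _ := this
        _ = _ := by ring
    have h5 : w - e ^ 2 ≤ (1 + e) * (P * R - w * (x * y)) * (1 - e) := by
      refine le_of_mul_le_mul_left ?_ (show 0 < 1 - e by linarith)
      linarith
    have h6 : e * (1 - e) < w - e ^ 2 := by rw [hwdef]; linarith
    exact lt_of_mul_lt_mul_right (h6.trans_le h5) (by linarith)

theorem exists_two_more {i j k : Fin 4} (hij : i ≠ j) (hki : k ≠ i) (hkj : k ≠ j) :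
    ∃ v, v ≠ i ∧ v ≠ j ∧ v ≠ k ∧ ∀ f : Fin 4 → ℝ, ∑ n, f n = f v + f i + f j + f k := by
  have : ∃ v, v ≠ i ∧ v ≠ j ∧ v ≠ k := by revert i j k; decide
  obtain ⟨v, h1, h2, h3⟩ := this
  refine ⟨v, h1, h2, h3, fun f => ?_⟩
  have hu : (Finset.univ : Finset (Fin 4)) = {v, i, j, k} := by
    revert i j k v; decide
  rw [hu, Finset.sum_insert (by simp [h1, h2, h3]), Finset.sum_insert (by simp [hij, hki.symm]),
    Finset.sum_insert (by simp [hkj.symm]), Finset.sum_singleton]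
  ring

/-- A geodesic does not pass through a vertex. -/
theorem IsTetGeodesic.pos_of_germs_ne (hb : IsRegularBasis b c) (h : IsTetGeodesic b γ) {t δ : ℝ}
    {i j : Fin 4} {U V : E4} (hl : Germ b γ t (-1) i U δ) (hr : Germ b γ t 1 j V δ) (hij : i ≠ j)
    {k : Fin 4} (hki : k ≠ i) (hkj : k ≠ j) : 0 < b.repr (γ t) k := by
  refine (h.nonneg t k).lt_of_ne' fun h0 => ?_
  obtain ⟨v, hvi, hvj, hvk, hsum⟩ := exists_two_more hij hki hkj
  have hc1 := hb.lt_one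
  have hc3 := hb.neg_third_lt
  have hX : γ t = b v := by
    have h1 : γ t = b.repr (γ t) v • b v := by
      apply b.ext_elem
      intro n
      have hn : n = v ∨ n = i ∨ n = j ∨ n = k := by
        clear * - hij hki hkj hvi hvj hvk
        revert n i j k v; decide
      rcases hn with rfl | rfl | rfl | rfl
      · simp
      · simp [hl.repr_eq_zero, Finsupp.single_apply, hvi]
      · simp [hr.repr_eq_zero, Finsupp.single_apply, hvj]
      · simp [h0, Finsupp.single_apply, hvk]
    have h2 := h.norm_eq_one t
    rw [h1, norm_smul, hb.norm_eq_one, mul_one, Real.norm_of_nonneg (h.nonneg t v)] at h2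
    rw [h1, h2, one_smul]
  have hUj := hl.repr_pos h (Or.inr rfl) hij.symm hr.repr_eq_zero
  have hUk := hl.repr_pos h (Or.inr rfl) hki h0
  have hVi := hr.repr_pos h (Or.inl rfl) hij hl.repr_eq_zero
  have hVk := hr.repr_pos h (Or.inl rfl) hkj h0
  have hUi := hl.repr_dir
  have hVj := hr.repr_dir
  have oU := hl.inner_eq_zero
  have oV := hr.inner_eq_zero
  have nU : inner ℝ U U = (1 : ℝ) := by rw [real_inner_self_eq_norm_sq, hl.norm_eq_one]; norm_num
  have nV : inner ℝ V V = (1 : ℝ) := by rw [real_inner_self_eq_norm_sq, hr.norm_eq_one]; norm_num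
  -- `v1` compares with passing the vertex over the edge towards `b k`. `v2` compares with passing
  -- it on the other side, through the face `k`, over the edges towards `b j` and `b i`; each break
  -- is weighted by the coordinate of the opposite direction, which makes the estimate symmetric.
  have v1 := h.inner_add_nonpos hl hr hki hkj
  have v2 := h.first_variation hl hr (k := k) (w := b.repr V k • b j) (w' := b.repr U k • b i)
    (pointsInto_basis hl.repr_eq_zero hij.symm hVk.le) (pointsInto_basis h0 hkj.symm hVk.le)
    (pointsInto_basis h0 hki.symm hUk.le) (pointsInto_basis hr.repr_eq_zero hij hUk.le)
  rw [hX, real_inner_comm, hb.inner_basis_right, hsum] at oU oV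
  rw [hX] at v2
  rw [hb.inner_eq_repr, hsum, hsum] at nU nV
  rw [hb.inner_basis_right, hb.inner_basis_right, hsum, hsum] at v1
  have i1 : inner ℝ (b i) (b i) = (1 : ℝ) := by
    rw [real_inner_self_eq_norm_sq, hb.norm_eq_one]; norm_num
  have i2 : inner ℝ (b j) (b j) = (1 : ℝ) := by
    rw [real_inner_self_eq_norm_sq, hb.norm_eq_one]; norm_num
  simp only [inner_smul_right, inner_sub_left, inner_sub_right, inner_smul_left, conj_trivial, i1, i2,
    hb.inner_eq i j hij, hb.inner_eq j i hij.symm, hb.inner_eq v i hvi, hb.inner_eq v j hvj] at v2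
  rw [hb.inner_basis_right, hb.inner_basis_right, hsum, hsum] at v2
  rw [hUi] at oU nU v1 v2
  rw [hVj] at oV nV v1 v2
  set uv := b.repr U v
  set uj := b.repr U j
  set x := b.repr U k
  set vv := b.repr V v
  set vi := b.repr V i
  set y := b.repr V k
  have euv : uv = -c * (uj + x) := by linarith
  have evv : vv = -c * (vi + y) := by linarith
  rw [euv] at nU v1 v2
  rw [evv] at nV v1 v2
  have hA : 0 < 1 + c := by linarith
  have hd : 0 < 1 - c := by linarith
  have v1' : (1 + c) * (x + y) + c * (uj + vi) ≤ 0 := by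
    refine nonpos_of_mul_nonpos_right (a := 1 - c) ?_ hd
    linarith
  -- For `c ≥ 0`, that is `α ≤ π/2`, the first competitor is always shorter.
  have hc0 : c < 0 := by
    by_contra hcon
    have h1 : 0 < (1 + c) * (x + y) := by positivity
    have h2 := mul_nonneg (not_lt.1 hcon) (add_pos hUj hVi).le
    linarith
  set p := (1 + c) * uj + c * x with hp
  set r := (1 + c) * vi + c * y with hr'
  set K := (1 + c) / (1 - c) with hK
  have hK' : (1 - c) * K = 1 + c := by rw [hK]; field_simp
  have hP : p ^ 2 + (1 - 2 * -c) * x ^ 2 = K := by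
    refine mul_left_cancel₀ hd.ne' ?_
    rw [hK', hp]
    linear_combination (1 + c) * nU
  have hR : r ^ 2 + (1 - 2 * -c) * y ^ 2 = K := by
    refine mul_left_cancel₀ hd.ne' ?_
    rw [hK', hr']
    linear_combination (1 + c) * nV
  obtain ⟨hM, hest⟩ := vertex_estimate (e := -c) (x := x) (y := y) (P := p) (R := r) (K := K)
    (by linarith) (by linarith) hUk hVk (by linarith) hP hR (by
      have := mul_nonneg_of_nonpos_of_nonpos v1' (show -(1 + c) ≤ 0 by linarith)
      rw [hp, hr']
      linarith)
  have hM' : 0 < (1 - c) * (y * p + x * r) := mul_pos hd hM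
  have v3 := (Real.le_sqrt' hM').1 (le_trans (le_of_eq (by rw [hp, hr']; ring)) v2)
  have hxy := mul_pos hUk hVk
  have h5 : (1 - c) * (y * p + x * r) ^ 2 = (1 + c) * (x ^ 2 + y ^ 2)
      + 2 * (x * y) * ((1 - c) * (p * r - (1 - 2 * -c) * (x * y))) := by
    linear_combination (1 - c) * y ^ 2 * hP + (1 - c) * x ^ 2 * hR + (x ^ 2 + y ^ 2) * hK'
  have h6 := mul_lt_mul_of_pos_left hest (mul_pos (mul_pos two_pos hxy) hd)
  have h7 : ((1 - c) * (y * p + x * r)) ^ 2 = (1 - c) * ((1 - c) * (y * p + x * r) ^ 2) := by ring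
  rw [h7, h5] at v3
  linarith

/-- The local shape of a geodesic at a time `t`: straight in a face, or crossing an edge. -/
theorem IsTetGeodesic.exists_germs (hb : IsRegularBasis b c) (h : IsTetGeodesic b γ) (t : ℝ) :
    ∃ i j U V δ, Germ b γ t (-1) i U δ ∧ Germ b γ t 1 j V δ ∧
      (∀ k, k ≠ i → k ≠ j → 0 < b.repr (γ t) k ∧ inner ℝ U (b k) + inner ℝ V (b k) = 0) ∧
      (i = j → U = -V) ∧ (i ≠ j → 0 < b.repr U j ∧ 0 < b.repr V i) := by
  obtain ⟨j, V, δ, hr⟩ := h.exists_germ_right t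
  obtain ⟨i, U, δ', hl⟩ := h.exists_germ_left t
  have hr := hr.mono (lt_min hr.pos hl.pos) (min_le_left _ _)
  have hl := hl.mono (lt_min (hr.pos.trans_le (min_le_left _ _)) hl.pos) (min_le_right δ δ')
  refine ⟨i, j, U, V, _, hl, hr, fun k hi hj => ?_, ?_, fun hij => ?_⟩
  · have hpos : 0 < b.repr (γ t) k := by
      by_cases hij : i = j
      · subst hij
        exact h.pos_of_germs hl hr hi
      · exact h.pos_of_germs_ne hb hl hr hij hi hj
    exact ⟨hpos, h.inner_add_eq_zero hl hr hi hj hpos.ne'⟩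
  · rintro rfl
    exact h.neg_of_germs hl hr
  · exact ⟨hl.repr_pos h (Or.inr rfl) (Ne.symm hij) hr.repr_eq_zero,
      hr.repr_pos h (Or.inl rfl) hij hl.repr_eq_zero⟩

end SphericalTetrahedron

/-! ### The crossing times are discrete, and the curve is a great circle between them. -/

namespace SphericalTetrahedron

open Module InnerProductGeometry Filter Topology

variable {b : Basis (Fin 4) ℝ E4} {c : ℝ} {γ : ℝ → E4}

/-- A discrete periodic subset of the line is enumerated by the integers. -/
theorem exists_int_enumeration {Z : Set ℝ} {L : ℝ} (hL : 0 < L) (hne : Z.Nonempty)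
    (hper : ∀ t, t ∈ Z ↔ t + L ∈ Z) (hfin : ∀ a b, (Z ∩ Icc a b).Finite) :
    ∃ (z : ℤ → ℝ) (m : ℕ), 0 < m ∧ StrictMono z ∧ range z = Z ∧ ∀ i, z (i + m) = z i + L := by
  classical
  letI : LocallyFiniteOrder Z := LocallyFiniteOrder.ofFiniteIcc fun x y => by
    refine Set.Finite.of_finite_image ((hfin x y).subset ?_) Subtype.val_injective.injOn
    rintro _ ⟨t, ht, rfl⟩
    exact ⟨t.2, ht⟩
  letI := LinearLocallyFiniteOrder.succOrder Z
  letI := LinearLocallyFiniteOrder.predOrder Z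
  have hper' : ∀ t, t ∈ Z → t - L ∈ Z := fun t ht => (hper _).2 (by rwa [sub_add_cancel])
  haveI : NoMaxOrder Z := ⟨fun t => ⟨⟨t + L, (hper t).1 t.2⟩, by
    rw [← Subtype.coe_lt_coe]; simpa using hL⟩⟩
  haveI : NoMinOrder Z := ⟨fun t => ⟨⟨t - L, hper' t t.2⟩, by
    rw [← Subtype.coe_lt_coe]; simpa using hL⟩⟩
  haveI : Nonempty Z := hne.to_subtype
  let e : Z ≃o ℤ := orderIsoIntOfLinearSuccPredArch
  let τ : Z ≃o Z :=
    { toFun := fun t => ⟨t + L, (hper t).1 t.2⟩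
      invFun := fun t => ⟨t - L, hper' t t.2⟩
      left_inv := fun t => by simp
      right_inv := fun t => by simp
      map_rel_iff' := by intro s t; simp [← Subtype.coe_le_coe] }
  -- The translation by `L` becomes an order automorphism of `ℤ`, which is a translation by an
  -- integer.
  let f : ℤ ≃o ℤ := (e.symm.trans τ).trans e
  have hf : ∀ n, f n = f 0 + n := by
    have hsucc : ∀ n, f (n + 1) = f n + 1 := fun n => by
      simpa [Order.succ_eq_add_one] using f.map_succ n
    intro n
    induction n using Int.induction_on with
    | zero => simp
    | succ n ih => rw [hsucc, ih]; ring
    | pred n ih =>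
      have := hsucc (-(n : ℤ) - 1)
      rw [sub_add_cancel, ih] at this
      linarith
  have hfz : ∀ i, ((e.symm (f i) : Z) : ℝ) = (e.symm i : ℝ) + L := by
    intro i
    simp [f, τ]
  have hmono : StrictMono fun i : ℤ => ((e.symm i : Z) : ℝ) :=
    (Subtype.strictMono_coe _).comp e.symm.strictMono
  have hf0 : 0 < f 0 := by
    refine hmono.lt_iff_lt.1 ?_
    show ((e.symm 0 : Z) : ℝ) < (e.symm (f 0) : Z)
    rw [hfz]
    linarith
  refine ⟨fun i => (e.symm i : Z), (f 0).toNat, by omega, hmono, ?_, fun i => ?_⟩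
  · ext t
    constructor
    · rintro ⟨i, rfl⟩
      exact (e.symm i).2
    · intro ht
      exact ⟨e ⟨t, ht⟩, by simp⟩
  · show ((e.symm (i + (f 0).toNat) : Z) : ℝ) = _
    rw [Int.toNat_of_nonneg hf0.le, add_comm i, ← hf, hfz]

theorem great_congr {x v x' v' : E4} {a a' r s : ℝ} (hrs : Real.sin (s - r) ≠ 0)
    (hr : great x v (r - a) = great x' v' (r - a')) (hs : great x v (s - a) = great x' v' (s - a'))
    (t : ℝ) : great x v (t - a) = great x' v' (t - a') := by
  have h1 := sin_smul_great x v (r - a) (s - a) (t - a)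
  have h2 := sin_smul_great x' v' (r - a') (s - a') (t - a')
  simp only [sub_sub_sub_cancel_right] at h1 h2
  rw [hr, hs, ← h2] at h1
  exact smul_right_injective E4 hrs h1

theorem exists_sin_ne_zero {p : ℝ → Prop} {t : ℝ} (h : ∀ᶠ s in 𝓝 t, p s) :
    ∃ s, p s ∧ Real.sin (s - t) ≠ 0 := by
  have h1 : ∀ᶠ s in 𝓝[>] t, s ∈ Ioo t (t + Real.pi) := Ioo_mem_nhdsGT (by linarith [Real.pi_pos])
  obtain ⟨s, hs, hs'⟩ := ((h.filter_mono nhdsWithin_le_nhds).and h1).exists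
  exact ⟨s, hs, (Real.sin_pos_of_pos_of_lt_pi (by linarith [hs'.1]) (by linarith [hs'.2])).ne'⟩

theorem great_neg (x v : E4) (t : ℝ) : great x (-v) (-t) = great x v t := by
  simp [great]

theorem exists_great_eq_add {x v : E4} {θ r s : ℝ} (h0 : 0 < θ) (hπ : θ < Real.pi) (hr : 0 < r)
    (hs : 0 < s) : ∃ ρ : ℝ, 0 < ρ ∧ ∃ τ ∈ Ioo 0 θ, r • x + s • great x v θ = ρ • great x v τ := by
  have hsin := Real.sin_pos_of_pos_of_lt_pi h0 hπ
  obtain ⟨ρ, φ, hρ, h1, h2, h3, h4⟩ := exists_polar (x := s * Real.sin θ)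
    (y := r + s * Real.cos θ) (mul_pos hs hsin)
  refine ⟨ρ, hρ, Real.pi / 2 - φ, ⟨by linarith, ?_⟩, ?_⟩
  · by_contra hcon
    have h5 : 0 < ρ * Real.sin (θ - (Real.pi / 2 - φ)) := by
      rw [Real.sin_sub, Real.cos_pi_div_two_sub, Real.sin_pi_div_two_sub]
      have : ρ * (Real.sin θ * Real.sin φ - Real.cos θ * Real.cos φ) = r * Real.sin θ := by
        linear_combination -(Real.sin θ) * h4 + Real.cos θ * h3
      rw [this]
      positivity
    have h6 := Real.sin_nonpos_of_nonpos_of_neg_pi_le (x := θ - (Real.pi / 2 - φ))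
      (by linarith) (by linarith)
    have := mul_nonpos_of_nonneg_of_nonpos hρ.le h6
    linarith
  · simp only [great, Real.cos_pi_div_two_sub, Real.sin_pi_div_two_sub, smul_add, smul_smul, ← h3,
      ← h4]
    module

/-- The times at which the curve crosses edges. -/
def crossingTimes (b : Basis (Fin 4) ℝ E4) (γ : ℝ → E4) : Set ℝ :=
  {t | ∃ g g', g ≠ g' ∧ b.repr (γ t) g = 0 ∧ b.repr (γ t) g' = 0}

theorem IsTetGeodesic.continuous_repr (h : IsTetGeodesic b γ) (k : Fin 4) :
    Continuous fun s => b.repr (γ s) k :=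
  (LinearMap.continuous_of_finiteDimensional (b.coord k)).comp h.continuous

theorem IsTetGeodesic.eventually_right (h : IsTetGeodesic b γ) {t δ : ℝ} {i j : Fin 4}
    {V : E4} (hr : Germ b γ t 1 j V δ) (hpos : ∀ k, k ≠ i → k ≠ j → 0 < b.repr (γ t) k)
    (hV : i ≠ j → 0 < b.repr V i) : ∀ᶠ s in 𝓝[>] t, γ s = great (γ t) V (s - t) ∧
      ∀ k, k ≠ j → 0 < b.repr (γ s) k := by
  have h1 : ∀ᶠ s in 𝓝[>] t, γ s = great (γ t) V (s - t) := by
    have : ∀ᶠ s in 𝓝[>] t, s ∈ Ioc t (t + δ) := Ioc_mem_nhdsGT (by linarith [hr.pos])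
    filter_upwards [this] with s hs
    have := hr.eq_great (s - t) (by linarith [hs.1]) (by linarith [hs.2])
    rwa [show t + 1 * (s - t) = s by ring] at this
  have h2 : ∀ᶠ s in 𝓝[>] t, s ∈ Ioo t (t + Real.pi) := Ioo_mem_nhdsGT (by linarith [Real.pi_pos])
  have h3 : ∀ᶠ s in 𝓝[>] t, ∀ k, k ≠ j → 0 < b.repr (γ s) k := by
    rw [eventually_all]
    intro k
    by_cases hk : 0 < b.repr (γ t) k
    · have : ∀ᶠ s in 𝓝 t, 0 < b.repr (γ s) k :=
        (h.continuous_repr k).continuousAt.eventually (lt_mem_nhds hk)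
      filter_upwards [this.filter_mono nhdsWithin_le_nhds] with s hs _
      exact hs
    · filter_upwards [h1, h2] with s hs hs' hkj
      have hki : k = i := by
        by_contra hki
        exact hk (hpos k hki hkj)
      subst hki
      have hz : b.repr (γ t) k = 0 := le_antisymm (not_lt.1 hk) (h.nonneg t k)
      rw [hs, repr_great, hz, mul_zero, zero_add]
      exact mul_pos (Real.sin_pos_of_pos_of_lt_pi (by linarith [hs'.1]) (by linarith [hs'.2]))
        (hV hkj)
  exact h1.and h3

theorem Germ.reverse {t δ : ℝ} {f : Fin 4} {V : E4} (h : Germ b γ t (-1) f V δ) :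
    Germ b (fun s => γ (-s)) (-t) 1 f V δ := by
  refine ⟨h.pos, h.norm_eq_one, by simpa using h.inner_eq_zero, by simpa using h.repr_eq_zero,
    h.repr_dir, fun s h0 h1 => ?_⟩
  have := h.eq_great s h0 h1
  simp only [neg_neg]
  rw [← this]
  congr 1
  ring

theorem IsTetGeodesic.eventually_left (h : IsTetGeodesic b γ) {t δ : ℝ} {i j : Fin 4}
    {U : E4} (hl : Germ b γ t (-1) i U δ) (hpos : ∀ k, k ≠ i → k ≠ j → 0 < b.repr (γ t) k)
    (hU : i ≠ j → 0 < b.repr U j) : ∀ᶠ s in 𝓝[<] t, γ s = great (γ t) (-U) (s - t) ∧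
      ∀ k, k ≠ i → 0 < b.repr (γ s) k := by
  have := h.reverse.eventually_right (i := j) hl.reverse
    (fun k h1 h2 => by simpa using hpos k h2 h1) (fun h1 => hU h1.symm)
  have h2 : Tendsto (fun s : ℝ => -s) (𝓝[<] t) (𝓝[>] (-t)) := by
    have := tendsto_neg_nhdsLT (a := t)
    exact this
  filter_upwards [h2.eventually this] with s hs
  simp only [neg_neg] at hs
  refine ⟨?_, hs.2⟩
  rw [hs.1, ← great_neg]
  congr 1
  ring

/-- Shortly before and after `t`, only the coordinate belonging to the face of the germ vanishes. -/
theorem IsTetGeodesic.eventually_notMem_crossingTimes (hb : IsRegularBasis b c)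
    (h : IsTetGeodesic b γ) (t : ℝ) : ∀ᶠ s in 𝓝[≠] t, s ∉ crossingTimes b γ := by
  obtain ⟨i, j, U, V, δ, hl, hr, hpos, -, hne⟩ := h.exists_germs hb t
  have key : ∀ s f, (∀ k, k ≠ f → 0 < b.repr (γ s) k) → s ∉ crossingTimes b γ := by
    rintro s f hs ⟨g, g', hg, h1, h2⟩
    by_cases hf : g = f
    · exact (hs g' (by rintro rfl; exact hg hf)).ne' h2
    · exact (hs g hf).ne' h1
  rw [← nhdsLT_sup_nhdsGT, eventually_sup]
  constructor
  · filter_upwards [h.eventually_left hl (fun k a1 a2 => (hpos k a1 a2).1) fun a => (hne a).1]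
      with s hs using key s i hs.2
  · filter_upwards [h.eventually_right hr (fun k a1 a2 => (hpos k a1 a2).1) fun a => (hne a).2]
      with s hs using key s j hs.2

theorem IsTetGeodesic.finite_crossingTimes (hb : IsRegularBasis b c) (h : IsTetGeodesic b γ)
    (u v : ℝ) : (crossingTimes b γ ∩ Icc u v).Finite := by
  by_contra hinf
  obtain ⟨t, -, ht⟩ := Set.Infinite.exists_accPt_of_subset_isCompact hinf isCompact_Icc
    inter_subset_right
  rw [accPt_iff_frequently_nhdsNE] at ht
  obtain ⟨s, hs, hs'⟩ := (ht.and_eventually (h.eventually_notMem_crossingTimes hb t)).exists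
  exact hs' hs.1

theorem IsTetGeodesic.eventually_eq_great (hb : IsRegularBasis b c) (h : IsTetGeodesic b γ) {t : ℝ}
    (ht : t ∉ crossingTimes b γ) : ∃ x v, ∀ᶠ s in 𝓝 t, γ s = great x v (s - t) := by
  obtain ⟨i, j, U, V, δ, hl, hr, hpos, heq, -⟩ := h.exists_germs hb t
  have hij : i = j := by
    by_contra hij
    exact ht ⟨i, j, hij, hl.repr_eq_zero, hr.repr_eq_zero⟩
  have hUV := heq hij
  refine ⟨γ t, V, ?_⟩
  have : ∀ᶠ s in 𝓝 t, s ∈ Ioo (t - δ) (t + δ) :=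
    Ioo_mem_nhds (by linarith [hr.pos]) (by linarith [hr.pos])
  filter_upwards [this] with s hs
  rcases le_total t s with hts | hts
  · have := hr.eq_great (s - t) (by linarith) (by linarith [hs.2])
    rwa [show t + 1 * (s - t) = s by ring] at this
  · have := hl.eq_great (t - s) (by linarith) (by linarith [hs.1])
    rw [show t + -1 * (t - s) = s by ring, hUV] at this
    rw [this, ← great_neg]
    simp

/-- Between two consecutive edges a geodesic is an arc of a great circle. -/
theorem IsTetGeodesic.eq_great (hb : IsRegularBasis b c) (h : IsTetGeodesic b γ) {u v δ : ℝ}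
    {f : Fin 4} {V : E4} (huv : u < v) (hr : Germ b γ u 1 f V δ)
    (hI : ∀ t ∈ Ioo u v, t ∉ crossingTimes b γ) :
    ∀ t ∈ Icc u v, γ t = great (γ u) V (t - u) := by
  set A : Set ℝ := {t | ∀ᶠ s in 𝓝 t, γ s = great (γ u) V (s - u)} with hA
  -- The set `A` is open and meets the interval. It is relatively closed there, since great circles
  -- agreeing at two times that do not differ by a multiple of `π` are equal.
  have hsub : Ioo u v ⊆ A := by
    refine isPreconnected_Ioo.subset_of_closure_inter_subset ?_ ?_ ?_
    · rw [isOpen_iff_mem_nhds]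
      exact fun t ht => eventually_eventually_nhds.2 ht
    · have hδ := hr.pos
      set η := min δ (v - u) with hη
      have hη0 : 0 < η := lt_min hδ (by linarith)
      have hη1 : η ≤ δ := min_le_left _ _
      have hη2 : η ≤ v - u := min_le_right _ _
      refine ⟨u + η / 2, ⟨by linarith, by linarith⟩, ?_⟩
      have : ∀ᶠ s in 𝓝 (u + η / 2), s ∈ Ioo u (u + δ) := Ioo_mem_nhds (by linarith) (by linarith)
      filter_upwards [this] with s hs
      have := hr.eq_great (s - u) (by linarith [hs.1]) (by linarith [hs.2])
      rwa [show u + 1 * (s - u) = s by ring] at this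
    · rintro t ⟨ht, htI⟩
      obtain ⟨x, w, hx⟩ := h.eventually_eq_great hb (hI t htI)
      obtain ⟨t', h1, h2⟩ := ((mem_closure_iff_frequently.1 ht).and_eventually
        (eventually_eventually_nhds.2 hx)).exists
      have h3 : ∀ᶠ s in 𝓝 t', great (γ u) V (s - u) = great x w (s - t) := by
        filter_upwards [h1, h2] with s a1 a2
        rw [← a1, a2]
      obtain ⟨s, hs, hs'⟩ := exists_sin_ne_zero h3
      have h4 := great_congr hs' h3.self_of_nhds hs
      filter_upwards [hx] with r hr
      rw [hr, h4]
  have hcl : IsClosed {t | γ t = great (γ u) V (t - u)} :=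
    isClosed_eq h.continuous ((continuous_great _ _).comp (continuous_id.sub continuous_const))
  have h5 : closure (Ioo u v) ⊆ {t | γ t = great (γ u) V (t - u)} :=
    closure_minimal (fun t ht => (hsub ht).self_of_nhds) hcl
  rw [closure_Ioo huv.ne] at h5
  exact h5

end SphericalTetrahedron

/-! ### From a simple closed geodesic to a crossing sequence. -/

namespace SphericalTetrahedron

open Module InnerProductGeometry Filter Topology

variable {b : Basis (Fin 4) ℝ E4} {c : ℝ} {γ : ℝ → E4}

theorem strand_eq_great {z : ℤ → ℝ} {P : ℤ → E4} {i : ℤ} {v : E4}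
    (h : great (P i) v (z (i + 1) - z i) = P (i + 1)) (hs : 0 < Real.sin (z (i + 1) - z i)) (t : ℝ) :
    strand z P i t = great (P i) v (t - z i) := by
  have := sin_smul_great (P i) v 0 (z (i + 1) - z i) (t - z i)
  rw [great_zero, h, sub_zero, sub_zero, sub_sub_sub_cancel_right] at this
  rw [strand, ← this, smul_smul, inv_mul_cancel₀ hs.ne', one_smul]

/-- A simple closed geodesic determines a crossing sequence. -/
theorem IsTetGeodesic.exists_crossingSequence (hb : IsRegularBasis b c) (h : IsTetGeodesic b γ)
    {L : ℝ} (hL : 0 < L) (hper : Function.Periodic γ L)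
    (hsimple : ∀ u v, γ u = γ v → ∃ n : ℤ, v = u + n * L) (hne : (crossingTimes b γ).Nonempty) :
    ∃ m z P F, CrossingSequence b m L z P F ∧ ∀ g g', g ≠ g' →
      {x | OnEdge P F g g' x} = {x ∈ range γ | b.repr x g = 0 ∧ b.repr x g' = 0} := by
  obtain ⟨z, m, hm, hz, hrange, hzm⟩ := exists_int_enumeration hL hne
    (fun t => by simp only [crossingTimes, mem_setOf_eq, hper t]) (h.finite_crossingTimes hb)
  have hgerm := fun i => h.exists_germs hb (z i)
  choose I J U V δ hl hr hpos heq hIJ using hgerm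
  have hzlt : ∀ i, z i < z (i + 1) := fun i => hz (by linarith)
  have hmem : ∀ i, z i ∈ crossingTimes b γ := fun i => hrange ▸ mem_range_self i
  have hne' : ∀ i, I i ≠ J i := by
    intro i hij
    obtain ⟨g, g', hg, h1, h2⟩ := hmem i
    by_cases hf : g = I i
    · have hg' : g' ≠ I i := fun h => hg (hf.trans h.symm)
      exact (hpos i g' hg' (hij ▸ hg')).1.ne' h2
    · exact (hpos i g hf (hij ▸ hf)).1.ne' h1
  have hgap : ∀ i, ∀ t ∈ Ioo (z i) (z (i + 1)), t ∉ crossingTimes b γ := by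
    intro i t ht hmt
    rw [← hrange] at hmt
    obtain ⟨j, rfl⟩ := hmt
    have h1 := hz.lt_iff_lt.1 ht.1
    have h2 := hz.lt_iff_lt.1 ht.2
    omega
  have harc : ∀ i, ∀ t ∈ Icc (z i) (z (i + 1)), γ t = great (γ (z i)) (V i) (t - z i) :=
    fun i => h.eq_great hb (hzlt i) (hr i) (hgap i)
  have hend : ∀ i, great (γ (z i)) (V i) (z (i + 1) - z i) = γ (z (i + 1)) := fun i =>
    (harc i _ ⟨(hzlt i).le, le_rfl⟩).symm
  have hface : ∀ i, ∀ t ∈ Icc (z i) (z (i + 1)), b.repr (γ t) (J i) = 0 := by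
    intro i t ht
    rw [harc i t ht, repr_great, (hr i).repr_eq_zero, (hr i).repr_dir]
    ring
  -- Just before `z (i + 1)` the curve is interior to the face by which it arrives, and it also lies
  -- in the face `J i`.
  have hnext : ∀ i, I (i + 1) = J i := by
    intro i
    have h1 := h.eventually_left (hl (i + 1)) (fun k a1 a2 => (hpos (i + 1) k a1 a2).1)
      fun a => (hIJ (i + 1) a).1
    have h2 : ∀ᶠ s in 𝓝[<] z (i + 1), s ∈ Ioo (z i) (z (i + 1)) := Ioo_mem_nhdsLT (hzlt i)
    obtain ⟨s, hs, hs'⟩ := (h1.and h2).exists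
    by_contra hcon
    exact (hs.2 (J i) (Ne.symm hcon)).ne' (hface i s ⟨hs'.1.le, hs'.2.le⟩)
  have hprev : ∀ i, I i = J (i - 1) := fun i => by
    have := hnext (i - 1)
    rwa [sub_add_cancel] at this
  -- After the time `π` the great circle would be at `-γ (z i)`, where the positive coordinates have
  -- become negative.
  have hlt : ∀ i, z (i + 1) < z i + Real.pi := by
    intro i
    by_contra hcon
    obtain ⟨k, hk1, hk2⟩ : ∃ k : Fin 4, k ≠ I i ∧ k ≠ J i := by
      generalize I i = x
      generalize J i = y
      revert x y
      decide
    have h1 := h.nonneg (z i + Real.pi) k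
    rw [harc i (z i + Real.pi) ⟨by linarith [Real.pi_pos], not_lt.1 hcon⟩, add_sub_cancel_left,
      repr_great] at h1
    simp only [Real.cos_pi, Real.sin_pi] at h1
    linarith [(hpos i k hk1 hk2).1]
  have hsin : ∀ i, 0 < Real.sin (z (i + 1) - z i) := fun i =>
    Real.sin_pos_of_pos_of_lt_pi (by linarith [hzlt i]) (by linarith [hlt i])
  have hzmul : ∀ i n : ℤ, z (i + n * m) = z i + n * L := by
    intro i n
    induction n using Int.induction_on with
    | zero => simp
    | succ n ih =>
      rw [show i + ((n : ℤ) + 1) * m = (i + n * m) + m by ring, hzm, ih]; push_cast; ring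
    | pred n ih =>
      have := hzm (i + (-(n : ℤ) - 1) * m)
      rw [show i + (-(n : ℤ) - 1) * m + m = i + -(n : ℤ) * m by ring, ih] at this
      push_cast at this ⊢; linarith
  have hPm : ∀ i, γ (z (i + m)) = γ (z i) := fun i => by rw [hzm, hper]
  have hstrand : ∀ i t, strand z (fun i => γ (z i)) i t = great (γ (z i)) (V i) (t - z i) :=
    fun i t => strand_eq_great (hend i) (hsin i) t
  have hstrand' : ∀ i t, strand z (fun i => γ (z i)) (i - 1) t =
      great (γ (z i)) (-U i) (t - z i) := by
    intro i t
    have e1 : i - 1 + 1 = i := by ring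
    have h1 := h.eventually_left (hl i) (fun k a1 a2 => (hpos i k a1 a2).1) fun a => (hIJ i a).1
    have h2 : ∀ᶠ s in 𝓝[<] z i, s ∈ Ioo (z (i - 1)) (z i) := by
      have := hzlt (i - 1)
      rw [e1] at this
      exact Ioo_mem_nhdsLT this
    obtain ⟨s, hs, hs'⟩ := (h1.and h2).exists
    have hbd := hlt (i - 1)
    rw [e1] at hbd
    rw [hstrand]
    refine great_congr (r := s) (s := z i) ?_ ?_ ?_ t
    · exact (Real.sin_pos_of_pos_of_lt_pi (by linarith [hs'.2]) (by linarith [hs'.1])).ne'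
    · rw [← hs.1]
      exact (harc (i - 1) s ⟨hs'.1.le, by rw [e1]; exact hs'.2.le⟩).symm
    · have := hend (i - 1)
      rw [e1] at this
      rw [this, sub_self, great_zero]
  have hPinj : ∀ i j, γ (z i) = γ (z j) → (m : ℤ) ∣ i - j := by
    intro i j hij
    obtain ⟨n, hn⟩ := hsimple _ _ hij
    rw [← hzmul] at hn
    exact ⟨-n, by rw [hz.injective hn]; ring⟩
  -- A point strictly between two crossings lies in only one face.
  have hJm : ∀ i, J (i + m) = J i := by
    intro i
    set t := (z i + z (i + 1)) / 2 with ht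
    have h1 := hzlt i
    have h2 := hface i t ⟨by linarith, by linarith⟩
    have h3 := hface (i + m) (t + L) ⟨by rw [hzm]; linarith, by
      rw [show i + m + 1 = i + 1 + m by ring, hzm]; linarith⟩
    rw [hper t] at h3
    by_contra hcon
    exact hgap i t ⟨by linarith, by linarith⟩ ⟨_, _, hcon, h3, h2⟩
  refine ⟨m, z, fun i => γ (z i), J, ⟨hm, hzlt, hlt, hzm, hPm, hJm, fun i => h.norm_eq_one _,
    ?_, ?_, fun i => (hr i).repr_eq_zero, ?_, ?_, ?_, ?_, hPinj, ?_⟩, ?_⟩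
  · intro i k h1 h2
    rw [← hprev] at h1
    exact (hpos i k h1 h2).1
  · intro i
    rw [← hprev]
    exact (hl i).repr_eq_zero
  · intro i
    rw [← hprev]
    exact (hne' i).symm
  · intro i hi
    have h1 := (hIJ i (hne' i)).2
    have h2 : b.repr (γ (z (i + 1))) (I i) = 0 := by
      rw [hprev, ← hi]
      exact (hr (i + 1)).repr_eq_zero
    rw [← hend i, repr_great, (hl i).repr_eq_zero, mul_zero, zero_add] at h2
    exact (mul_pos (hsin i) h1).ne' h2
  · intro i
    show inner ℝ (γ (z i)) (γ (z (i + 1))) = _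
    rw [← hend i, real_inner_comm, inner_great, real_inner_self_eq_norm_sq, h.norm_eq_one,
      real_inner_comm, (hr i).inner_eq_zero]
    ring
  · intro i k h1 h2 t
    rw [← hprev] at h1
    have h3 := (hpos i k h1 h2).2
    rw [hstrand', hstrand i, inner_great, inner_great, inner_neg_left]
    linear_combination -(Real.sin (t - z i)) * h3
  -- Both sides are positive multiples of `γ` at interior times of the two arcs. By simplicity these
  -- times differ by a multiple of `L`, so up to whole periods the arcs are the same.
  · intro i j r s u v h1 h2 h3 h4 he
    simp only [← hend] at he
    obtain ⟨ρ, hρ, τ, hτ, e1⟩ := exists_great_eq_add (x := γ (z i)) (v := V i)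
      (show 0 < z (i + 1) - z i by linarith [hzlt i]) (by linarith [hlt i]) h1 h2
    obtain ⟨ρ', hρ', τ', hτ', e2⟩ := exists_great_eq_add (x := γ (z j)) (v := V j)
      (show 0 < z (j + 1) - z j by linarith [hzlt j]) (by linarith [hlt j]) h3 h4
    have g1 := harc i (z i + τ) ⟨by linarith [hτ.1], by linarith [hτ.2]⟩
    have g2 := harc j (z j + τ') ⟨by linarith [hτ'.1], by linarith [hτ'.2]⟩
    rw [add_sub_cancel_left] at g1 g2
    rw [e1, e2, ← g1, ← g2] at he
    have hn := congrArg norm he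
    rw [norm_smul, norm_smul, h.norm_eq_one, h.norm_eq_one, Real.norm_of_nonneg hρ.le,
      Real.norm_of_nonneg hρ'.le, mul_one, mul_one] at hn
    rw [hn] at he
    obtain ⟨n, hn'⟩ := hsimple _ _ (smul_right_injective E4 hρ'.ne' he)
    have a1 : z (i + n * m) < z (j + 1) := by rw [hzmul]; linarith [hτ.1, hτ'.2]
    have a2 : z j < z (i + 1 + n * m) := by rw [hzmul]; linarith [hτ.2, hτ'.1]
    have b1 := hz.lt_iff_lt.1 a1
    have b2 := hz.lt_iff_lt.1 a2
    exact ⟨-n, by linarith [show j = i + n * m by omega]⟩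
  · intro g g' hg
    ext x
    constructor
    · rintro ⟨i, rfl, ⟨rfl, rfl⟩ | ⟨rfl, rfl⟩⟩
      · exact ⟨mem_range_self _, by rw [← hprev]; exact (hl i).repr_eq_zero, (hr i).repr_eq_zero⟩
      · exact ⟨mem_range_self _, (hr i).repr_eq_zero, by rw [← hprev]; exact (hl i).repr_eq_zero⟩
    · rintro ⟨⟨t, rfl⟩, h1, h2⟩
      have ht : t ∈ crossingTimes b γ := ⟨g, g', hg, h1, h2⟩
      rw [← hrange] at ht
      obtain ⟨i, rfl⟩ := ht
      refine ⟨i, rfl, ?_⟩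
      rw [← hprev]
      have k1 : g = I i ∨ g = J i := by
        by_contra! hcon
        exact (hpos i g hcon.1 hcon.2).1.ne' h1
      have k2 : g' = I i ∨ g' = J i := by
        by_contra! hcon
        exact (hpos i g' hcon.1 hcon.2).1.ne' h2
      rcases k1 with rfl | rfl <;> rcases k2 with rfl | rfl
      · exact absurd rfl hg
      · exact Or.inl ⟨rfl, rfl⟩
      · exact Or.inr ⟨rfl, rfl⟩
      · exact absurd rfl hg

end SphericalTetrahedron

/-! ### Relabelling of the vertices, the planar angle, and the conclusion. -/

namespace SphericalTetrahedron

open Module InnerProductGeometry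

variable {b : Basis (Fin 4) ℝ E4} {c : ℝ} {γ : ℝ → E4}

theorem mem_edge_iff {g g' k l : Fin 4} (h : ∀ j, j = g ∨ j = g' ∨ j = k ∨ j = l) (hgg : g ≠ g')
    (hkl : k ≠ l) (hgk : g ≠ k) (hgl : g ≠ l) (hgk' : g' ≠ k) (hgl' : g' ≠ l) {x : E4} :
    x ∈ edge b k l ↔ ‖x‖ = 1 ∧ (∀ j, 0 ≤ b.repr x j) ∧ b.repr x g = 0 ∧ b.repr x g' = 0 := by
  constructor
  · rintro ⟨h1, s, t, hs, ht, rfl⟩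
    refine ⟨h1, fun j => ?_, ?_, ?_⟩
    · simp only [map_add, map_smul, b.repr_self, Finsupp.add_apply, Finsupp.smul_apply,
        Finsupp.single_apply, smul_eq_mul]
      split_ifs <;> simp [hs, ht, add_nonneg]
    · simp [Finsupp.single_apply, hgk.symm, hgl.symm]
    · simp [Finsupp.single_apply, hgk'.symm, hgl'.symm]
  · rintro ⟨h1, h2, h3, h4⟩
    refine ⟨h1, b.repr x k, b.repr x l, h2 k, h2 l, b.ext_elem fun j => ?_⟩
    rcases h j with rfl | rfl | rfl | rfl
    · simp [Finsupp.single_apply, hgk.symm, hgl.symm, h3]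
    · simp [Finsupp.single_apply, hgk'.symm, hgl'.symm, h4]
    · simp [Finsupp.single_apply, hkl.symm]
    · simp [Finsupp.single_apply, hkl]

theorem crossings_eq_inter_edge (hγ : ∀ t, γ t ∈ surface b) {g g' k l : Fin 4}
    (h : ∀ j, j = g ∨ j = g' ∨ j = k ∨ j = l) (hgg : g ≠ g')
    (hkl : k ≠ l) (hgk : g ≠ k) (hgl : g ≠ l) (hgk' : g' ≠ k) (hgl' : g' ≠ l) :
    {x ∈ range γ | b.repr x g = 0 ∧ b.repr x g' = 0} = range γ ∩ edge b k l := by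
  ext x
  constructor
  · rintro ⟨⟨t, rfl⟩, h1, h2⟩
    obtain ⟨h3, f, h4⟩ := mem_surface_iff.1 (hγ t)
    exact ⟨mem_range_self t, (mem_edge_iff h hgg hkl hgk hgl hgk' hgl').2 ⟨h3, h4.2, h1, h2⟩⟩
  · rintro ⟨h1, h2⟩
    exact ⟨h1, ((mem_edge_iff h hgg hkl hgk hgl hgk' hgl').1 h2).2.2⟩

theorem surface_comp (A : Fin 4 → E4) (σ : Equiv.Perm (Fin 4)) : surface (A ∘ σ) = surface A := by
  have hface : ∀ i, face (A ∘ σ) i = face A (σ i) := by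
    intro i
    ext x
    constructor
    · rintro ⟨h1, t, h2, h3, rfl⟩
      refine ⟨h1, t ∘ σ.symm, fun j => h2 _, by simpa using h3, ?_⟩
      rw [← Equiv.sum_comp σ fun j => (t ∘ σ.symm) j • A j]
      simp
    · rintro ⟨h1, t, h2, h3, rfl⟩
      refine ⟨h1, t ∘ σ, fun j => h2 _, h3, ?_⟩
      rw [← Equiv.sum_comp σ]
      simp
  simp only [surface, hface]
  exact σ.surjective.iUnion_comp (face A)

/-- The spherical cosine rule `cos α = c / (1 + c)`, in a form without division: the tangential edge
vectors have squared length `1 - c²` and inner product `c - c²`. -/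
theorem IsRegularTetrahedron.cos_eq {A : Fin 4 → E4} {α : ℝ} (hA : IsRegularTetrahedron A α) :
    ∃ c, (∀ i j, i ≠ j → inner ℝ (A i) (A j) = c) ∧ Real.cos α * (1 + c) * (1 - c) = c * (1 - c) := by
  have hc : ∀ i j, i ≠ j → inner ℝ (A i) (A j) = (inner ℝ (A 0) (A 1) : ℝ) := by
    intro i j hij
    have h1 := hA.edges_equal i j 0 1 hij (by decide)
    have h2 := congrArg Real.cos h1
    rwa [cos_angle, cos_angle, hA.norm_eq_one, hA.norm_eq_one, hA.norm_eq_one, hA.norm_eq_one,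
      one_mul, div_one, div_one] at h2
  set c : ℝ := inner ℝ (A 0) (A 1) with hcdef
  refine ⟨c, hc, ?_⟩
  have h1 := hA.planar_angle 0 1 2 (by decide) (by decide) (by decide)
  have e : ∀ i, inner ℝ (A i) (A i) = (1 : ℝ) := fun i => by
    rw [real_inner_self_eq_norm_sq, hA.norm_eq_one]; norm_num
  have h2 := cos_angle_mul_norm_mul_norm (A 1 - inner ℝ (A 0) (A 1) • A 0)
    (A 2 - inner ℝ (A 0) (A 2) • A 0)
  have hn : ∀ i, i ≠ 0 → ‖A i - inner ℝ (A 0) (A i) • A 0‖ ^ 2 = 1 - c ^ 2 := by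
    intro i hi
    rw [norm_sub_sq_real, norm_smul, inner_smul_right, hc 0 i hi.symm, hc i 0 hi, hA.norm_eq_one,
      hA.norm_eq_one, Real.norm_eq_abs, mul_one, sq_abs]
    ring
  have hnn : ‖A 1 - inner ℝ (A 0) (A 1) • A 0‖ * ‖A 2 - inner ℝ (A 0) (A 2) • A 0‖ = 1 - c ^ 2 := by
    have h3 : ‖A 1 - inner ℝ (A 0) (A 1) • A 0‖ = ‖A 2 - inner ℝ (A 0) (A 2) • A 0‖ := by
      rw [← pow_left_inj₀ (norm_nonneg _) (norm_nonneg _) two_ne_zero, hn 1 (by decide),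
        hn 2 (by decide)]
    rw [h3, ← sq, hn 2 (by decide)]
  rw [sphericalAngle] at h1
  rw [hnn, h1] at h2
  simp only [inner_sub_left, inner_sub_right, inner_smul_left, inner_smul_right, conj_trivial, e,
    hc 0 1 (by decide), hc 0 2 (by decide), hc 1 2 (by decide), hc 1 0 (by decide)] at h2
  linear_combination h2

/-- The edges of a regular tetrahedron with a simple closed geodesic of type `(p, q)` are short. -/
theorem edge_bound_of_geodesic {A : Fin 4 → E4} (hn : ∀ i, ‖A i‖ = 1)
    (hli : LinearIndependent ℝ A) (hc : ∀ i j, i ≠ j → inner ℝ (A i) (A j) = c) {L : ℝ} {p q : ℕ}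
    (hp : 0 < p) (hq : 0 < q) (hγ : IsSimpleClosedGeodesic (surface A) γ L)
    (ht : HasType A γ p q) : c < 1 ∧
      2 * (1 - c) * ((p : ℝ) ^ 2 + p * q + q ^ 2) ≤ Real.pi ^ 2 := by
  obtain ⟨σ, t1, t2, t3, t4, t5, t6⟩ := ht
  -- After relabelling by `σ`, the edges met `p + q` times are the common edges of the faces `g` and
  -- `Fin.rev g`, as in `edgeCount`.
  rw [← surface_comp A σ] at hγ
  let b : Basis (Fin 4) ℝ E4 := basisOfLinearIndependentOfCardEqFinrank (b := A ∘ σ)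
    (hli.comp σ σ.injective) (by simp)
  have hbA : ⇑b = A ∘ σ := coe_basisOfLinearIndependentOfCardEqFinrank _ _
  have hb : IsRegularBasis b c := by
    refine ⟨fun i => ?_, fun i j hij => ?_⟩
    · rw [hbA]; exact hn _
    · rw [hbA]; exact hc _ _ (σ.injective.ne hij)
  rw [← hbA] at hγ
  have hset : ∀ {g g' k l : Fin 4}, (∀ j, j = g ∨ j = g' ∨ j = k ∨ j = l) → g ≠ g' → k ≠ l →
      g ≠ k → g ≠ l → g' ≠ k → g' ≠ l →
      {x ∈ range γ | b.repr x g = 0 ∧ b.repr x g' = 0} = range γ ∩ edge A (σ k) (σ l) := by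
    intro g g' k l h1 h2 h3 h4 h5 h6 h7
    rw [crossings_eq_inter_edge hγ.mem_surface h1 h2 h3 h4 h5 h6 h7, hbA]
    rfl
  have hcard : ∀ g g', g ≠ g' → {x ∈ range γ | b.repr x g = 0 ∧ b.repr x g' = 0}.encard =
      (edgeCount p q g g' : ℕ∞) := by
    have hsymm : ∀ g g', {x ∈ range γ | b.repr x g = 0 ∧ b.repr x g' = 0} =
        {x ∈ range γ | b.repr x g' = 0 ∧ b.repr x g = 0} := by
      intro g g'
      ext x
      simp only [mem_setOf_eq, and_comm]
    have hlt : ∀ g g' : Fin 4, g < g' → {x ∈ range γ | b.repr x g = 0 ∧ b.repr x g' = 0}.encard =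
        (edgeCount p q g g' : ℕ∞) := by
      intro g g' hg
      fin_cases g <;> fin_cases g' <;> first | exact absurd hg (by decide) | skip
      · exact (congrArg encard (hset (g := 0) (g' := 1) (k := 2) (l := 3) (by decide) (by decide)
          (by decide) (by decide) (by decide) (by decide) (by decide))).trans t2
      · exact (congrArg encard (hset (g := 0) (g' := 2) (k := 1) (l := 3) (by decide) (by decide)
          (by decide) (by decide) (by decide) (by decide) (by decide))).trans t4
      · exact (congrArg encard (hset (g := 0) (g' := 3) (k := 1) (l := 2) (by decide) (by decide)
          (by decide) (by decide) (by decide) (by decide) (by decide))).trans t6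
      · exact (congrArg encard (hset (g := 1) (g' := 2) (k := 0) (l := 3) (by decide) (by decide)
          (by decide) (by decide) (by decide) (by decide) (by decide))).trans t5
      · exact (congrArg encard (hset (g := 1) (g' := 3) (k := 0) (l := 2) (by decide) (by decide)
          (by decide) (by decide) (by decide) (by decide) (by decide))).trans t3
      · exact (congrArg encard (hset (g := 2) (g' := 3) (k := 0) (l := 1) (by decide) (by decide)
          (by decide) (by decide) (by decide) (by decide) (by decide))).trans t1
    intro g g' hg
    rcases lt_or_gt_of_ne hg with h | h
    · exact hlt g g' h
    · rw [hsymm, edgeCount_comm]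
      exact hlt g' g h
  have hgeo : IsTetGeodesic b γ := hγ.isTetGeodesic fun g g' hg =>
    finite_of_encard_eq_coe (hcard g g' hg)
  have hne : (crossingTimes b γ).Nonempty := by
    have h1 : {x ∈ range γ | b.repr x 0 = 0 ∧ b.repr x 3 = 0}.encard ≠ 0 := by
      rw [hcard 0 3 (by decide)]
      have : edgeCount p q 0 3 = p + q := rfl
      rw [this]
      exact_mod_cast (by omega : p + q ≠ 0)
    obtain ⟨_, ⟨t, rfl⟩, h2, h3⟩ := encard_ne_zero.1 h1
    exact ⟨t, 0, 3, by decide, h2, h3⟩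
  obtain ⟨m, z, P, F, hcs, hedge⟩ := hgeo.exists_crossingSequence hb hγ.length_pos hγ.closed
    (fun u v huv => hγ.exists_period huv) hne
  exact ⟨hb.lt_one, hcs.edge_bound hb hp hq fun g g' hg => by rw [hedge g g' hg, hcard g g' hg]⟩

end SphericalTetrahedron

theorem mainTheorem4 (p q : ℕ) (hpq : Nat.Coprime p q)
    (hdef : Real.pi ^ 2 ≤ 3 * ((p : ℝ) ^ 2 + p * q + q ^ 2))
    (α : ℝ)
    (hα : 2 * Real.arcsin (Real.sqrt (((p : ℝ) ^ 2 + p * q + q ^ 2) /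
      (4 * ((p : ℝ) ^ 2 + p * q + q ^ 2) - Real.pi ^ 2))) < α)
    (A : Fin 4 → SphericalTetrahedron.E4)
    (hA : SphericalTetrahedron.IsRegularTetrahedron A α) :
    ¬ ∃ (γ : ℝ → SphericalTetrahedron.E4) (L : ℝ),
      SphericalTetrahedron.IsSimpleClosedGeodesic (SphericalTetrahedron.surface A) γ L ∧
      SphericalTetrahedron.HasType A γ p q := by
  rintro ⟨γ, L, hγ, ht⟩
  have hπ := Real.pi_gt_three
  -- A vanishing entry makes the coprime pair `(0, 1)` or `(1, 0)`, where `hdef` would say `π² ≤ 3`.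
  have hp : 0 < p := by
    rcases Nat.eq_zero_or_pos p with rfl | h
    · rw [Nat.coprime_zero_left] at hpq
      subst hpq
      norm_num at hdef
      nlinarith
    · exact h
  have hq : 0 < q := by
    rcases Nat.eq_zero_or_pos q with rfl | h
    · rw [Nat.coprime_zero_right] at hpq
      subst hpq
      norm_num at hdef
      nlinarith
    · exact h
  obtain ⟨c, hc, hcos⟩ := hA.cos_eq
  obtain ⟨hc1, hbound⟩ := SphericalTetrahedron.edge_bound_of_geodesic hA.norm_eq_one
    hA.linearIndependent hc hp hq hγ ht
  set N : ℝ := (p : ℝ) ^ 2 + p * q + q ^ 2 with hN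
  have hN0 : 0 < N := by positivity
  have hden : 0 < 4 * N - Real.pi ^ 2 := by linarith
  have hαeq := hA.planar_angle 0 1 2 (by decide) (by decide) (by decide)
  have hα0 : 0 ≤ α := by rw [← hαeq]; exact InnerProductGeometry.angle_nonneg _ _
  have hαπ : α ≤ Real.pi := by rw [← hαeq]; exact InnerProductGeometry.angle_le_pi _ _
  have h1 : Real.sqrt (N / (4 * N - Real.pi ^ 2)) < Real.sin (α / 2) := by
    rw [← Real.arcsin_lt_iff_lt_sin' ⟨by linarith, by linarith⟩]
    linarith
  have h2 : N / (4 * N - Real.pi ^ 2) < Real.sin (α / 2) ^ 2 :=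
    (Real.sqrt_lt' (lt_of_le_of_lt (Real.sqrt_nonneg _) h1)).1 h1
  have h3 : Real.cos α * (1 + c) = c := mul_right_cancel₀ (by linarith : 1 - c ≠ 0) hcos
  have h4 : Real.sin (α / 2) ^ 2 * (2 * (1 + c)) = 1 := by
    have := Real.cos_sq (α / 2)
    rw [mul_div_cancel₀ α two_ne_zero] at this
    have h5 := Real.sin_sq_add_cos_sq (α / 2)
    have h6 : Real.sin (α / 2) ^ 2 = 1 / 2 - Real.cos α / 2 := by linarith
    rw [h6]
    linarith
  have hcpos : 0 < 1 + c := by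
    by_contra hcon
    have := mul_nonneg_of_nonpos_of_nonpos (not_lt.1 hcon) (neg_nonpos.2 (sq_nonneg (Real.sin (α / 2))))
    linarith
  rw [div_lt_iff₀ hden] at h2
  -- By `h4` this reads `2(1 + c)N < 4N - π²`, that is `π² < 2(1 - c)N`, contrary to `hbound`.
  have h5 := mul_lt_mul_of_pos_right h2 (show 0 < 2 * (1 + c) by linarith)
  have h6 : Real.sin (α / 2) ^ 2 * (4 * N - Real.pi ^ 2) * (2 * (1 + c)) = 4 * N - Real.pi ^ 2 := by
    linear_combination (4 * N - Real.pi ^ 2) * h4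
  linarith
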